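/- Let $K$ be any commutative ring (for instance $\mathbb Z$, or a field of positive characteristic). Operads and chain complexes are taken in $K$-modules. **The operad.** The commutative operad $C$ is the operad with $C(0)=0$ and, for $r\ge 1$, $C(r)=K$, the trivial representation of $\Sigma_r$ generated by the monomial $x_1\cdots x_r$; a composite of monomials is again the monomial. It is weight graded by $C_{(s)}(r)=C(r)$ if $r=s+1$ and $C_{(s)}(r)=0$ otherwise. It is connected: $C(0)=0$, $C(1)=K\cdot 1$, and $C_{(0)}$ is reduced to $K\cdot 1$ in arity one. **Reduced bar construction.** Let $P$ be a connected operad with augmentation ideal $\tilde P$. For each $n$, $\bar B(P)(n)$ is the chain complex whose component of degree $d$ is the direct sum, over the isomorphism classes of reduced $n$-trees $\tau$ with $d$ vertices (rooted trees with entries labeled by $1,\dots,n$, each vertex having at least two ingoing edges; for $n=1$ also the tree without vertices), of the tensor products $\bigotimes_{v}\Sigma \tilde P(I_v)$, where $v$ ranges over the vertices, $I_v$ is the set of ingoing edges of $v$, and $\Sigma$ is the suspension. The differential $\beta$ is the sum over the contractions of an internal edge $v\to u$, where the labels $\Sigma p_u\otimes\Sigma p_v$ are replaced by $-\Sigma(p_u\circ_v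 p_v)$, with the usual signs of permutations of suspensions. **Koszul construction and Koszul operads.** If $P$ is a connected weight graded operad, then $\bar B(P)$ inherits a weight grading, and the Koszul construction of $P$ is $$\bar K(P)_{(s)}(n)=\ker\big(\beta:\bar B_s(P)_{(s)}(n)\to \bar B_{s-1}(P)_{(s)}(n)\big),$$ placed in degree $s$, with zero differential. The operad $P$ is Koszul if the $K$-modules $P(n)$ and $\bar K(P)_{(s)}(n)$ are projective and if the inclusion $\bar K(P)(n)\hookrightarrow\bar B(P)(n)$ is a quasi-isomorphism for every $n$. **Normalized bar construction.** The simplicial bar construction with trivial coefficients of $P$ is $\bar C_d(P)=P^{\circ d}$ (sums over trees with $d$ levels); the faces $d_0$ and $d_d$ apply the augmentation $P\to I$ to the bottom and to the top level, the other faces $d_i$ apply the composition product $P\circ P\to P$ to two consecutive levels, and the degeneracies insert a level of operad units. $\bar N(P)$ is the associated normalized complex: the quotient of $\bar C_*(P)$ by the images of the degeneracies, with the differential $\sum_i(-1)^i d_i$. The levelization morphism $\bar B(P)\to\bar N(P)$ sends a labeled reduced tree with $d$ vertices to the sum, over all ways of placing its vertices on $d$ levels, one vertex on each level and compatibly with the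 tree order, of the corresponding trees with levels (the other vertices being labeled by the operad unit), with the sign of the permutation of the suspensions. **Theorem.** Over any commutative ring $K$, the commutative operad $C$ is Koszul. In particular, for every $n$, the comparison morphisms $$\bar K(C)(n)\to\bar B(C)(n)\to\bar N(C)(n)$$ (the inclusion and the levelization morphism) are well-defined morphisms of chain complexes and are both quasi-isomorphisms. -/

import Mathlib

open scoped DirectSum TensorProduct
open CategoryTheory

universe u

/-! ## Operads in modules, indexed by finite sets -/

/-- A (symmetric) operad in the category of `K`-modules, in the equivalent presentation in which
inputs are indexed by arbitrary finite sets: `obj I` is the module of operations with set of inputs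
`I`, functorial for bijections (so that `obj (Fin r)` is a representation of the symmetric group),
and `comp J p q` is the composite `p(q_i, i ∈ I)`, whose inputs are the disjoint union of the
inputs of the `q_i`. -/
structure SymmOperad (K : Type u) [CommRing K] where
  obj : (I : Type) → [Finite I] → Type u
  [acg : ∀ (I : Type) [Finite I], AddCommGroup (obj I)]
  [mod : ∀ (I : Type) [Finite I], Module K (obj I)]
  map : ∀ {I J : Type} [Finite I] [Finite J], (I ≃ J) → (obj I →ₗ[K] obj J)
  map_refl : ∀ (I : Type) [Finite I], map (Equiv.refl I) = LinearMap.id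
  map_trans : ∀ {I J L : Type} [Finite I] [Finite J] [Finite L] (e : I ≃ J) (f : J ≃ L),
    map (e.trans f) = map f ∘ₗ map e
  one : obj Unit
  comp : ∀ {I : Type} [Finite I] (J : I → Type) [∀ i, Finite (J i)],
    obj I →ₗ[K] MultilinearMap K (fun i : I => obj (J i)) (obj (Σ i, J i))
  comp_map : ∀ {I I' : Type} [Finite I] [Finite I'] (J : I → Type) [∀ i, Finite (J i)]
    (J' : I' → Type) [∀ i, Finite (J' i)] (e : I ≃ I') (f : ∀ i, J i ≃ J' (e i))
    (p : obj I) (q : ∀ i, obj (J i)) (q' : ∀ i, obj (J' i)),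
    (∀ i, q' (e i) = map (f i) (q i)) →
    comp J' (map e p) q' = map (Equiv.sigmaCongr e f) (comp J p q)
  comp_assoc : ∀ {I : Type} [Finite I] (J : I → Type) [∀ i, Finite (J i)]
    (L : ∀ i, J i → Type) [∀ i j, Finite (L i j)]
    (p : obj I) (q : ∀ i, obj (J i)) (r : ∀ i j, obj (L i j)),
    map (Equiv.sigmaAssoc L) (comp (fun x : Σ i, J i => L x.1 x.2) (comp J p q)
      (fun x => r x.1 x.2)) =
    comp (fun i => Σ j, L i j) p (fun i => comp (L i) (q i) (r i))
  one_comp : ∀ {J : Type} [Finite J] (q : obj J),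
    map (Equiv.uniqueSigma (fun _ : Unit => J)) (comp (fun _ : Unit => J) one (fun _ => q)) = q
  comp_one : ∀ {I : Type} [Finite I] (p : obj I),
    map (Equiv.sigmaUnique I (fun _ => Unit)) (comp (fun _ : I => Unit) p (fun _ => one)) = p

namespace SymmOperad

attribute [instance] SymmOperad.acg SymmOperad.mod

variable {K : Type u} [CommRing K]

/-- An operad is connected if `P(0) = 0` and `P(1) = K · 1` is free of rank one on the unit. -/
def IsConnected (P : SymmOperad K) : Prop :=
  (∀ (I : Type) [Finite I], IsEmpty I → Subsingleton (P.obj I)) ∧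
    Function.Bijective (fun c : K => c • P.one)

open Classical in
/-- The operad unit, as an operation whose only input is indexed by the one-element set `I`
(by convention `0` if `I` has not exactly one element). -/
noncomputable def unitAt (P : SymmOperad K) (I : Type) [Finite I] : P.obj I :=
  if h : Nonempty (Unit ≃ I) then P.map h.some P.one else 0

open Classical in
/-- The augmentation `P → I` of a connected operad: on a one-element set it sends `c · 1` to `c`,
on the other finite sets it vanishes. -/
noncomputable def aug (P : SymmOperad K) (I : Type) [Finite I] : P.obj I →ₗ[K] K :=
  if h : Nat.card I = 1 ∧
      Function.Bijective (LinearMap.toSpanSingleton K (P.obj I) (P.unitAt I)) then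
    (LinearEquiv.ofBijective _ h.2).symm.toLinearMap
  else 0

/-- Reindexing along an equality of finite sets. -/
def transport (P : SymmOperad K) {X : Type} {I J : Finset X} (h : I = J) :
    P.obj I →ₗ[K] P.obj J :=
  P.map (Equiv.subtypeEquivRight fun a => by rw [h])

/-! ### Weight gradings -/

/-- A weight grading `P = ⨁ₛ P₍ₛ₎` of an operad: a splitting, stable under reindexing, which is
preserved by the composition products. -/
structure WeightGrading (P : SymmOperad K) where
  wt : ℕ → ∀ (I : Type) [Finite I], Submodule K (P.obj I)
  isInternal : ∀ (I : Type) [Finite I], DirectSum.IsInternal (fun s => wt s I)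
  map_mem : ∀ {I J : Type} [Finite I] [Finite J] (e : I ≃ J) (s : ℕ) (p : P.obj I),
    p ∈ wt s I → P.map e p ∈ wt s J
  one_mem : P.one ∈ wt 0 Unit
  comp_mem : ∀ {I : Type} [Fintype I] (J : I → Type) [∀ i, Finite (J i)] (s : ℕ) (t : I → ℕ)
    (p : P.obj I) (q : ∀ i, P.obj (J i)), p ∈ wt s I → (∀ i, q i ∈ wt (t i) (J i)) →
    P.comp J p q ∈ wt (s + ∑ i, t i) (Σ i, J i)

/-- A weight graded operad is connected if `P(0) = 0`, `P(1) = K · 1`, and the component of weight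
zero is reduced to `K · 1` in arity one. -/
def WeightGrading.IsConnected {P : SymmOperad K} (w : P.WeightGrading) : Prop :=
  P.IsConnected ∧ ∀ (I : Type) [Finite I], Nat.card I ≠ 1 → w.wt 0 I = ⊥

open Classical in
/-- The canonical weight grading of an operad with `P(0) = 0`: the operations with `r` inputs
are homogeneous of weight `r - 1`. -/
noncomputable def canonicalWeight (P : SymmOperad K)
    (h0 : ∀ (I : Type) [Finite I], IsEmpty I → Subsingleton (P.obj I)) : P.WeightGrading where
  wt s I _ := if Nat.card I = s + 1 then ⊤ else ⊥
  isInternal I _ := by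
    rw [DirectSum.isInternal_submodule_iff_iSupIndep_and_iSup_eq_top]
    refine ⟨fun s => ?_, ?_⟩
    · by_cases h : Nat.card I = s + 1
      · have : (⨆ (j : ℕ) (_ : j ≠ s),
            (if Nat.card I = j + 1 then (⊤ : Submodule K (P.obj I)) else ⊥)) = ⊥ := by
          simp only [iSup_eq_bot]
          intro j hj
          rw [if_neg (by omega)]
        rw [this]; exact disjoint_bot_right
      · simp only [if_neg h]; exact disjoint_bot_left
    · rcases Nat.eq_zero_or_pos (Nat.card I) with h | h
      · have := h0 I ((Nat.card_eq_zero.1 h).resolve_right (by simpa using ‹Finite I›))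
        exact Subsingleton.elim _ _
      · refine top_le_iff.1 (le_iSup_of_le (Nat.card I - 1) ?_)
        rw [if_pos (by omega)]
  map_mem e s p hp := by
    rw [← Nat.card_congr e]
    split_ifs at hp ⊢ with h
    · trivial
    · rw [Submodule.mem_bot] at hp; simp [hp]
  one_mem := by simp
  comp_mem {I} _ J _ s t p q hp hq := by
    by_cases hI : Nat.card I = s + 1
    · by_cases hJ : ∀ i, Nat.card (J i) = t i + 1
      · rw [if_pos]
        · trivial
        · rw [Nat.card_sigma, Finset.sum_congr rfl fun i _ => hJ i, Finset.sum_add_distrib]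
          rw [Nat.card_eq_fintype_card] at hI
          simp [hI]; omega
      · push Not at hJ
        obtain ⟨i, hi⟩ := hJ
        have h1 := hq i
        rw [if_neg hi, Submodule.mem_bot] at h1
        rw [(P.comp J p).map_coord_zero i h1]
        exact Submodule.zero_mem _
    · rw [if_neg hI, Submodule.mem_bot] at hp
      simp [hp]

/-! ### The commutative operad -/

/-- The module `C(I)`: the trivial representation `K` if `I` is non-empty, and `0` if `I = ∅`. -/
def comObj (K : Type u) [CommRing K] (I : Type) : Submodule K K where
  carrier := {c | IsEmpty I → c = 0}
  add_mem' ha hb h := by rw [ha h, hb h, add_zero]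
  zero_mem' _ := rfl
  smul_mem' c x hx h := by rw [hx h, smul_zero]

theorem comObj_prod_update {I : Type} [Fintype I] [DecidableEq I] {J : I → Type}
    (q : ∀ i, comObj K (J i)) (i : I) (z : comObj K (J i)) :
    (∏ j, (Function.update q i z j).1) = z.1 * ∏ j ∈ Finset.univ \ {i}, (q j).1 := by
  rw [← Finset.prod_update_of_mem (Finset.mem_univ i) (fun j => (q j).1)]
  refine Finset.prod_congr rfl fun j _ => ?_
  by_cases hj : j = i
  · subst hj; simp
  · simp [hj]

/-- The composition product of the commutative operad is the multiplication of `K`. -/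
noncomputable def comComp (K : Type u) [CommRing K] {I : Type} [Finite I] (J : I → Type) :
    comObj K I →ₗ[K] MultilinearMap K (fun i : I => comObj K (J i)) (comObj K (Σ i, J i)) :=
  letI := Fintype.ofFinite I
  { toFun := fun p =>
      { toFun := fun q => ⟨p.1 * ∏ i, (q i).1, fun h => by
          by_cases hI : IsEmpty I
          · rw [p.2 hI, zero_mul]
          · obtain ⟨i⟩ := not_isEmpty_iff.1 hI
            have : IsEmpty (J i) := ⟨fun j => h.false ⟨i, j⟩⟩
            rw [Finset.prod_eq_zero (Finset.mem_univ i) ((q i).2 this), mul_zero]⟩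
        map_update_add' := fun q i x y => Subtype.ext (by
          simp only [Submodule.coe_add, comObj_prod_update]; ring)
        map_update_smul' := fun q i c x => Subtype.ext (by
          simp only [Submodule.coe_smul, comObj_prod_update, smul_eq_mul]; ring) }
    map_add' := fun p p' => by
      ext q; simp [add_mul]
    map_smul' := fun c p => by
      ext q; simp [mul_assoc] }

/-- Reindexing in the commutative operad: the action of bijections is trivial. -/
def comMap (K : Type u) [CommRing K] {I J : Type} (e : I ≃ J) : comObj K I →ₗ[K] comObj K J where
  toFun c := ⟨c.1, fun h => c.2 ⟨fun i => h.false (e i)⟩⟩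
  map_add' _ _ := rfl
  map_smul' _ _ := rfl

theorem comComp_coe {I : Type} [Fintype I] (J : I → Type) (p : comObj K I)
    (q : ∀ i, comObj K (J i)) : (comComp K J p q).1 = p.1 * ∏ i, (q i).1 := by
  refine congrArg (p.1 * ·) ?_
  exact Finset.prod_congr (Finset.ext fun _ => by simp) fun _ _ => rfl

/-- The commutative operad `C` (operad of commutative associative algebras without unit):
`C(r) = K` is the trivial representation, generated by the monomial `x₁ ⋯ x_r`, for `r ≥ 1`,
`C(0) = 0`, and the composite of these monomials is the monomial again. -/
noncomputable def commutative (K : Type u) [CommRing K] : SymmOperad K where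
  obj I _ := comObj K I
  map e := comMap K e
  map_refl _ := rfl
  map_trans _ _ := rfl
  one := ⟨1, fun h => (h.false ()).elim⟩
  comp J _ := comComp K J
  comp_map {I I'} _ _ J _ J' _ e f p q q' h := by
    let := Fintype.ofFinite I
    let := Fintype.ofFinite I'
    apply Subtype.ext
    change (comComp K J' (comMap K e p) q').1 = (comComp K J p q).1
    rw [comComp_coe, comComp_coe, ← e.prod_comp]
    congr 1
    exact Finset.prod_congr rfl fun i _ => by rw [h i]; rfl
  comp_assoc {I} _ J _ L _ p q r := by
    let := Fintype.ofFinite I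
    let := fun i => Fintype.ofFinite (J i)
    apply Subtype.ext
    change (comComp K (fun x : Σ i, J i => L x.1 x.2) (comComp K J p q) (fun x => r x.1 x.2)).1
      = (comComp K (fun i => Σ j, L i j) p (fun i => comComp K (L i) (q i) (r i))).1
    simp only [comComp_coe, Fintype.prod_sigma, Finset.prod_mul_distrib, mul_assoc]
  one_comp q := by
    apply Subtype.ext
    change (comComp K _ _ _).1 = _
    rw [comComp_coe]; simp
  comp_one {I} _ p := by
    let := Fintype.ofFinite I
    apply Subtype.ext
    change (comComp K _ _ _).1 = _
    rw [comComp_coe]; simp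

theorem commutative_subsingleton (I : Type) [Finite I] (h : IsEmpty I) :
    Subsingleton ((commutative K).obj I) :=
  ⟨fun a b => Subtype.ext ((a.2 h).trans (b.2 h).symm)⟩

/-- The commutative operad is weight graded by its canonical weight grading. -/
noncomputable def commutativeWeight (K : Type u) [CommRing K] : (commutative K).WeightGrading :=
  (commutative K).canonicalWeight commutative_subsingleton

/-! ### Composition along refinements of finite sets of blocks -/

/-- Every member of `I'` is contained in exactly one member of `I`. -/
def Refines {n : ℕ} (I' I : Finset (Finset (Fin n))) : Prop :=
  ∀ j ∈ I', ∃! c, c ∈ I ∧ j ⊆ c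

/-- If `I'` refines `I`, then `I'` is the disjoint union of the sets `{j ∈ I' | j ⊆ c}`, `c ∈ I`. -/
noncomputable def Refines.sigmaEquiv {n : ℕ} {I' I : Finset (Finset (Fin n))} (h : Refines I' I) :
    (Σ c : I, ↥(I'.filter (· ⊆ c.1))) ≃ I' :=
  Equiv.ofBijective (fun x => ⟨x.2.1, (Finset.mem_filter.1 x.2.2).1⟩) (by
    constructor
    · rintro ⟨⟨c, hc⟩, ⟨j, hj⟩⟩ ⟨⟨c', hc'⟩, ⟨j', hj'⟩⟩ hjj
      obtain rfl : j = j' := congrArg Subtype.val hjj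
      obtain rfl : c = c' := (h j (Finset.mem_filter.1 hj).1).unique
        ⟨hc, (Finset.mem_filter.1 hj).2⟩ ⟨hc', (Finset.mem_filter.1 hj').2⟩
      rfl
    · rintro ⟨j, hj⟩
      obtain ⟨c, hc, -⟩ := h j hj
      exact ⟨⟨⟨c, hc.1⟩, ⟨j, Finset.mem_filter.2 ⟨hj, hc.2⟩⟩⟩, rfl⟩)

/-- The composite `p(q_c, c ∈ I)`, where `q_c` has `{j ∈ I' | j ⊆ c}` as set of inputs. -/
noncomputable def subst (P : SymmOperad K) {n : ℕ} {I' I : Finset (Finset (Fin n))}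
    (h : Refines I' I) :
    P.obj I →ₗ[K] MultilinearMap K (fun c : I => P.obj ↥(I'.filter (· ⊆ c.1))) (P.obj I') :=
  (P.map h.sigmaEquiv).compMultilinearMapₗ K ∘ₗ P.comp (fun c : I => ↥(I'.filter (· ⊆ c.1)))

/-- If a family `G x` depends on a family `x` in such a way that each component `x v` occurs in
exactly one component of `G x`, on which it acts linearly, then the pure tensor of the components
of `G x` is a multilinear function of `x`. -/
noncomputable def tprodOf {V V' : Type} {M : V → Type u} {N : V' → Type u}
    [∀ v, AddCommGroup (M v)] [∀ v, Module K (M v)] [∀ w, AddCommGroup (N w)]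
    [∀ w, Module K (N w)] [DecidableEq V] (G : (∀ v, M v) → ∀ w, N w)
    (hG : ∀ v, ∃ w, (∀ x y w', w' ≠ w → G (Function.update x v y) w' = G x w') ∧
      ∀ x, ∃ L : M v →ₗ[K] N w, ∀ y, G (Function.update x v y) w = L y) :
    MultilinearMap K M (⨂[K] w, N w) :=
  MultilinearMap.mk' (fun x => PiTensorProduct.tprod K (G x))
    (fun x v y y' => by
      classical
      obtain ⟨w, h1, h2⟩ := hG v
      obtain ⟨L, hL⟩ := h2 x
      have key : ∀ y, G (Function.update x v y) = Function.update (G x) w (L y) := fun y => by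
        funext w'
        by_cases h : w' = w
        · subst h; simp [hL]
        · simp [h, h1 x y w' h]
      rw [key, key, key, map_add, MultilinearMap.map_update_add])
    (fun x v c y => by
      classical
      obtain ⟨w, h1, h2⟩ := hG v
      obtain ⟨L, hL⟩ := h2 x
      have key : ∀ y, G (Function.update x v y) = Function.update (G x) w (L y) := fun y => by
        funext w'
        by_cases h : w' = w
        · subst h; simp [hL]
        · simp [h, h1 x y w' h]
      rw [key, key, map_smul, MultilinearMap.map_update_smul])

/-! ### Reduced trees and the reduced bar construction -/

/-- A reduced `n`-tree with `d` vertices (a rooted tree whose entries are in bijection with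
`Fin n`, and such that each vertex has at least two ingoing edges), up to isomorphism.
Such a tree has no automorphism, and it is determined by the collection of the subsets
`v ⊆ Fin n` formed by the entries of the tree which lie above a given vertex. Hence we identify a
vertex with this subset. If `n = 1`, then we have the tree without vertices `↓`. -/
@[ext]
structure RTree (n d : ℕ) where
  verts : Finset (Finset (Fin n))
  card_verts : verts.card = d
  two_le : ∀ v ∈ verts, 2 ≤ v.card
  laminar : ∀ v ∈ verts, ∀ w ∈ verts, v ⊆ w ∨ w ⊆ v ∨ Disjoint v w
  root : Finset.univ ∈ verts ∨ n = 1

namespace RTree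

variable {n d : ℕ}

noncomputable instance : DecidableEq (RTree n d) := Classical.decEq _

open Classical in
/-- The set `I_v` of ingoing edges of a vertex `v`: the sources of these edges are either vertices
or entries of the tree, the latter being represented by one-element sets. -/
noncomputable def inputs (T : RTree n d) (v : Finset (Fin n)) : Finset (Finset (Fin n)) :=
  Finset.univ.filter fun c =>
    c ⊂ v ∧ (c ∈ T.verts ∨ c.card = 1) ∧ ∀ w ∈ T.verts, c ⊂ w → ¬ w ⊂ v

theorem mem_inputs {T : RTree n d} {v c : Finset (Fin n)} : c ∈ T.inputs v ↔
    c ⊂ v ∧ (c ∈ T.verts ∨ c.card = 1) ∧ ∀ w ∈ T.verts, c ⊂ w → ¬ w ⊂ v := by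
  simp [inputs]

theorem nonempty_of {T : RTree n d} {c : Finset (Fin n)} (h : c ∈ T.verts ∨ c.card = 1) :
    c.Nonempty := by
  rw [← Finset.card_pos]
  rcases h with h | h
  · have := T.two_le c h; omega
  · omega

theorem trichotomy {T : RTree n d} {c c' : Finset (Fin n)} (h : c ∈ T.verts ∨ c.card = 1)
    (h' : c' ∈ T.verts ∨ c'.card = 1) {a : Fin n} (ha : a ∈ c) (ha' : a ∈ c') :
    c = c' ∨ c ⊂ c' ∨ c' ⊂ c := by
  have : c ⊆ c' ∨ c' ⊆ c := by
    rcases h with h | h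
    · rcases h' with h' | h'
      · rcases T.laminar c h c' h' with h | h | h
        · exact Or.inl h
        · exact Or.inr h
        · exact absurd ha' (Finset.disjoint_left.1 h ha)
      · obtain ⟨b, rfl⟩ := Finset.card_eq_one.1 h'
        rw [Finset.mem_singleton] at ha'; subst ha'
        exact Or.inr (Finset.singleton_subset_iff.2 ha)
    · obtain ⟨b, rfl⟩ := Finset.card_eq_one.1 h
      rw [Finset.mem_singleton] at ha; subst ha
      exact Or.inl (Finset.singleton_subset_iff.2 ha')
  rcases this with h | h
  · rcases h.eq_or_ssubset with h | h
    · exact Or.inl h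
    · exact Or.inr (Or.inl h)
  · rcases h.eq_or_ssubset with h | h
    · exact Or.inl h.symm
    · exact Or.inr (Or.inr h)

/-- Contraction of the edge going from a vertex `v`, different from the root vertex, to the
vertex below `v`. -/
def contract (T : RTree n (d + 1)) (v : Finset (Fin n)) (hv : v ∈ T.verts)
    (hr : v ≠ Finset.univ) : RTree n d where
  verts := T.verts.erase v
  card_verts := by rw [Finset.card_erase_of_mem hv, T.card_verts]; rfl
  two_le w hw := T.two_le w (Finset.mem_of_mem_erase hw)
  laminar w hw w' hw' := T.laminar w (Finset.mem_of_mem_erase hw) w' (Finset.mem_of_mem_erase hw')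
  root := T.root.imp (fun h => Finset.mem_erase.2 ⟨hr.symm, h⟩) id

theorem refines_contract (T : RTree n (d + 1)) {v : Finset (Fin n)} (hv : v ∈ T.verts)
    (hr : v ≠ Finset.univ) (w : Finset (Fin n)) :
    Refines ((T.contract v hv hr).inputs w) (T.inputs w) := by
  intro j hj
  obtain ⟨h1, h2, h3⟩ := mem_inputs.1 hj
  have h2' : j ∈ T.verts ∨ j.card = 1 := h2.imp_left Finset.mem_of_mem_erase
  obtain ⟨a, ha⟩ := nonempty_of h2'
  refine existsUnique_of_exists_of_unique ?_ ?_
  · by_cases h : ∃ u ∈ T.verts, j ⊂ u ∧ u ⊂ w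
    · obtain ⟨u, hu, hju, huw⟩ := h
      have huv : u = v := by
        by_contra huv
        exact h3 u (Finset.mem_erase.2 ⟨huv, hu⟩) hju huw
      subst huv
      refine ⟨u, mem_inputs.2 ⟨huw, Or.inl hu, fun u' hu' huu' hu'w => ?_⟩, hju.1⟩
      exact h3 u' (Finset.mem_erase.2 ⟨huu'.ne', hu'⟩) (hju.trans huu') hu'w
    · push Not at h
      exact ⟨j, mem_inputs.2 ⟨h1, h2', h⟩, subset_rfl⟩
  · rintro c c' ⟨hc, hjc⟩ ⟨hc', hjc'⟩
    obtain ⟨c1, c2, c3⟩ := mem_inputs.1 hc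
    obtain ⟨c1', c2', c3'⟩ := mem_inputs.1 hc'
    have big : ∀ {c c' : Finset (Fin n)}, c.Nonempty → c ⊂ c' →
        (c' ∈ T.verts ∨ c'.card = 1) → c' ∈ T.verts := fun hn hlt h => h.resolve_right fun h' => by
      have := Finset.card_lt_card hlt
      have := Finset.card_pos.2 hn
      omega
    rcases trichotomy c2 c2' (hjc ha) (hjc' ha) with h | h | h
    · exact h
    · exact absurd c1' (c3 c' (big ⟨a, hjc ha⟩ h c2') h)
    · exact absurd c1 (c3' c (big ⟨a, hjc' ha⟩ h c2) h)

theorem inputs_contract (T : RTree n (d + 1)) {v : Finset (Fin n)} (hv : v ∈ T.verts)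
    (hr : v ≠ Finset.univ) {w : Finset (Fin n)} (hw : v ∈ T.inputs w) :
    T.inputs v = ((T.contract v hv hr).inputs w).filter (· ⊆ v) := by
  obtain ⟨h1, -, h3⟩ := mem_inputs.1 hw
  ext j
  rw [Finset.mem_filter, mem_inputs, mem_inputs]
  constructor
  · rintro ⟨j1, j2, j3⟩
    obtain ⟨a, ha⟩ := nonempty_of j2
    refine ⟨⟨j1.trans h1, j2.imp_left fun h => Finset.mem_erase.2 ⟨j1.ne, h⟩, ?_⟩, j1.1⟩
    intro u hu hju huw
    have hu' := Finset.mem_of_mem_erase hu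
    rcases trichotomy (Or.inl hu') (Or.inl hv) (hju.1 ha) (j1.1 ha) with h | h | h
    · exact (Finset.mem_erase.1 hu).1 h
    · exact j3 u hu' hju h
    · exact h3 u hu' h huw
  · rintro ⟨⟨j1, j2, j3⟩, hjv⟩
    have hne : j ≠ v := by
      rintro rfl
      rcases j2 with h | h
      · exact (Finset.mem_erase.1 h).1 rfl
      · have := T.two_le j hv; omega
    refine ⟨hjv.ssubset_of_ne hne, j2.imp_left Finset.mem_of_mem_erase, ?_⟩
    intro u hu hju huv
    exact j3 u (Finset.mem_erase.2 ⟨huv.ne, hu⟩) hju (huv.trans h1)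

variable (P : SymmOperad K)

/-- The treewise tensor module `τ(P̃) = ⨂_v P̃(I_v)`, where `v` ranges over the vertices of `τ`. -/
abbrev Tensor (T : RTree n d) : Type u := ⨂[K] v : T.verts, P.obj (T.inputs v)

open Classical in
/-- The labels of the tree obtained by contracting the edge issued from `v`: the vertex `w` below
`v` is labeled by the partial composite `x_w ∘_v x_v`, and the labels of the other vertices are
unchanged. (We write the partial composite as `x_w(1, …, x_v, …, 1)`; when `v` is not an ingoing
edge of `w`, then the formula reads `x_w(1, …, 1) = x_w`.) -/
noncomputable def contractLabel (T : RTree n (d + 1)) (v : Finset (Fin n)) (hv : v ∈ T.verts)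
    (hr : v ≠ Finset.univ) (x : ∀ w : T.verts, P.obj (T.inputs w))
    (w : (T.contract v hv hr).verts) : P.obj ((T.contract v hv hr).inputs w) :=
  P.subst (T.refines_contract hv hr w) (x ⟨w.1, Finset.mem_of_mem_erase w.2⟩) fun c =>
    if h : c.1 = v then
      P.transport ((T.inputs_contract hv hr (h ▸ c.2)).trans (by rw [h])) (x ⟨v, hv⟩)
    else P.unitAt _

theorem exists_parent (T : RTree n d) {v : Finset (Fin n)} (hv : v ∈ T.verts)
    (hr : v ≠ Finset.univ) : ∃ w ∈ T.verts, v ∈ T.inputs w := by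
  classical
  have huniv : Finset.univ ∈ T.verts := T.root.resolve_right fun h => by
    have h1 := T.two_le v hv
    have h2 := Finset.card_le_univ v
    rw [Fintype.card_fin] at h2
    omega
  obtain ⟨w, hw, hmin⟩ := (T.verts.filter (v ⊂ ·)).exists_min_image Finset.card
    ⟨Finset.univ, Finset.mem_filter.2 ⟨huniv, (Finset.subset_univ v).ssubset_of_ne hr⟩⟩
  rw [Finset.mem_filter] at hw
  refine ⟨w, hw.1, mem_inputs.2 ⟨hw.2, Or.inl hv, fun u hu hvu huw => ?_⟩⟩
  exact absurd (hmin u (Finset.mem_filter.2 ⟨hu, hvu⟩)) (not_le.2 (Finset.card_lt_card huw))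

theorem parent_unique (T : RTree n d) {v w w' : Finset (Fin n)} (hw : w ∈ T.verts)
    (hw' : w' ∈ T.verts) (h : v ∈ T.inputs w) (h' : v ∈ T.inputs w') : w = w' := by
  obtain ⟨h1, h2, h3⟩ := mem_inputs.1 h
  obtain ⟨h1', -, h3'⟩ := mem_inputs.1 h'
  obtain ⟨a, ha⟩ := nonempty_of h2
  rcases trichotomy (Or.inl hw) (Or.inl hw') (h1.1 ha) (h1'.1 ha) with h | h | h
  · exact h
  · exact absurd h (h3' w hw h1)
  · exact absurd h (h3 w' hw' h1')

/-- The component of the bar differential associated to an edge contraction (without its sign). -/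
noncomputable def contractMap (T : RTree n (d + 1)) (v : Finset (Fin n)) (hv : v ∈ T.verts)
    (hr : v ≠ Finset.univ) : T.Tensor P →ₗ[K] (T.contract v hv hr).Tensor P :=
  PiTensorProduct.lift (tprodOf (T.contractLabel P v hv hr) (by
    rintro ⟨v₀, hv₀⟩
    by_cases h0 : v₀ = v
    · subst h0
      obtain ⟨w, hw, hvw⟩ := T.exists_parent hv₀ hr
      have hwv : w ≠ v₀ := fun h => (mem_inputs.1 hvw).1.ne h.symm
      have hx : ∀ (x : ∀ w : T.verts, P.obj (T.inputs w)) y (w' : (T.contract v₀ hv₀ hr).verts),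
          Function.update x ⟨v₀, hv₀⟩ y ⟨w'.1, Finset.mem_of_mem_erase w'.2⟩ =
            x ⟨w'.1, Finset.mem_of_mem_erase w'.2⟩ := fun x y w' =>
        Function.update_of_ne (fun h => (Finset.mem_erase.1 w'.2).1 (congrArg Subtype.val h)) _ _
      refine ⟨⟨w, Finset.mem_erase.2 ⟨hwv, hw⟩⟩, fun x y w' hw' => ?_, fun x => ?_⟩
      · unfold contractLabel
        rw [hx]
        congr 1
        funext c
        have : c.1 ≠ v₀ := fun h => hw' (Subtype.ext
          (T.parent_unique (Finset.mem_of_mem_erase w'.2) hw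
            (Eq.subst (motive := fun z => z ∈ T.inputs w'.1) h c.2) hvw))
        rw [dif_neg this, dif_neg this]
      · refine ⟨((P.subst (T.refines_contract hv₀ hr w) (x ⟨w, hw⟩)).toLinearMap
          (fun c => P.unitAt _) ⟨v₀, hvw⟩) ∘ₗ
            P.transport (T.inputs_contract hv₀ hr hvw), fun y => ?_⟩
        unfold contractLabel
        rw [hx]
        simp only [LinearMap.comp_apply, MultilinearMap.toLinearMap_apply]
        congr 1
        funext c
        by_cases hc : c.1 = v₀
        · obtain ⟨c, hc'⟩ := c
          obtain rfl : c = v₀ := hc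
          simp
        · rw [dif_neg hc, Function.update_of_ne (fun h => hc (congrArg Subtype.val h))]
    · have hx : ∀ (x : ∀ w : T.verts, P.obj (T.inputs w)) y,
          Function.update x ⟨v₀, hv₀⟩ y ⟨v, hv⟩ = x ⟨v, hv⟩ := fun x y =>
        Function.update_of_ne (fun h => h0 (congrArg Subtype.val h).symm) _ _
      refine ⟨⟨v₀, Finset.mem_erase.2 ⟨h0, hv₀⟩⟩, fun x y w' hw' => ?_, fun x => ?_⟩
      · unfold contractLabel
        have hx' : Function.update x ⟨v₀, hv₀⟩ y ⟨w'.1, Finset.mem_of_mem_erase w'.2⟩ =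
            x ⟨w'.1, Finset.mem_of_mem_erase w'.2⟩ :=
          Function.update_of_ne (a := (⟨w'.1, Finset.mem_of_mem_erase w'.2⟩ : T.verts))
            (fun h => hw' (Subtype.ext (Subtype.mk.inj h))) _ _
        rw [hx, hx']
      · refine ⟨⟨⟨fun y => T.contractLabel P v hv hr (Function.update x ⟨v₀, hv₀⟩ y)
          ⟨v₀, Finset.mem_erase.2 ⟨h0, hv₀⟩⟩, fun y y' => ?_⟩, fun c y => ?_⟩, fun y => rfl⟩
        · unfold contractLabel
          simp only [hx, Function.update_self, map_add, add_apply]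
        · unfold contractLabel
          simp only [hx, Function.update_self, map_smul, smul_apply,
            RingHom.id_apply]))

end RTree

/-- The component `B̄_d(P)(n) = F^c₍d₎(Σ P̃)(n)` of the reduced bar construction: the sum of the
treewise tensor modules over the reduced `n`-trees with `d` vertices. The suspensions `Σ` are made
explicit as follows: the label `⨂_v x_v` of a tree represents the tensor product `⨂_v Σ x_v`, where
the vertices `v` are put in increasing order (for the colexicographic order of subsets). As the
operad `P` is not graded, this component is homogeneous of degree `d`. -/
abbrev Bar (P : SymmOperad K) (n d : ℕ) : Type u := ⨁ T : RTree n d, T.Tensor P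

open Classical in
/-- The position, numbered from `0`, of a vertex in the ordering of the vertices of a tree. -/
noncomputable def RTree.position {n d : ℕ} (T : RTree n d) (v : Finset (Fin n)) : ℕ :=
  (T.verts.filter fun w => toColex w < toColex v).card

open Classical in
/-- The bar differential `β : B̄_{d+1}(P)(n) → B̄_d(P)(n)`: the sum over the edge contractions.
In the contraction of an edge `v → u`, the sign `(-1)^(position v)` is obtained by moving `Σ x_v`
next to the right of `Σ x_u`, and by applying the map `Σ x_u ⊗ Σ x_v ↦ - Σ (x_u ∘_v x_v)`, which is
homogeneous of degree `-1`. -/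
noncomputable def barD (P : SymmOperad K) (n d : ℕ) : Bar P n (d + 1) →ₗ[K] Bar P n d :=
  DirectSum.toModule K _ _ fun T => ∑ v : T.verts,
    if hr : v.1 ≠ Finset.univ then
      (-1 : K) ^ T.position v.1 •
        (DirectSum.lof K (RTree n d) (fun T => T.Tensor P) (T.contract v.1 v.2 hr) ∘ₗ
          T.contractMap P v.1 v.2 hr)
    else 0

/-! ### The Koszul construction -/

/-- The component of weight `s` of `B̄_d(P)(n)`: it is spanned by the tensors of homogeneous
elements whose weights have sum `s`. -/
noncomputable def WeightGrading.bar {P : SymmOperad K} (w : P.WeightGrading) (n d s : ℕ) :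
    Submodule K (Bar P n d) :=
  Submodule.span K {y | ∃ (T : RTree n d) (x : ∀ v : T.verts, P.obj (T.inputs v))
    (t : T.verts → ℕ), (∀ v, x v ∈ w.wt (t v) (T.inputs v)) ∧ ∑ v, t v = s ∧
      y = DirectSum.lof K (RTree n d) (fun T => T.Tensor P) T (PiTensorProduct.tprod K x)}

/-- The cycles of degree `d` of the bar construction. -/
noncomputable def barCycles (P : SymmOperad K) (n : ℕ) : ∀ d, Submodule K (Bar P n d)
  | 0 => ⊤
  | d + 1 => LinearMap.ker (barD P n d)

/-- The Koszul construction `K̄(P)₍s₎(n) = ker(β : B̄_s(P)₍s₎(n) → B̄_{s-1}(P)₍s₎(n))`, which is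
homogeneous of degree `s`. -/
noncomputable def WeightGrading.koszul {P : SymmOperad K} (w : P.WeightGrading) (n s : ℕ) :
    Submodule K (Bar P n s) :=
  w.bar n s s ⊓ P.barCycles n s

/-! ### Trees with levels and the normalized bar construction -/

/-- An `n`-tree with levels `0, …, d - 1` (the root vertex is at level `0`, the entries are put
above level `d - 1`), up to isomorphism, where each vertex has at least one ingoing edge. We
represent a vertex, and its outgoing edge, by the set of entries which lie above it, so that the
vertices of level `i` form a partition `part i` of the set of entries, and the entries form the
discrete partition `part d`. -/
@[ext]
structure LevelTree (n d : ℕ) where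
  part : ℕ → Finpartition (Finset.univ : Finset (Fin n))
  anti : Antitone part
  first : (part 0).parts = {Finset.univ}
  last : ∀ i, d ≤ i → part i = ⊥

theorem refines_of_le {n : ℕ} {A B C : Finpartition (Finset.univ : Finset (Fin n))} (hAB : A ≤ B)
    (hBC : B ≤ C) {b : Finset (Fin n)} (hb : b ∈ C.parts) :
    Refines (A.parts.filter (· ⊆ b)) (B.parts.filter (· ⊆ b)) := by
  intro j hj
  rw [Finset.mem_filter] at hj
  obtain ⟨a, ha⟩ := A.nonempty_of_mem_parts hj.1
  obtain ⟨c, hc, hjc⟩ := hAB hj.1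
  obtain ⟨b', hb', hcb'⟩ := hBC hc
  obtain rfl : b' = b := C.eq_of_mem_parts hb' hb (hcb' (hjc ha)) (hj.2 ha)
  refine ⟨c, ⟨Finset.mem_filter.2 ⟨hc, hcb'⟩, hjc⟩, fun c' hc' => ?_⟩
  exact B.eq_of_mem_parts (Finset.mem_filter.1 hc'.1).1 hc (hc'.2 ha) (hjc ha)

/-- Variant of `tprodOf` where the pure tensor is multiplied by a scalar `s x`: each component
`x v` occurs either in `s x` or in a component of `G x`. -/
noncomputable def smulTprodOf {V V' : Type} {M : V → Type u} {N : V' → Type u}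
    [∀ v, AddCommGroup (M v)] [∀ v, Module K (M v)] [∀ w, AddCommGroup (N w)]
    [∀ w, Module K (N w)] [DecidableEq V] (s : (∀ v, M v) → K) (G : (∀ v, M v) → ∀ w, N w)
    (hG : ∀ v, ((∀ x y, s (Function.update x v y) = s x) ∧
        ∃ w, (∀ x y w', w' ≠ w → G (Function.update x v y) w' = G x w') ∧
          ∀ x, ∃ L : M v →ₗ[K] N w, ∀ y, G (Function.update x v y) w = L y) ∨
      ((∀ x y, G (Function.update x v y) = G x) ∧
        ∀ x, ∃ L : M v →ₗ[K] K, ∀ y, s (Function.update x v y) = L y)) :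
    MultilinearMap K M (⨂[K] w, N w) :=
  MultilinearMap.mk' (fun x => s x • PiTensorProduct.tprod K (G x))
    (fun x v y y' => by
      classical
      rcases hG v with ⟨hs, w, h1, h2⟩ | ⟨h1, h2⟩
      · obtain ⟨L, hL⟩ := h2 x
        have key : ∀ y, G (Function.update x v y) = Function.update (G x) w (L y) := fun y => by
          funext w'
          by_cases h : w' = w
          · subst h; simp [hL]
          · simp [h, h1 x y w' h]
        rw [hs, hs, hs, key, key, key, map_add, MultilinearMap.map_update_add, smul_add]
      · obtain ⟨L, hL⟩ := h2 x
        rw [h1, h1, h1, hL, hL, hL, map_add, add_smul])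
    (fun x v c y => by
      classical
      rcases hG v with ⟨hs, w, h1, h2⟩ | ⟨h1, h2⟩
      · obtain ⟨L, hL⟩ := h2 x
        have key : ∀ y, G (Function.update x v y) = Function.update (G x) w (L y) := fun y => by
          funext w'
          by_cases h : w' = w
          · subst h; simp [hL]
          · simp [h, h1 x y w' h]
        rw [hs, hs, key, key, map_smul, MultilinearMap.map_update_smul, smul_comm]
      · obtain ⟨L, hL⟩ := h2 x
        rw [h1, h1, hL, hL, map_smul, smul_assoc])

namespace LevelTree

variable {n d : ℕ}

noncomputable instance : DecidableEq (LevelTree n d) := Classical.decEq _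

/-- The vertices of a tree with levels. -/
abbrev Vertex (τ : LevelTree n d) : Type := Σ i : Fin d, ↥(τ.part i).parts

/-- The set of ingoing edges of a vertex `b` of level `i`. -/
abbrev inputs (τ : LevelTree n d) (i : ℕ) (b : Finset (Fin n)) : Finset (Finset (Fin n)) :=
  (τ.part (i + 1)).parts.filter (· ⊆ b)

variable (P : SymmOperad K)

/-- The summand of the composite `P ∘ ⋯ ∘ P` associated to a tree with levels `τ`. -/
abbrev Tensor (τ : LevelTree n d) : Type u := ⨂[K] v : τ.Vertex, P.obj (τ.inputs v.1 v.2)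

/-- The increasing map `ℕ → ℕ` which avoids `j + 1`. -/
def skip (j l : ℕ) : ℕ := if l ≤ j then l else l + 1

theorem skip_mono (j : ℕ) : Monotone (skip j) := by
  intro a b h
  unfold skip
  split_ifs <;> omega

theorem skip_succ_le (j l : ℕ) : skip j l + 1 ≤ skip j (l + 1) := by
  unfold skip
  split_ifs <;> omega

/-- The tree obtained by merging the levels `j` and `j + 1`. -/
def merge (τ : LevelTree n (d + 1)) (j : Fin d) : LevelTree n d where
  part l := τ.part (skip j l)
  anti := τ.anti.comp_monotone (skip_mono j)
  first := by simpa [skip] using τ.first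
  last i hi := by
    have := j.2
    rw [skip, if_neg (by omega)]
    exact τ.last _ (by omega)

theorem merge_refines (τ : LevelTree n (d + 1)) (j : Fin d) (l : ℕ) {b : Finset (Fin n)}
    (hb : b ∈ ((τ.merge j).part l).parts) :
    Refines ((τ.merge j).inputs l b) (τ.inputs (skip j l) b) :=
  refines_of_le (τ.anti (skip_succ_le j l)) (τ.anti (Nat.le_succ _)) hb

theorem skip_lt (j : Fin d) (l : Fin d) : skip j l < d + 1 := by
  unfold skip
  split_ifs <;> omega

theorem inputs_merge (τ : LevelTree n (d + 1)) (j : Fin d) {l : ℕ} (hl : l = j)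
    {b c : Finset (Fin n)} (hc : c ⊆ b) :
    τ.inputs (j + 1) c = ((τ.merge j).inputs l b).filter (· ⊆ c) := by
  subst hl
  have : (τ.merge j).part (j + 1) = τ.part (j + 1 + 1) := by simp [merge, skip]
  ext e
  simp only [inputs, Finset.mem_filter, this]
  exact ⟨fun h => ⟨⟨h.1, h.2.trans hc⟩, h.2⟩, fun h => ⟨h.1.1, h.2⟩⟩

/-- The labels of the tree obtained by merging the levels `j` and `j + 1`: a vertex `b` of level
`j` is labeled by the composite of its label with the labels of the vertices of level `j + 1` above
it. The other labels are unchanged (for a uniform formula, we write `p` as `p(1, …, 1)`). -/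
noncomputable def mergeLabel (τ : LevelTree n (d + 1)) (j : Fin d)
    (x : ∀ v : τ.Vertex, P.obj (τ.inputs v.1 v.2)) (w : (τ.merge j).Vertex) :
    P.obj ((τ.merge j).inputs w.1 w.2) :=
  P.subst (τ.merge_refines j w.1 w.2.2) (x ⟨⟨skip j w.1, skip_lt j w.1⟩, w.2⟩) fun c =>
    if h : w.1 = j then
      P.transport (τ.inputs_merge j (congrArg Fin.val h) (Finset.mem_filter.1 c.2).2)
        (x ⟨j.succ, ⟨c.1, by
          have := (Finset.mem_filter.1 c.2).1
          simpa [h, skip] using this⟩⟩)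
    else P.unitAt _

theorem exists_skip (j : Fin d) {i : Fin (d + 1)} (h : i ≠ j.succ) :
    ∃ l : Fin d, i = ⟨skip j l, skip_lt j l⟩ := by
  have h' : (i : ℕ) ≠ j + 1 := fun h' => h (Fin.ext h')
  by_cases hij : (i : ℕ) ≤ j
  · exact ⟨⟨i, by omega⟩, Fin.ext (if_pos hij).symm⟩
  · refine ⟨⟨i - 1, by omega⟩, Fin.ext ?_⟩
    change (i : ℕ) = skip j (i - 1)
    rw [skip, if_neg (by omega)]
    omega

/-- Composition of the vertices of level `j` with the vertices of level `j + 1`. -/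
noncomputable def mergeMap (τ : LevelTree n (d + 1)) (j : Fin d) :
    τ.Tensor P →ₗ[K] (τ.merge j).Tensor P :=
  PiTensorProduct.lift (tprodOf (τ.mergeLabel P j) (by
    rintro ⟨i, b⟩
    by_cases hi : i = j.succ
    · subst hi
      have hx : ∀ (x : ∀ v : τ.Vertex, P.obj (τ.inputs v.1 v.2)) y (w : (τ.merge j).Vertex),
          Function.update x ⟨j.succ, b⟩ y ⟨⟨skip j w.1, skip_lt j w.1⟩, w.2⟩ =
            x ⟨⟨skip j w.1, skip_lt j w.1⟩, w.2⟩ := fun x y w =>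
        Function.update_of_ne (fun h => by
          have h2 : skip j w.1 = j + 1 := congrArg (fun z : τ.Vertex => (z.1 : ℕ)) h
          unfold skip at h2
          split_ifs at h2 <;> omega) _ _
      have hs : skip j j = j := if_pos le_rfl
      obtain ⟨c, hc, hbc⟩ := τ.anti (Nat.le_succ (j : ℕ)) b.2
      have hc' : c ∈ ((τ.merge j).part j).parts := by
        change c ∈ (τ.part (skip j j)).parts
        rw [hs]; exact hc
      have hb : b.1 ∈ τ.inputs (skip j j) c := by
        rw [hs]; exact Finset.mem_filter.2 ⟨b.2, hbc⟩
      refine ⟨⟨j, ⟨c, hc'⟩⟩, fun x y w hw => ?_, fun x => ?_⟩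
      · unfold mergeLabel
        rw [hx]
        congr 1
        funext e
        by_cases h : w.1 = j
        · rw [dif_pos h, dif_pos h, Function.update_of_ne]
          intro he
          apply hw
          obtain ⟨l, w, hw'⟩ := w
          obtain rfl : l = j := h
          have he' : e.1 = b.1 := congrArg (fun z : τ.Vertex => z.2.1) he
          obtain ⟨a, ha⟩ := (τ.part _).nonempty_of_mem_parts b.2
          have : w = c := (τ.part _).eq_of_mem_parts
            (show w ∈ (τ.part l).parts by rw [← hs]; exact hw') hc
            ((Finset.mem_filter.1 e.2).2 (by rw [he']; exact ha)) (hbc ha)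
          subst this
          rfl
        · rw [dif_neg h, dif_neg h]
      · refine ⟨((P.subst (τ.merge_refines j j hc')
          (x ⟨⟨skip j j, skip_lt j j⟩, ⟨c, hc'⟩⟩)).toLinearMap
          (fun e => P.transport (τ.inputs_merge j rfl (Finset.mem_filter.1 e.2).2)
            (x ⟨j.succ, ⟨e.1, by
              have := (Finset.mem_filter.1 e.2).1
              simpa [skip] using this⟩⟩)) ⟨b.1, hb⟩) ∘ₗ
            P.transport (τ.inputs_merge j rfl hbc), fun y => ?_⟩
        unfold mergeLabel
        rw [hx]
        simp only [LinearMap.comp_apply, MultilinearMap.toLinearMap_apply, dite_true]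
        congr 1
        funext e
        by_cases he : e.1 = b.1
        · obtain ⟨e, he'⟩ := e
          obtain ⟨b, hb'⟩ := b
          obtain rfl : e = b := he
          simp
        · rw [Function.update_of_ne (fun h => he (congrArg (fun z : τ.Vertex => z.2.1) h)),
            Function.update_of_ne (fun h => he (congrArg Subtype.val h))]
    · obtain ⟨l, rfl⟩ := exists_skip j hi
      have hx : ∀ (x : ∀ v : τ.Vertex, P.obj (τ.inputs v.1 v.2)) y c,
          Function.update x ⟨⟨skip j l, skip_lt j l⟩, b⟩ y ⟨j.succ, c⟩ = x ⟨j.succ, c⟩ :=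
        fun x y c => Function.update_of_ne (fun h => hi (congrArg Sigma.fst h).symm) _ _
      refine ⟨⟨l, b⟩, fun x y w hw => ?_, fun x => ?_⟩
      · have hx' : Function.update x ⟨⟨skip j l, skip_lt j l⟩, b⟩ y
            ⟨⟨skip j w.1, skip_lt j w.1⟩, w.2⟩ = x ⟨⟨skip j w.1, skip_lt j w.1⟩, w.2⟩ := by
          refine Function.update_of_ne (a := (⟨⟨skip j w.1, skip_lt j w.1⟩, w.2⟩ : τ.Vertex))
            (fun h => hw ?_) _ _
          obtain ⟨l', w, hw'⟩ := w
          have h1 : skip j l' = skip j l := congrArg (fun z : τ.Vertex => (z.1 : ℕ)) h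
          have h2 : w = b.1 := congrArg (fun z : τ.Vertex => z.2.1) h
          obtain rfl : l' = l := by
            apply Fin.ext
            unfold skip at h1
            split_ifs at h1 <;> omega
          subst h2
          rfl
        unfold mergeLabel
        simp only [hx, hx']
      · refine ⟨⟨⟨fun y => τ.mergeLabel P j
          (Function.update x ⟨⟨skip j l, skip_lt j l⟩, b⟩ y) ⟨l, b⟩,
            fun y y' => ?_⟩, fun c y => ?_⟩, fun y => rfl⟩
        · unfold mergeLabel
          simp only [hx, Function.update_self, map_add, add_apply]
        · unfold mergeLabel
          simp only [hx, Function.update_self, map_smul, smul_apply, RingHom.id_apply]))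

/-- The tree obtained by removing the bottom level, when it consists of a vertex with one ingoing
edge. -/
def dropFirst (τ : LevelTree n (d + 1)) (h : (τ.part 1).parts = {Finset.univ}) :
    LevelTree n d where
  part l := τ.part (l + 1)
  anti _ _ h := τ.anti (Nat.succ_le_succ h)
  first := h
  last _ hi := τ.last _ (Nat.succ_le_succ hi)

/-- The tree obtained by removing the top level, when it consists of vertices with one ingoing
edge. -/
def dropLast (τ : LevelTree n (d + 1)) (h : τ.part d = ⊥) : LevelTree n d where
  part := τ.part
  anti := τ.anti
  first := τ.first
  last _ hi := le_bot_iff.1 (h ▸ τ.anti hi)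

/-- The product of the augmentations of the labels of the vertices of level `i`. -/
noncomputable def levelAug (τ : LevelTree n d) (i : Fin d)
    (x : ∀ v : τ.Vertex, P.obj (τ.inputs v.1 v.2)) : K :=
  ∏ b : ↥(τ.part i).parts, P.aug _ (x ⟨i, b⟩)

theorem levelAug_update (τ : LevelTree n d) (i : Fin d) (b : ↥(τ.part i).parts)
    (x : ∀ v : τ.Vertex, P.obj (τ.inputs v.1 v.2)) (y : P.obj (τ.inputs i b)) :
    τ.levelAug P i (Function.update x ⟨i, b⟩ y) =
      (∏ b' ∈ Finset.univ.erase b, P.aug _ (x ⟨i, b'⟩)) * P.aug _ y := by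
  unfold levelAug
  rw [← Finset.mul_prod_erase _ _ (Finset.mem_univ b), Function.update_self, mul_comm]
  congr 1
  refine Finset.prod_congr rfl fun b' hb' => ?_
  rw [Function.update_of_ne]
  intro h
  exact (Finset.mem_erase.1 hb').1 (eq_of_heq (Sigma.mk.inj h).2)

theorem levelAug_update_of_ne (τ : LevelTree n d) {i i' : Fin d} (hi : i ≠ i')
    (b : ↥(τ.part i').parts) (x : ∀ v : τ.Vertex, P.obj (τ.inputs v.1 v.2))
    (y : P.obj (τ.inputs i' b)) :
    τ.levelAug P i (Function.update x ⟨i', b⟩ y) = τ.levelAug P i x :=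
  Finset.prod_congr rfl fun b' _ => by
    rw [Function.update_of_ne]
    exact fun h => hi (congrArg Sigma.fst h)

/-- Application of the augmentation of `P` to the vertex of the bottom level. -/
noncomputable def dropFirstMap (τ : LevelTree n (d + 1)) (h : (τ.part 1).parts = {Finset.univ}) :
    τ.Tensor P →ₗ[K] (τ.dropFirst h).Tensor P :=
  PiTensorProduct.lift (smulTprodOf
    (τ.levelAug P 0) (fun x (w : (τ.dropFirst h).Vertex) => x ⟨w.1.succ, w.2⟩) (by
      rintro ⟨i, b⟩
      by_cases hi : i = 0
      · subst hi
        refine Or.inr ⟨fun x y => funext fun w => ?_, fun x => ⟨(∏ b' ∈ Finset.univ.erase b,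
          P.aug _ (x ⟨0, b'⟩)) • P.aug _, fun y => τ.levelAug_update P 0 b x y⟩⟩
        exact Function.update_of_ne (fun h => Fin.succ_ne_zero _ (congrArg Sigma.fst h)) _ _
      · obtain ⟨i, rfl⟩ := Fin.exists_succ_eq.2 hi
        refine Or.inl ⟨fun x y => τ.levelAug_update_of_ne P (Ne.symm hi) b x y, ⟨i, b⟩,
          fun x y w hw => ?_, fun x => ⟨LinearMap.id, fun y => Function.update_self _ _ _⟩⟩
        refine Function.update_of_ne (a := (⟨w.1.succ, w.2⟩ : τ.Vertex)) (fun h => hw ?_) _ _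
        obtain ⟨l, w⟩ := w
        obtain rfl : l = i := Fin.succ_injective _ (congrArg Sigma.fst h)
        obtain rfl : w = b := eq_of_heq (Sigma.mk.inj h).2
        rfl))

/-- Application of the augmentation of `P` to the vertices of the top level. -/
noncomputable def dropLastMap (τ : LevelTree n (d + 1)) (h : τ.part d = ⊥) :
    τ.Tensor P →ₗ[K] (τ.dropLast h).Tensor P :=
  PiTensorProduct.lift (smulTprodOf
    (τ.levelAug P (Fin.last d)) (fun x (w : (τ.dropLast h).Vertex) => x ⟨w.1.castSucc, w.2⟩) (by
      rintro ⟨i, b⟩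
      by_cases hi : i = Fin.last d
      · subst hi
        refine Or.inr ⟨fun x y => funext fun w => ?_, fun x => ⟨(∏ b' ∈ Finset.univ.erase b,
          P.aug _ (x ⟨Fin.last d, b'⟩)) • P.aug _,
            fun y => τ.levelAug_update P (Fin.last d) b x y⟩⟩
        exact Function.update_of_ne
          (fun h => (Fin.castSucc_lt_last _).ne (congrArg Sigma.fst h)) _ _
      · obtain ⟨i, rfl⟩ := Fin.exists_castSucc_eq.2 hi
        refine Or.inl ⟨fun x y => τ.levelAug_update_of_ne P (Ne.symm hi) b x y, ⟨i, b⟩,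
          fun x y w hw => ?_, fun x => ⟨LinearMap.id, fun y => Function.update_self _ _ _⟩⟩
        refine Function.update_of_ne (a := (⟨w.1.castSucc, w.2⟩ : τ.Vertex))
          (fun h => hw ?_) _ _
        obtain ⟨l, w⟩ := w
        obtain rfl : l = i := Fin.castSucc_injective _ (congrArg Sigma.fst h)
        obtain rfl : w = b := eq_of_heq (Sigma.mk.inj h).2
        rfl))

end LevelTree

/-- The component `C̄_d(P)(n) = P^{∘ d}(n)` of the simplicial bar construction with trivial
coefficients: the sum over the trees with `d` levels. -/
abbrev SBar (P : SymmOperad K) (n d : ℕ) : Type u := ⨁ τ : LevelTree n d, τ.Tensor P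

open Classical in
/-- The face `d_0 : P^{∘ (d + 1)} → P^{∘ d}`, given by the augmentation `P → I` on the bottom
level. -/
noncomputable def sbarFirst (P : SymmOperad K) (n d : ℕ) : SBar P n (d + 1) →ₗ[K] SBar P n d :=
  DirectSum.toModule K _ _ fun τ =>
    if h : (τ.part 1).parts = {Finset.univ} then
      DirectSum.lof K (LevelTree n d) (fun τ => τ.Tensor P) (τ.dropFirst h) ∘ₗ τ.dropFirstMap P h
    else 0

open Classical in
/-- The face `d_{d+1} : P^{∘ (d + 1)} → P^{∘ d}`, given by the augmentation `P → I` on the top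
level. -/
noncomputable def sbarLast (P : SymmOperad K) (n d : ℕ) : SBar P n (d + 1) →ₗ[K] SBar P n d :=
  DirectSum.toModule K _ _ fun τ =>
    if h : τ.part d = ⊥ then
      DirectSum.lof K (LevelTree n d) (fun τ => τ.Tensor P) (τ.dropLast h) ∘ₗ τ.dropLastMap P h
    else 0

/-- The face `d_{j+1} : P^{∘ (d + 1)} → P^{∘ d}`, `0 ≤ j < d`, given by the composition product
`P ∘ P → P` on the levels `j` and `j + 1`. -/
noncomputable def sbarMerge (P : SymmOperad K) (n d : ℕ) (j : Fin d) :
    SBar P n (d + 1) →ₗ[K] SBar P n d :=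
  DirectSum.toModule K _ _ fun τ =>
    DirectSum.lof K (LevelTree n d) (fun τ => τ.Tensor P) (τ.merge j) ∘ₗ τ.mergeMap P j

/-- The alternating sum `δ = ∑ᵢ (-1)^i d_i` of the faces `d_i : P^{∘ (d + 1)} → P^{∘ d}`,
`0 ≤ i ≤ d + 1`. -/
noncomputable def sbarD (P : SymmOperad K) (n d : ℕ) : SBar P n (d + 1) →ₗ[K] SBar P n d :=
  P.sbarFirst n d + ∑ j : Fin d, (-1 : K) ^ ((j : ℕ) + 1) • P.sbarMerge n d j +
    (-1 : K) ^ (d + 1) • P.sbarLast n d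

/-- The sum of the images of the degeneracies `P^{∘ (d - 1)} → P^{∘ d}`, which insert a level formed
by operad units in trees: it is spanned by the tensors where all vertices of some level have
exactly one ingoing edge and are labeled by the operad unit. -/
noncomputable def degenerate (P : SymmOperad K) (n d : ℕ) : Submodule K (SBar P n d) :=
  Submodule.span K {y | ∃ (τ : LevelTree n d) (x : ∀ v : τ.Vertex, P.obj (τ.inputs v.1 v.2))
    (i : Fin d), τ.part i = τ.part (i + 1) ∧ (∀ b, x ⟨i, b⟩ = P.unitAt _) ∧
      y = DirectSum.lof K (LevelTree n d) (fun τ => τ.Tensor P) τ (PiTensorProduct.tprod K x)}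

/-- The component `N̄_d(P)(n)` of the normalized bar construction, homogeneous of degree `d`. -/
abbrev NBar (P : SymmOperad K) (n d : ℕ) : Type u := SBar P n d ⧸ P.degenerate n d

/-- The differential of the normalized bar construction, induced by the alternating sum of the
faces (which preserves the degenerate elements, by the simplicial identities). -/
noncomputable def normD (P : SymmOperad K) (n d : ℕ)
    (h : P.degenerate n (d + 1) ≤ (P.degenerate n d).comap (P.sbarD n d)) :
    NBar P n (d + 1) →ₗ[K] NBar P n d :=
  Submodule.mapQ _ _ (P.sbarD n d) h

/-! ### The levelization morphism -/

namespace RTree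

variable {n d : ℕ}

/-- The ways to put the vertices of a tree on the levels `0, …, d - 1`, one vertex on each level,
such that each vertex is on a higher level than the vertices below it. -/
abbrev Leveling (T : RTree n d) : Type :=
  {l : T.verts ≃ Fin d // ∀ v w : T.verts, v.1 ⊂ w.1 → l w < l v}

noncomputable instance (T : RTree n d) : Fintype T.Leveling := Fintype.ofFinite _

namespace Leveling

variable {T : RTree n d} (l : T.Leveling)

/-- The subset `c` represents an entry, or a vertex of level at least `i`. -/
def Above (i : ℕ) (c : Finset (Fin n)) : Prop :=
  (∃ w : T.verts, w.1 = c ∧ i ≤ l.1 w) ∨ c.card = 1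

open Classical in
/-- The edges which cross the height just below level `i`: their sources are the entries, and the
vertices of level at least `i`, which are not above another vertex of level at least `i`. -/
noncomputable def blocks (i : ℕ) : Finset (Finset (Fin n)) :=
  Finset.univ.filter fun c => l.Above i c ∧ ∀ w : T.verts, i ≤ l.1 w → ¬ c ⊂ w.1

variable {l}

theorem mem_blocks {i : ℕ} {c : Finset (Fin n)} :
    c ∈ l.blocks i ↔ l.Above i c ∧ ∀ w : T.verts, i ≤ l.1 w → ¬ c ⊂ w.1 := by
  simp [blocks]

theorem Above.or {i : ℕ} {c : Finset (Fin n)} (h : l.Above i c) : c ∈ T.verts ∨ c.card = 1 :=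
  h.imp_left (by rintro ⟨w, rfl, -⟩; exact w.2)

theorem Above.mono {i j : ℕ} (hij : i ≤ j) {c : Finset (Fin n)} (h : l.Above j c) : l.Above i c :=
  h.imp_left (by rintro ⟨w, rfl, hw⟩; exact ⟨w, rfl, hij.trans hw⟩)

/-- Every subset in `Above i` is contained in a block. -/
theorem exists_block {i : ℕ} {c : Finset (Fin n)} (h : l.Above i c) :
    ∃ b ∈ l.blocks i, c ⊆ b := by
  classical
  obtain ⟨b, hb, hmax⟩ := (Finset.univ.filter fun b => l.Above i b ∧ c ⊆ b).exists_max_image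
    Finset.card ⟨c, by simp [h]⟩
  simp only [Finset.mem_filter, Finset.mem_univ, true_and] at hb hmax
  refine ⟨b, mem_blocks.2 ⟨hb.1, fun w hw hbw => ?_⟩, hb.2⟩
  exact absurd (hmax w ⟨Or.inl ⟨w, rfl, hw⟩, hb.2.trans hbw.1⟩)
    (not_le.2 (Finset.card_lt_card hbw))

theorem block_maximal {i : ℕ} {b c : Finset (Fin n)} (hb : b ∈ l.blocks i) (hc : l.Above i c) :
    ¬ b ⊂ c := by
  intro h
  rw [mem_blocks] at hb
  rcases hc with ⟨w, rfl, hw⟩ | hc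
  · exact hb.2 w hw h
  · have := Finset.card_lt_card h
    have := Finset.card_pos.2 (nonempty_of hb.1.or)
    omega

theorem block_unique {i : ℕ} {b c : Finset (Fin n)} (hb : b ∈ l.blocks i) (hc : c ∈ l.blocks i)
    {a : Fin n} (hab : a ∈ b) (hac : a ∈ c) : b = c := by
  rcases trichotomy (mem_blocks.1 hb).1.or (mem_blocks.1 hc).1.or hab hac with h | h | h
  · exact h
  · exact absurd h (block_maximal hb (mem_blocks.1 hc).1)
  · exact absurd h (block_maximal hc (mem_blocks.1 hb).1)

variable (l)

/-- The tree with levels associated to a leveling, where vertices with one ingoing edge are inserted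
whenever an edge crosses a level. -/
noncomputable def tree : LevelTree n d where
  part i := Finpartition.ofExistsUnique (l.blocks i) (fun b _ => Finset.subset_univ b)
    (fun a _ => by
      obtain ⟨b, hb, hab⟩ := exists_block (l := l) (i := i) (c := {a})
        (Or.inr (Finset.card_singleton a))
      have hab := hab (Finset.mem_singleton_self a)
      exact ⟨b, ⟨hb, hab⟩, fun c hc => block_unique hc.1 hb hc.2 hab⟩)
    (fun h => by simpa using nonempty_of (mem_blocks.1 h).1.or)
  anti i j hij b hb := exists_block ((mem_blocks.1 hb).1.mono hij)
  first := by
    change l.blocks 0 = _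
    have h0 : l.Above 0 Finset.univ := by
      rcases T.root with h | h
      · exact Or.inl ⟨⟨_, h⟩, rfl, Nat.zero_le _⟩
      · exact Or.inr (by simp [h])
    have hu : Finset.univ ∈ l.blocks 0 :=
      mem_blocks.2 ⟨h0, fun w _ h => h.2 (Finset.subset_univ _)⟩
    refine Finset.eq_singleton_iff_unique_mem.2 ⟨hu, fun b hb => ?_⟩
    obtain ⟨a, ha⟩ := nonempty_of (mem_blocks.1 hb).1.or
    exact block_unique hb hu ha (Finset.mem_univ a)
  last i hi := by
    apply Finpartition.ext
    change l.blocks i = _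
    ext b
    have hn : ∀ w : T.verts, ¬ i ≤ l.1 w := fun w hw => by
      have := (l.1 w).2
      omega
    simp [mem_blocks, Above, hn, Finset.card_eq_one, eq_comm]

theorem mem_part (v : T.verts) : v.1 ∈ (l.tree.part (l.1 v)).parts :=
  mem_blocks.2 ⟨Or.inl ⟨v, rfl, le_rfl⟩, fun w hw h =>
    absurd (l.2 v w h) (not_lt.2 (by exact_mod_cast hw))⟩

theorem inputs_eq (v : T.verts) : T.inputs v.1 = l.tree.inputs (l.1 v) v.1 := by
  ext c
  rw [mem_inputs, Finset.mem_filter]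
  change _ ↔ c ∈ l.blocks _ ∧ _
  rw [mem_blocks]
  constructor
  · rintro ⟨h1, h2, h3⟩
    refine ⟨⟨h2.imp_left fun h => ⟨⟨c, h⟩, rfl, Nat.succ_le_of_lt (l.2 ⟨c, h⟩ v h1)⟩, ?_⟩, h1.1⟩
    intro w hw hcw
    obtain ⟨a, ha⟩ := nonempty_of h2
    rcases trichotomy (Or.inl w.2) (Or.inl v.2) (hcw.1 ha) (h1.1 ha) with h | h | h
    · obtain rfl : w = v := Subtype.ext h
      omega
    · exact h3 w w.2 hcw h
    · have : (l.1 w : ℕ) < l.1 v := l.2 v w h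
      omega
  · rintro ⟨⟨h1, h2⟩, h3⟩
    have hne : c ≠ v.1 := by
      rintro rfl
      rcases h1 with ⟨w, hw, hl⟩ | h
      · obtain rfl : w = v := Subtype.ext hw
        omega
      · have := T.two_le _ v.2
        omega
    refine ⟨h3.ssubset_of_ne hne, h1.or, fun w hw hcw hwv => ?_⟩
    exact h2 ⟨w, hw⟩ (Nat.succ_le_of_lt (l.2 ⟨w, hw⟩ v hwv)) hcw

variable (P : SymmOperad K)

open Classical in
/-- The labels of the tree with levels associated to a leveling: the vertices of the original tree
keep their labels, and the other vertices are labeled by operad units. -/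
noncomputable def label (x : ∀ v : T.verts, P.obj (T.inputs v)) (w : l.tree.Vertex) :
    P.obj (l.tree.inputs w.1 w.2) :=
  if h : w.2.1 = (l.1.symm w.1).1 then
    P.transport ((l.inputs_eq (l.1.symm w.1)).trans (by rw [h, Equiv.apply_symm_apply]))
      (x (l.1.symm w.1))
  else P.unitAt _

theorem label_update_add (x : ∀ v : T.verts, P.obj (T.inputs v)) (v : T.verts)
    (y y' : P.obj (T.inputs v)) :
    l.label P (Function.update x v (y + y')) ⟨l.1 v, ⟨v.1, l.mem_part v⟩⟩ =
      l.label P (Function.update x v y) ⟨l.1 v, ⟨v.1, l.mem_part v⟩⟩ +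
        l.label P (Function.update x v y') ⟨l.1 v, ⟨v.1, l.mem_part v⟩⟩ := by
  have h : v.1 = (l.1.symm (l.1 v)).1 := by rw [Equiv.symm_apply_apply]
  have key : ∀ u, u = v → Function.update x v (y + y') u =
      Function.update x v y u + Function.update x v y' u := by
    rintro u rfl; simp
  unfold label
  rw [dif_pos h, dif_pos h, dif_pos h, key _ (l.1.symm_apply_apply v), map_add]

theorem label_update_smul (x : ∀ v : T.verts, P.obj (T.inputs v)) (v : T.verts)
    (c : K) (y : P.obj (T.inputs v)) :
    l.label P (Function.update x v (c • y)) ⟨l.1 v, ⟨v.1, l.mem_part v⟩⟩ =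
      c • l.label P (Function.update x v y) ⟨l.1 v, ⟨v.1, l.mem_part v⟩⟩ := by
  have h : v.1 = (l.1.symm (l.1 v)).1 := by rw [Equiv.symm_apply_apply]
  have key : ∀ u, u = v → Function.update x v (c • y) u = c • Function.update x v y u := by
    rintro u rfl; simp
  unfold label
  rw [dif_pos h, dif_pos h, key _ (l.1.symm_apply_apply v), map_smul]

/-- The component of the levelization morphism associated to a leveling (without its sign). -/
noncomputable def tensorMap : T.Tensor P →ₗ[K] l.tree.Tensor P :=
  PiTensorProduct.lift (tprodOf (l.label P) (by
    intro v
    refine ⟨⟨l.1 v, ⟨v.1, l.mem_part v⟩⟩, fun x y w hw => ?_, fun x => ?_⟩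
    · unfold label
      by_cases h : w.2.1 = (l.1.symm w.1).1
      · rw [dif_pos h, dif_pos h, Function.update_of_ne]
        intro hv
        apply hw
        obtain ⟨i, b, hb⟩ := w
        obtain ⟨v', rfl⟩ := l.1.surjective i
        rw [Equiv.symm_apply_apply] at hv
        subst hv
        obtain rfl : b = v'.1 := by simpa using h
        rfl
      · rw [dif_neg h, dif_neg h]
    · exact ⟨⟨⟨fun y => l.label P (Function.update x v y) ⟨l.1 v, ⟨v.1, l.mem_part v⟩⟩,
        l.label_update_add P x v⟩, l.label_update_smul P x v⟩, fun y => rfl⟩))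

open Classical in
/-- The sign of the permutation which takes the ordering of the vertices of the tree to the ordering
of the levels. -/
noncomputable def sign : K :=
  (-1 : K) ^ (Finset.univ.filter fun p : T.verts × T.verts =>
    toColex p.1.1 < toColex p.2.1 ∧ l.1 p.2 < l.1 p.1).card

end Leveling

end RTree

/-- The levelization morphism `B̄_d(P)(n) → P^{∘ d}(n)`: the signed sum over the levelings of
trees. -/
noncomputable def levelize (P : SymmOperad K) (n d : ℕ) : Bar P n d →ₗ[K] SBar P n d :=
  DirectSum.toModule K _ _ fun T => ∑ l : T.Leveling, (l.sign : K) •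
    (DirectSum.lof K (LevelTree n d) (fun τ => τ.Tensor P) l.tree ∘ₗ l.tensorMap P)

/-- The levelization morphism `B̄_d(P)(n) → N̄_d(P)(n)`. -/
noncomputable def levelization (P : SymmOperad K) (n d : ℕ) : Bar P n d →ₗ[K] NBar P n d :=
  (P.degenerate n d).mkQ ∘ₗ P.levelize n d

/-! ### Quasi-isomorphisms and Koszul operads -/

/-- The sequences of modules and of linear maps `(X, dX)` and `(Y, dY)` are chain complexes, the
family `f` is a morphism of chain complexes, and it is a quasi-isomorphism. -/
structure IsQuasiIso {X Y : ℕ → Type u} [∀ i, AddCommGroup (X i)] [∀ i, Module K (X i)]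
    [∀ i, AddCommGroup (Y i)] [∀ i, Module K (Y i)] (dX : ∀ i, X (i + 1) →ₗ[K] X i)
    (dY : ∀ i, Y (i + 1) →ₗ[K] Y i) (f : ∀ i, X i →ₗ[K] Y i) : Prop where
  sqX : ∀ i, dX i ∘ₗ dX (i + 1) = 0
  sqY : ∀ i, dY i ∘ₗ dY (i + 1) = 0
  comm : ∀ i, dY i ∘ₗ f (i + 1) = f i ∘ₗ dX i
  quasiIso : QuasiIso (ChainComplex.ofHom
    (X := ChainComplex.of (fun i => ModuleCat.of K (X i)) (fun i => ModuleCat.ofHom (dX i))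
      (fun i => by rw [← ModuleCat.ofHom_comp, sqX]; rfl))
    (Y := ChainComplex.of (fun i => ModuleCat.of K (Y i)) (fun i => ModuleCat.ofHom (dY i))
      (fun i => by rw [← ModuleCat.ofHom_comp, sqY]; rfl))
    (fun i => ModuleCat.ofHom (f i))
    (fun i => by
      simp only [ChainComplex.of_d]
      rw [← ModuleCat.ofHom_comp, ← ModuleCat.ofHom_comp, comm]))

/-- The inclusion `K̄(P)(n) → B̄(P)(n)` of the Koszul construction (with zero differential) in the
bar construction is a quasi-isomorphism. -/
def WeightGrading.KoszulToBarQuasiIso {P : SymmOperad K} (w : P.WeightGrading) (n : ℕ) : Prop :=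
  IsQuasiIso (X := fun s => w.koszul n s) (Y := fun s => P.Bar n s) (fun _ => 0) (P.barD n) (fun s => (w.koszul n s).subtype)

/-- The levelization morphism `B̄(P)(n) → N̄(P)(n)` is a quasi-isomorphism of chain complexes
(this includes that the differential of `N̄(P)(n)` is well-defined). -/
def BarToNormQuasiIso (P : SymmOperad K) (n : ℕ) : Prop :=
  ∃ h : ∀ d, P.degenerate n (d + 1) ≤ (P.degenerate n d).comap (P.sbarD n d),
    IsQuasiIso (X := fun d => P.Bar n d) (Y := fun d => P.NBar n d) (P.barD n) (fun d => P.normD n d (h d)) (P.levelization n)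

/-- A connected weight graded operad `P` over `K` is Koszul if `K̄(P) → B̄(P)` is a
quasi-isomorphism; in this definition, the operad `P` and its Koszul construction `K̄(P)` are assumed
to be projective as `K`-modules (which is automatic if `K` is a field). -/
structure WeightGrading.IsKoszul {P : SymmOperad K} (w : P.WeightGrading) : Prop where
  connected : w.IsConnected
  projective : ∀ (I : Type) [Finite I], Module.Projective K (P.obj I)
  projective_koszul : ∀ n s, Module.Projective K (w.koszul n s)
  quasiIso : ∀ n, w.KoszulToBarQuasiIso n

end SymmOperad

/-! Each module `C(I)` with `I` nonempty is free of rank one on the monomial, and composites of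
monomials are monomials. Hence the bar complex has a basis of reduced trees, seen as laminar
families of subsets of the entries, and the normalized complex has a basis of strict chains of
partitions running from the one-block partition to the discrete one. In both complexes the
differential is an alternating sum over the removals of one member of the family, so all that
remains is combinatorics with coefficients `±1`, valid over any ring.

For `n = 0` everything vanishes. For `n = m + 1`, both bases carry an acyclic matching in the sense
of discrete Morse theory, governed by the entry `0`. For trees, look at the vertices containing `0`,
a nested path from `{0}` to the root; if two consecutive sets `U ⊂ V` differ by at least two
entries, the vertex `V \ U` can be added or removed freely. For chains of partitions, look at the
finest member for each value of the block of `0`; if two consecutive ones are not related by a mere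
splitting of that block, the split partition can be added or removed. In both cases the critical
cells are the flags growing from `{0}` one entry at a time, and they have exactly `m` members, the
maximal number. The homotopy attached to the matching (`defect_single`) is the identity minus the
critical projection up to terms with a smaller path. By induction on the path, the complexes are
exact outside degree `m`, and the cycles of degree `m` correspond bijectively to their critical
components (`exists_primitive`, `eq_zero_of_crit_eq_zero`, `exists_cycle`).

Koszulness follows: a tree with `n` entries has weight `n - 1`, so the Koszul construction is the
module of cycles of degree `n - 1 = m`; it is free on the critical cells (`projective_cycles`) and
carries all the homology.

For the levelization, the chain map property (`normD_levelization`) is a cancellation: removing the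
level of `v` gives a term of the contracted tree if the preceding vertex is the parent of `v`, and
otherwise cancels against the leveling where the two vertices are exchanged (`sum_face`). For the
homology, a critical tree is a nested chain, so it has a single leveling, whose chain of partitions
is critical, and every critical chain of partitions arises in this way. Thus the levelization
preserves critical components up to sign (`normChain_levelization_apply`) and is bijective on cycles
of degree `m`. -/

/-! ## Matchings on families of finite sets -/

/-- A family of finite subsets (cells) of `V`, stable under the removal of the free elements, such
that the elements of each cell are totally ordered by the relation `lt`. -/
structure CellFamily (V : Type) where
  cell : Finset V → Prop
  -- The elements which are not free are those that the differential never removes: the root vertex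
  -- for trees, the coarsest partition for chains.
  free : V → Prop
  lt : V → V → Prop
  cell_erase [DecidableEq V] {F : Finset V} {v : V} : cell F → v ∈ F → free v → cell (F.erase v)
  total {F : Finset V} {v w : V} : cell F → v ∈ F → w ∈ F → v ≠ w → (lt v w ↔ ¬ lt w v)

namespace CellFamily

open Classical

variable {V W : Type} (X : CellFamily V) (K : Type u) [CommRing K]

/-- The number of elements of `F` which precede `v`. -/
noncomputable def pos (F : Finset V) (v : V) : ℕ := (F.filter fun w => X.lt w v).card

/-- The sum of the free faces of a cell, with the alternating signs. -/
noncomputable def faceSum (F : Finset V) : Finset V →₀ K :=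
  ∑ v ∈ F.filter X.free, Finsupp.single (F.erase v) ((-1 : K) ^ X.pos F v)

/-- The boundary operator. -/
noncomputable def bdry : (Finset V →₀ K) →ₗ[K] (Finset V →₀ K) :=
  Finsupp.linearCombination K (X.faceSum K)

/-- The chains of cells with `d` elements. -/
noncomputable def chains (d : ℕ) : Submodule K (Finset V →₀ K) :=
  Finsupp.supported K K {F | X.cell F ∧ F.card = d}

variable {X K}

@[simp]
theorem bdry_single (F : Finset V) (c : K) :
    X.bdry K (Finsupp.single F c) = c • X.faceSum K F := by
  simp [bdry, Finsupp.linearCombination_single]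

theorem pos_erase {F : Finset V} {v w : V} (hv : v ∈ F) :
    X.pos (F.erase v) w + (if X.lt v w then 1 else 0) = X.pos F w := by
  unfold pos
  rw [Finset.filter_erase]
  split_ifs with h
  · rw [Finset.card_erase_add_one (Finset.mem_filter.2 ⟨hv, h⟩)]
  · rw [Finset.erase_eq_of_notMem (by simp [h]), add_zero]

/-- Exactly one of `v`, `w` precedes the other, and its removal lowers the position of the other one
by one. This parity shift gives both the vanishing of the squared boundary and the cancellations in
the homotopy formula. -/
theorem sign_antisymm {F : Finset V} (hF : X.cell F) {v w : V} (hv : v ∈ F) (hw : w ∈ F)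
    (hvw : v ≠ w) : (-1 : K) ^ (X.pos F v + X.pos (F.erase v) w) =
      - (-1 : K) ^ (X.pos F w + X.pos (F.erase w) v) := by
  have h1 := pos_erase (X := X) (w := w) hv
  have h2 := pos_erase (X := X) (w := v) hw
  have h3 := X.total hF hv hw hvw
  by_cases h : X.lt v w
  · rw [if_pos h] at h1
    rw [if_neg (h3.1 h)] at h2
    rw [← h1, ← h2]; ring
  · have h' : X.lt w v := by tauto
    rw [if_neg h] at h1
    rw [if_pos h'] at h2
    rw [← h1, ← h2]; ring

theorem bdry_mem {d : ℕ} {x : Finset V →₀ K} (hx : x ∈ X.chains K (d + 1)) :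
    X.bdry K x ∈ X.chains K d := by
  unfold chains at hx
  rw [Finsupp.supported_eq_span_single] at hx
  induction hx using Submodule.span_induction with
  | mem y hy =>
    obtain ⟨F, ⟨hF, hc⟩, rfl⟩ := hy
    simp only [bdry_single, one_smul]
    refine Submodule.sum_mem _ fun v hv => ?_
    rw [Finset.mem_filter] at hv
    refine Finsupp.single_mem_supported K _ ⟨X.cell_erase hF hv.1 hv.2, ?_⟩
    rw [Finset.card_erase_of_mem hv.1, hc]; rfl
  | zero => simp
  | add y z _ _ hy hz => rw [map_add]; exact add_mem hy hz
  | smul c y _ hy => rw [map_smul]; exact Submodule.smul_mem _ _ hy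

theorem bdry_bdry {d : ℕ} {x : Finset V →₀ K} (hx : x ∈ X.chains K d) :
    X.bdry K (X.bdry K x) = 0 := by
  unfold chains at hx
  rw [Finsupp.supported_eq_span_single] at hx
  induction hx using Submodule.span_induction with
  | mem y hy =>
    obtain ⟨F, ⟨hF, -⟩, rfl⟩ := hy
    simp only [bdry_single, one_smul, faceSum, map_sum]
    simp only [Finset.smul_sum]
    rw [Finset.sum_sigma']
    -- Removing two elements in either order gives the same cell with opposite signs.
    refine Finset.sum_involution (fun p _ => ⟨p.2, p.1⟩) ?_ ?_ ?_ ?_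
    · rintro ⟨v, w⟩ hp
      simp only [Finset.mem_sigma, Finset.mem_filter, Finset.mem_erase] at hp
      simp only [Finsupp.smul_single, smul_eq_mul, ← pow_add]
      rw [Finset.erase_right_comm (a := w) (b := v), ← Finsupp.single_add,
        sign_antisymm hF hp.1.1 hp.2.1.2 hp.2.1.1.symm, neg_add_cancel, Finsupp.single_zero]
    · rintro ⟨v, w⟩ hp _ h
      simp only [Finset.mem_sigma, Finset.mem_filter, Finset.mem_erase] at hp
      exact hp.2.1.1 (congrArg Sigma.fst h)
    · rintro ⟨v, w⟩ hp
      simp only [Finset.mem_sigma, Finset.mem_filter, Finset.mem_erase] at hp ⊢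
      tauto
    · rintro ⟨v, w⟩ _
      rfl
  | zero => simp
  | add y z _ _ hy hz => rw [map_add, map_add, hy, hz, add_zero]
  | smul c y _ hy => rw [map_smul, map_smul, hy, smul_zero]

end CellFamily

/-- An acyclic matching on a family of cells: the cell `F` is matched with the cells obtained by
adding or removing the element `pivot (path F)`. The cells without pivot are critical, and have the
maximal number of elements. -/
structure CellMatching (V W : Type) extends CellFamily V where
  path : Finset V → Finset W
  pivot : Finset W → Option V
  top : ℕ
  -- The size of the path filters the complex: a face has either the same path or a strictly smaller
  -- one, which makes the matching acyclic.
  path_mono : Monotone path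
  pivot_free {F : Finset V} {v : V} : cell F → pivot (path F) = some v → free v
  cell_insert [DecidableEq V] {F : Finset V} {v : V} :
    cell F → pivot (path F) = some v → cell (insert v F)
  path_insert [DecidableEq V] {F : Finset V} {v : V} :
    cell F → pivot (path F) = some v → path (insert v F) = path F
  path_erase [DecidableEq V] {F : Finset V} {v : V} :
    cell F → pivot (path F) = some v → path (F.erase v) = path F
  card_le {F : Finset V} : cell F → F.card ≤ top
  card_critical {F : Finset V} : cell F → pivot (path F) = none → F.card = top

/-! ### Homotopy and exactness for an acyclic matching. -/

namespace CellMatching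

open Classical

variable {V W : Type} (X : CellMatching V W) (K : Type u) [CommRing K]

/-- The critical cells. -/
def Critical (F : Finset V) : Prop := X.cell F ∧ X.pivot (X.path F) = none

/-- The homotopy operator on a cell. -/
noncomputable def lift (F : Finset V) : Finset V →₀ K :=
  match X.pivot (X.path F) with
  | none => 0
  | some v => if v ∈ F then 0 else Finsupp.single (insert v F) ((-1 : K) ^ X.pos (insert v F) v)

/-- The homotopy operator. -/
noncomputable def homotopy : (Finset V →₀ K) →ₗ[K] (Finset V →₀ K) :=
  Finsupp.linearCombination K (X.lift K)

/-- The projection on the critical cells. -/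
noncomputable def crit : (Finset V →₀ K) →ₗ[K] (Finset V →₀ K) :=
  Finsupp.linearCombination K fun F => if X.Critical F then Finsupp.single F 1 else 0

/-- The chains of cells with `d` elements and with a path of length less than `k`. -/
noncomputable def filt (d k : ℕ) : Submodule K (Finset V →₀ K) :=
  Finsupp.supported K K {F | X.cell F ∧ F.card = d ∧ (X.path F).card < k}

variable {X K}

theorem lift_eq {F : Finset V} {v : V} (h : X.pivot (X.path F) = some v) :
    X.lift K F = if v ∈ F then 0 else
      Finsupp.single (insert v F) ((-1 : K) ^ X.pos (insert v F) v) := by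
  unfold lift; rw [h]

theorem lift_none {F : Finset V} (h : X.pivot (X.path F) = none) : X.lift K F = 0 := by
  unfold lift; rw [h]

@[simp]
theorem homotopy_single (F : Finset V) (c : K) :
    X.homotopy K (Finsupp.single F c) = c • X.lift K F := by
  simp [homotopy, Finsupp.linearCombination_single]

theorem crit_apply (x : Finset V →₀ K) (F : Finset V) :
    X.crit K x F = if X.Critical F then x F else 0 := by
  induction x using Finsupp.induction_linear with
  | zero => simp
  | add f g hf hg => rw [map_add, Finsupp.add_apply, hf, hg, Finsupp.add_apply]; split_ifs <;> simp
  | single G c =>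
    simp only [crit, Finsupp.linearCombination_single]
    by_cases h : G = F
    · subst h; split_ifs <;> simp
    · split_ifs <;> simp [h]

theorem lift_mem {F : Finset V} (hF : X.cell F) :
    X.lift K F ∈ X.filt K (F.card + 1) ((X.path F).card + 1) := by
  rcases h : X.pivot (X.path F) with _ | v
  · rw [lift_none h]; exact Submodule.zero_mem _
  · rw [lift_eq h]
    split_ifs with hv
    · exact Submodule.zero_mem _
    · refine Finsupp.single_mem_supported K _ ⟨X.cell_insert hF h,
        Finset.card_insert_of_notMem hv, ?_⟩
      rw [X.path_insert hF h]; omega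

/-- A cell produced by the homotopy keeps the path of `F`, hence still has a pivot. This is why
primitives can be chosen without critical component. -/
theorem crit_lift {F : Finset V} (hF : X.cell F) : X.crit K (X.lift K F) = 0 := by
  rcases h : X.pivot (X.path F) with _ | v
  · rw [lift_none h, map_zero]
  · rw [lift_eq h]
    split_ifs with hv
    · exact map_zero _
    · have : ¬ X.Critical (insert v F) := fun hc => by
        have := hc.2
        rw [X.path_insert hF h, h] at this
        cases this
      simp [crit, Finsupp.linearCombination_single, this]

theorem filt_le_chains (d k : ℕ) : X.filt K d k ≤ X.chains K d :=
  Finsupp.supported_mono fun _ h => ⟨h.1, h.2.1⟩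

theorem filt_mono (d : ℕ) {k l : ℕ} (h : k ≤ l) : X.filt K d k ≤ X.filt K d l :=
  Finsupp.supported_mono fun _ hF => ⟨hF.1, hF.2.1, hF.2.2.trans_le h⟩

theorem path_erase_eq_or_lt (F : Finset V) (v : V) :
    X.path (F.erase v) = X.path F ∨ (X.path (F.erase v)).card < (X.path F).card := by
  rcases (X.path_mono (Finset.erase_subset v F)).eq_or_ssubset with h | h
  · exact Or.inl h
  · exact Or.inr (Finset.card_lt_card h)

theorem lift_erase_mem {F : Finset V} (hF : X.cell F) {w : V} (hw : w ∈ F) (hfw : X.free w)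
    (h : (X.path (F.erase w)).card < (X.path F).card) :
    X.lift K (F.erase w) ∈ X.filt K F.card (X.path F).card := by
  have := lift_mem (K := K) (X.cell_erase hF hw hfw)
  rw [Finset.card_erase_add_one hw] at this
  exact filt_mono _ h this

theorem homotopy_faceSum (F : Finset V) : X.homotopy K (X.faceSum K F) =
    ∑ w ∈ F.filter X.free, (-1 : K) ^ X.pos F w • X.lift K (F.erase w) := by
  simp [CellFamily.faceSum]

/-- This is the core of the Morse argument. Among the faces with the same path as `F`, the pivot is
unchanged, so the homotopy terms cancel or vanish; every other term has a strictly smaller path. -/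
theorem defect_single {F : Finset V} (hF : X.cell F) :
    X.bdry K (X.lift K F) + X.homotopy K (X.faceSum K F) + X.crit K (Finsupp.single F 1) -
      Finsupp.single F 1 ∈ X.filt K F.card (X.path F).card := by
  rw [homotopy_faceSum]
  rcases h : X.pivot (X.path F) with _ | v
  · have hc : X.crit K (Finsupp.single F 1) = Finsupp.single F 1 := by
      simp [crit, Finsupp.linearCombination_single, show X.Critical F from ⟨hF, h⟩]
    -- Critical cell: a face with the same path has no pivot either, so the homotopy kills it.
    rw [hc, lift_none h, map_zero, zero_add, add_sub_cancel_right]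
    refine Submodule.sum_mem _ fun w hw => Submodule.smul_mem _ _ ?_
    rw [Finset.mem_filter] at hw
    rcases X.path_erase_eq_or_lt F w with h' | h'
    · rw [lift_none (by rw [h', h])]; exact Submodule.zero_mem _
    · exact lift_erase_mem hF hw.1 hw.2 h'
  · have hc : X.crit K (Finsupp.single F 1) = 0 := by
      have : ¬ X.Critical F := fun hc => by
        have := hc.2
        rw [h] at this
        cases this
      simp [crit, Finsupp.linearCombination_single, this]
    have hfv := X.pivot_free hF h
    rw [hc, add_zero]
    by_cases hv : v ∈ F
    -- Pivot in `F`: the homotopy applied to the face without `v` restores `F` with squared sign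
    -- `1`; the other faces with the same path still contain `v` and are killed.
    · rw [lift_eq h, if_pos hv, map_zero, zero_add,
        ← Finset.add_sum_erase _ _ (Finset.mem_filter.2 ⟨hv, hfv⟩)]
      have h1 : (-1 : K) ^ X.pos F v • X.lift K (F.erase v) = Finsupp.single F 1 := by
        rw [lift_eq (v := v) (by rw [X.path_erase hF h, h]), if_neg (Finset.notMem_erase v F),
          Finset.insert_erase hv, Finsupp.smul_single, smul_eq_mul, ← pow_add, ← two_mul,
          pow_mul]
        simp
      rw [h1, add_sub_cancel_left]
      refine Submodule.sum_mem _ fun w hw => Submodule.smul_mem _ _ ?_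
      rw [Finset.mem_erase, Finset.mem_filter] at hw
      rcases X.path_erase_eq_or_lt F w with h' | h'
      · rw [lift_eq (v := v) (by rw [h', h]), if_pos (Finset.mem_erase.2 ⟨hw.1.symm, hv⟩)]
        exact Submodule.zero_mem _
      · exact lift_erase_mem hF hw.2.1 hw.2.2 h'
    -- Pivot not in `F`: in the boundary of `G = F ∪ {v}`, the face without `v` restores `F`. For
    -- the other elements `w`, the face of `G` without `w` cancels with the homotopy of the face of
    -- `F` without `w` whenever that face has the path of `F`.
    · have hG := X.cell_insert hF h
      have hp := X.path_insert hF h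
      set G := insert v F with hGdef
      have hvG : v ∈ G := Finset.mem_insert_self v F
      have hGv : G.erase v = F := Finset.erase_insert hv
      have hfilt : G.filter X.free = insert v (F.filter X.free) := by
        rw [hGdef, Finset.filter_insert, if_pos hfv]
      rw [lift_eq h, if_neg hv, CellFamily.bdry_single, CellFamily.faceSum, hfilt,
        Finset.sum_insert (by simp [hv]), hGv, smul_add, Finsupp.smul_single, smul_eq_mul,
        ← pow_add, ← two_mul, pow_mul, neg_one_sq, one_pow, add_assoc, add_sub_cancel_left,
        Finset.smul_sum, ← Finset.sum_add_distrib]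
      refine Submodule.sum_mem _ fun w hw => ?_
      rw [Finset.mem_filter] at hw
      have hvw : v ≠ w := fun e => hv (e ▸ hw.1)
      have hwG : w ∈ G := Finset.mem_insert_of_mem hw.1
      have hGw : insert v (F.erase w) = G.erase w :=
        (Finset.erase_insert_of_ne hvw).symm
      have hGwv : (G.erase w).erase v = F.erase w := by
        rw [Finset.erase_right_comm, hGv]
      have hcG := X.cell_erase hG hwG hw.2
      rcases X.path_erase_eq_or_lt F w with h' | h'
      · rw [lift_eq (v := v) (by rw [h', h]), if_neg (fun e => hv (Finset.mem_of_mem_erase e)),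
          hGw]
        have := CellFamily.sign_antisymm (K := K) hG hvG hwG hvw
        rw [hGv] at this
        simp only [Finsupp.smul_single, smul_eq_mul, ← pow_add]
        have h2 : X.pos F w + X.pos (G.erase w) v + X.pos G w + X.pos G w =
          X.pos G w + X.pos (G.erase w) v + (X.pos F w + X.pos G w) := by ring
        have hs : (-1 : K) ^ (X.pos G v + X.pos G w) =
            - (-1 : K) ^ (X.pos F w + X.pos (G.erase w) v) := by
          have h3 : ∀ a : ℕ, (-1 : K) ^ a * (-1) ^ a = 1 := fun a => by
            rw [← pow_add, ← two_mul, pow_mul]; simp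
          rw [pow_add, pow_add] at this ⊢
          linear_combination ((-1 : K) ^ X.pos F w * (-1) ^ X.pos G w) * this
            - (-1 : K) ^ X.pos G v * (-1) ^ X.pos G w * h3 (X.pos F w)
            - (-1 : K) ^ X.pos F w * (-1) ^ X.pos (G.erase w) v * h3 (X.pos G w)
        rw [hs, ← Finsupp.single_add, neg_add_cancel, Finsupp.single_zero]
        exact Submodule.zero_mem _
      · refine add_mem ?_ (Submodule.smul_mem _ _ (lift_erase_mem hF hw.1 hw.2 h'))
        rw [Finsupp.smul_single]
        refine Finsupp.single_mem_supported K _ ⟨hcG, ?_, ?_⟩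
        · rw [Finset.card_erase_of_mem hwG, Finset.card_insert_of_notMem hv]; rfl
        -- If removing `w` kept the path of `G`, the pivot would still be `v`, and removing `v` as
        -- well would show that the face of `F` has the path of `F`, against `h'`.
        · rcases X.path_erase_eq_or_lt G w with h4 | h4
          · rw [hp] at h4
            have h5 := X.path_erase hcG (v := v) (by rw [h4, h])
            rw [hGwv, h4] at h5
            rw [h5] at h'
            exact absurd h' (lt_irrefl _)
          · rwa [hp] at h4

theorem defect_mem {d k : ℕ} {x : Finset V →₀ K} (hx : x ∈ X.filt K d (k + 1)) :
    X.bdry K (X.homotopy K x) + X.homotopy K (X.bdry K x) + X.crit K x - x ∈ X.filt K d k := by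
  unfold filt at hx
  rw [Finsupp.supported_eq_span_single] at hx
  induction hx using Submodule.span_induction with
  | mem y hy =>
    obtain ⟨F, ⟨hF, rfl, hk⟩, rfl⟩ := hy
    have := X.defect_single (K := K) hF
    simp only [homotopy_single, one_smul, CellFamily.bdry_single] at this ⊢
    exact filt_mono _ (by omega) this
  | zero => simp
  | add y z _ _ hy hz =>
    simp only [map_add]
    convert add_mem hy hz using 1
    abel
  | smul c y _ hy =>
    simp only [map_smul]
    convert Submodule.smul_mem _ c hy using 1
    simp only [smul_add, smul_sub]

theorem homotopy_mem {d : ℕ} {x : Finset V →₀ K} (hx : x ∈ X.chains K d) :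
    X.homotopy K x ∈ X.chains K (d + 1) ∧ X.crit K (X.homotopy K x) = 0 := by
  unfold CellFamily.chains at hx
  rw [Finsupp.supported_eq_span_single] at hx
  induction hx using Submodule.span_induction with
  | mem y hy =>
    obtain ⟨F, ⟨hF, rfl⟩, rfl⟩ := hy
    simp only [homotopy_single, one_smul]
    exact ⟨filt_le_chains _ _ (lift_mem hF), crit_lift hF⟩
  | zero => simp
  | add y z _ _ hy hz =>
    simp only [map_add]
    exact ⟨add_mem hy.1 hz.1, by rw [hy.2, hz.2, add_zero]⟩
  | smul c y _ hy =>
    simp only [map_smul]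
    exact ⟨Submodule.smul_mem _ _ hy.1, by rw [hy.2, smul_zero]⟩

theorem chains_eq_zero {d : ℕ} (hd : X.top < d) {x : Finset V →₀ K} (hx : x ∈ X.chains K d) :
    x = 0 := by
  ext F
  by_contra h
  have := hx (Finsupp.mem_support_iff.2 h)
  have := X.card_le this.1
  have := this.trans_lt hd
  simp_all

/-- Critical cells only exist in the top degree. -/
theorem crit_eq_zero {d : ℕ} (hd : d ≠ X.top) {x : Finset V →₀ K} (hx : x ∈ X.chains K d) :
    X.crit K x = 0 := by
  ext F
  rw [crit_apply]
  split_ifs with hF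
  · by_contra h
    have := hx (Finsupp.mem_support_iff.2 h)
    exact hd (this.2.symm.trans (X.card_critical hF.1 hF.2))
  · rfl

theorem mem_filt_of_mem_chains {d : ℕ} {x : Finset V →₀ K} (hx : x ∈ X.chains K d) :
    ∃ k, x ∈ X.filt K d k :=
  ⟨(x.support.sup fun F => (X.path F).card) + 1, fun _ hF =>
    ⟨(hx hF).1, (hx hF).2, Nat.lt_succ_of_le (Finset.le_sup (f := fun F => (X.path F).card) hF)⟩⟩

theorem eq_zero_of_mem_filt_zero {d : ℕ} {x : Finset V →₀ K} (hx : x ∈ X.filt K d 0) : x = 0 := by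
  ext F
  by_contra h
  exact absurd (hx (Finsupp.mem_support_iff.2 h)).2.2 (Nat.not_lt_zero _)

/-- The complex of cells is exact below the top degree. -/
theorem exists_primitive {d : ℕ} (hd : d < X.top) {x : Finset V →₀ K} (hx : x ∈ X.chains K d)
    (h0 : X.bdry K x = 0) :
    ∃ z ∈ X.chains K (d + 1), X.crit K z = 0 ∧ X.bdry K z = x := by
  obtain ⟨k, hk⟩ := mem_filt_of_mem_chains hx
  induction k generalizing x with
  | zero => exact
    ⟨0, Submodule.zero_mem _, map_zero _, by rw [eq_zero_of_mem_filt_zero hk, map_zero]⟩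
  | succ k ih =>
    -- For a cycle without critical part, the boundary of the homotopy differs from `x` by a cycle
    -- with smaller paths, to which the induction applies.
    have h1 := defect_mem hk
    rw [h0, map_zero, add_zero, crit_eq_zero hd.ne hx, add_zero] at h1
    obtain ⟨hm, hc⟩ := homotopy_mem hx
    obtain ⟨z, hz, hzc, hz'⟩ := ih (filt_le_chains _ _ h1)
      (by rw [map_sub, CellFamily.bdry_bdry hm, h0, sub_zero]) h1
    exact ⟨X.homotopy K x - z, sub_mem hm hz, by rw [map_sub, hc, hzc, sub_zero],
      by rw [map_sub, hz', sub_sub_cancel]⟩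

/-- The cycles of top degree are determined by their critical components. -/
theorem eq_zero_of_crit_eq_zero {x : Finset V →₀ K} (hx : x ∈ X.chains K X.top)
    (h0 : X.bdry K x = 0) (hc : X.crit K x = 0) : x = 0 := by
  have key : ∀ k, x ∈ X.filt K X.top k → x = 0 := by
    intro k hk
    induction k with
    | zero => exact eq_zero_of_mem_filt_zero hk
    | succ k ih =>
      have h1 := defect_mem hk
      -- The homotopy of `x` lives above the top degree, so the whole defect reduces to `-x`, which
      -- thus has smaller paths.
      rw [h0, hc, chains_eq_zero (Nat.lt_succ_self _) (homotopy_mem hx).1] at h1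
      refine ih ?_
      simpa using h1
  obtain ⟨k, hk⟩ := mem_filt_of_mem_chains hx
  exact key k hk

/-- The critical components of a cycle of top degree can be prescribed. -/
theorem exists_cycle {y : Finset V →₀ K} (hy : y ∈ X.chains K X.top) (hc : X.crit K y = y) :
    ∃ x ∈ X.chains K X.top, (∀ d, d + 1 = X.top → X.bdry K x = 0) ∧ X.crit K x = y := by
  rcases h : X.top with _ | d
  · exact ⟨y, h ▸ hy, by simp, hc⟩
  · rw [h] at hy
    -- The boundary of `y` has a primitive `z` without critical component; subtracting it makes `y`
    -- a cycle and leaves the critical part untouched.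
    obtain ⟨z, hz, hzc, hz'⟩ := X.exists_primitive (d := d) (by omega)
      (CellFamily.bdry_mem hy) (CellFamily.bdry_bdry hy)
    exact ⟨y - z, sub_mem hy hz, fun _ _ => by rw [map_sub, hz', sub_self],
      by rw [map_sub, hzc, hc, sub_zero]⟩

end CellMatching

/-! ## Reduced trees -/

namespace SymmOperad.RTree

open Classical

variable {n d : ℕ}

theorem exists_input (T : RTree n d) {v : Finset (Fin n)} (hv : 2 ≤ v.card) {a : Fin n}
    (ha : a ∈ v) : ∃ c ∈ T.inputs v, a ∈ c := by
  obtain ⟨c, hc, hmax⟩ := (Finset.univ.filter fun c =>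
      c ⊂ v ∧ (c ∈ T.verts ∨ c.card = 1) ∧ a ∈ c).exists_max_image Finset.card
    ⟨{a}, by
      simp only [Finset.mem_filter, Finset.mem_univ, true_and, Finset.card_singleton, or_true,
        Finset.mem_singleton, and_true]
      refine (Finset.singleton_subset_iff.2 ha).ssubset_of_ne fun h => ?_
      rw [← h, Finset.card_singleton] at hv
      omega⟩
  simp only [Finset.mem_filter, Finset.mem_univ, true_and] at hc hmax
  refine ⟨c, mem_inputs.2 ⟨hc.1, hc.2.1, fun w hw hcw hwv => ?_⟩, hc.2.2⟩
  exact absurd (hmax w ⟨hwv, Or.inl hw, hcw.1 hc.2.2⟩) (not_le.2 (Finset.card_lt_card hcw))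

/-- An ingoing edge is a proper subset of `v`, so an entry of `v` outside it lies on a second one.
-/
theorem two_le_card_inputs (T : RTree n d) {v : Finset (Fin n)} (hv : 2 ≤ v.card) :
    2 ≤ (T.inputs v).card := by
  obtain ⟨a, ha⟩ := Finset.card_pos.1 (by omega : 0 < v.card)
  obtain ⟨c, hc, hac⟩ := T.exists_input hv ha
  have hcv := (mem_inputs.1 hc).1
  obtain ⟨b, hb, hbc⟩ := Finset.exists_of_ssubset hcv
  obtain ⟨e, he, hbe⟩ := T.exists_input hv hb
  exact Finset.one_lt_card.2 ⟨c, hc, e, he, fun h => hbc (h ▸ hbe)⟩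

theorem univ_mem (T : RTree n d) (hn : n ≠ 1) : Finset.univ ∈ T.verts := T.root.resolve_right hn

theorem exists_parent_of_or (T : RTree n d) (hn : n ≠ 1) {c : Finset (Fin n)}
    (hc : c ∈ T.verts ∨ c.card = 1) (hr : c ≠ Finset.univ) : ∃ w ∈ T.verts, c ∈ T.inputs w := by
  obtain ⟨w, hw, hmin⟩ := (T.verts.filter (c ⊂ ·)).exists_min_image Finset.card
    ⟨Finset.univ, Finset.mem_filter.2
      ⟨T.univ_mem hn, (Finset.subset_univ c).ssubset_of_ne hr⟩⟩
  rw [Finset.mem_filter] at hw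
  refine ⟨w, hw.1, mem_inputs.2 ⟨hw.2, hc, fun u hu hcu huw => ?_⟩⟩
  exact absurd (hmin u (Finset.mem_filter.2 ⟨hu, hcu⟩)) (not_le.2 (Finset.card_lt_card huw))

theorem verts_eq_empty (T : RTree 1 d) : T.verts = ∅ := by
  refine Finset.eq_empty_of_forall_notMem fun v hv => ?_
  have h1 := T.two_le v hv
  have h2 := Finset.card_le_univ v
  rw [Fintype.card_fin] at h2
  omega

/-- The sum of the weights of the vertices of a tree with `n` entries is `n - 1`. -/
theorem sum_card_inputs (T : RTree n d) :
    ∑ v : T.verts, ((T.inputs v).card - 1) = n - 1 := by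
  rw [Finset.sum_coe_sort T.verts fun v => (T.inputs v).card - 1]
  by_cases hn : n = 1
  · subst hn
    rw [T.verts_eq_empty]; rfl
  have hu := T.univ_mem hn
  have h2 : 2 ≤ n := by simpa using T.two_le _ hu
  -- Count the edges by their sources: each non-root vertex and each entry is an ingoing edge of
  -- exactly one vertex.
  have h1 : ∑ v ∈ T.verts, (T.inputs v).card = (T.verts.card - 1) + n := by
    rw [← Finset.card_biUnion]
    · have : T.verts.biUnion T.inputs =
          T.verts.erase Finset.univ ∪
            Finset.univ.map ⟨fun a => {a}, Finset.singleton_injective⟩ := by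
        ext c
        simp only [Finset.mem_biUnion, Finset.mem_union, Finset.mem_erase, Finset.mem_map,
          Finset.mem_univ, true_and, Function.Embedding.coeFn_mk]
        constructor
        · rintro ⟨v, hv, hc⟩
          obtain ⟨h1, h2, -⟩ := mem_inputs.1 hc
          rcases h2 with h2 | h2
          · exact Or.inl ⟨fun h => (h ▸ h1).2 (Finset.subset_univ _), h2⟩
          · obtain ⟨a, rfl⟩ := Finset.card_eq_one.1 h2
            exact Or.inr ⟨a, rfl⟩
        · rintro (⟨h, hc⟩ | ⟨a, rfl⟩)
          · exact T.exists_parent_of_or hn (Or.inl hc) h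
          · refine T.exists_parent_of_or hn (Or.inr (Finset.card_singleton a)) fun h => ?_
            have := congrArg Finset.card h
            simp at this
            omega
      rw [this, Finset.card_union_of_disjoint, Finset.card_erase_of_mem hu, Finset.card_map,
        Finset.card_univ, Fintype.card_fin]
      rw [Finset.disjoint_left]
      intro c hc hc'
      simp only [Finset.mem_map, Finset.mem_univ, true_and, Function.Embedding.coeFn_mk] at hc'
      obtain ⟨a, rfl⟩ := hc'
      have := T.two_le _ (Finset.mem_of_mem_erase hc)
      simp at this
    · intro v hv w hw hvw
      rw [Function.onFun, Finset.disjoint_left]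
      exact fun c hc hc' => hvw (T.parent_unique hv hw hc hc')
  have h3 : ∑ v ∈ T.verts, (T.inputs v).card =
      ∑ v ∈ T.verts, ((T.inputs v).card - 1) + T.verts.card := by
    rw [Finset.card_eq_sum_ones, ← Finset.sum_add_distrib]
    refine Finset.sum_congr rfl fun v hv => ?_
    have := T.two_le_card_inputs (T.two_le v hv)
    omega
  have h4 := Finset.card_pos.2 ⟨_, hu⟩
  omega

/-- Every vertex has weight at least one and the total weight is `n - 1`. -/
theorem degree_le (T : RTree n d) : d ≤ n - 1 := by
  have h : d = ∑ v : T.verts, 1 := by simp [T.card_verts]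
  rw [← T.sum_card_inputs]
  refine h.trans_le (Finset.sum_le_sum fun v _ => ?_)
  have := T.two_le_card_inputs (T.two_le v v.2)
  omega

/-- A laminar family of subsets with at least two elements which contains the whole set. -/
def IsFamily (n : ℕ) (F : Finset (Finset (Fin n))) : Prop :=
  (∀ v ∈ F, 2 ≤ v.card) ∧ (∀ v ∈ F, ∀ w ∈ F, v ⊆ w ∨ w ⊆ v ∨ Disjoint v w) ∧
    (Finset.univ ∈ F ∨ n = 1)

theorem isFamily (T : RTree n d) : IsFamily n T.verts := ⟨T.two_le, T.laminar, T.root⟩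

/-- The reduced tree associated to a laminar family. -/
def ofFamily {F : Finset (Finset (Fin n))} (h : IsFamily n F) (hd : F.card = d) : RTree n d :=
  ⟨F, hd, h.1, h.2.1, h.2.2⟩

/-- `U ⊂ V` are consecutive members of `{0} ∪ Q`, and `V \ U` is not a single entry. -/
def IsGap {m : ℕ} (Q : Finset (Finset (Fin (m + 1))))
    (p : Finset (Fin (m + 1)) × Finset (Fin (m + 1))) : Prop :=
  (p.1 ∈ Q ∨ p.1 = {0}) ∧ p.2 ∈ Q ∧ p.1 ⊂ p.2 ∧ (∀ w ∈ Q, p.1 ⊂ w → ¬ w ⊂ p.2) ∧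
    2 ≤ (p.2 \ p.1).card

/-- The difference of two consecutive members of the chain `{0} ∪ Q` when it is not a single
entry. -/
noncomputable def gap {m : ℕ} (Q : Finset (Finset (Fin (m + 1)))) : Option (Finset (Fin (m + 1))) :=
  -- Any selection rule would do: since it sees only the path, cells with the same path receive the
  -- same pivot.
  if h : ∃ p, IsGap Q p then some (h.choose.2 \ h.choose.1) else none

theorem gap_eq_some {m : ℕ} {Q : Finset (Finset (Fin (m + 1)))} {v : Finset (Fin (m + 1))}
    (h : gap Q = some v) : ∃ p, IsGap Q p ∧ v = p.2 \ p.1 := by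
  unfold gap at h
  split_ifs at h with h'
  exact ⟨_, h'.choose_spec, (Option.some.inj h).symm⟩

theorem gap_eq_none {m : ℕ} {Q : Finset (Finset (Fin (m + 1)))} (h : gap Q = none) :
    ∀ p, ¬ IsGap Q p := by
  unfold gap at h
  split_ifs at h with h'
  exact not_exists.1 h'

/-- The vertices on the path from the entry `0` to the root. -/
noncomputable def rootPath {m : ℕ} (F : Finset (Finset (Fin (m + 1)))) :
    Finset (Finset (Fin (m + 1))) := F.filter fun v => 0 ∈ v

/-- The smaller set of a gap contains `0`. Consequently the pivot is never the root, and adding or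
removing it does not alter the path. -/
theorem gap_zero_notMem {m : ℕ} {F : Finset (Finset (Fin (m + 1)))} {v : Finset (Fin (m + 1))}
    (h : gap (rootPath F) = some v) : 0 ∉ v := by
  obtain ⟨⟨U, V⟩, ⟨h1, -⟩, rfl⟩ := gap_eq_some h
  have : (0 : Fin (m + 1)) ∈ U := by
    rcases h1 with h1 | h1
    · exact (Finset.mem_filter.1 h1).2
    · change U = _ at h1
      simp [h1]
  simp [this]

/-- Inserting `V \ U` groups the branches at `V` off the path. A member of `F` inside `V` that
contains `0` is contained in `U` or equals `V`, because `U` and `V` are consecutive; one that avoids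
`0` lies inside `U` or is disjoint from it. -/
theorem IsFamily.insert_gap {m : ℕ} {F : Finset (Finset (Fin (m + 1)))} (hF : IsFamily (m + 1) F)
    {v : Finset (Fin (m + 1))} (h : gap (rootPath F) = some v) :
    IsFamily (m + 1) (insert v F) := by
  have h0 := gap_zero_notMem h
  obtain ⟨⟨U, V⟩, ⟨h1, h2, h3, h4, h5⟩, rfl⟩ := gap_eq_some h
  simp only at h1 h2 h3 h4 h5 h0 ⊢
  have hV := (Finset.mem_filter.1 h2).1
  have hU0 : (0 : Fin (m + 1)) ∈ U := by
    rcases h1 with h1 | h1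
    · exact (Finset.mem_filter.1 h1).2
    · simp [h1]
  have key : ∀ w ∈ F, V \ U ⊆ w ∨ w ⊆ V \ U ∨ Disjoint (V \ U) w := by
    intro w hw
    rcases hF.2.1 w hw V hV with h | h | h
    · by_cases hw0 : (0 : Fin (m + 1)) ∈ w
      · have hUw : w ⊆ U ∨ U ⊆ w := by
          rcases h1 with h1 | h1
          · rcases hF.2.1 w hw U (Finset.mem_filter.1 h1).1 with h' | h' | h'
            · exact Or.inl h'
            · exact Or.inr h'
            · exact absurd hU0 (Finset.disjoint_left.1 h' hw0)
          · exact Or.inr (by simpa [h1] using hw0)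
        rcases hUw with h' | h'
        · refine Or.inr (Or.inr ?_)
          exact Finset.disjoint_of_subset_right h' Finset.sdiff_disjoint
        · rcases h'.eq_or_ssubset with rfl | h'
          · exact Or.inr (Or.inr Finset.sdiff_disjoint)
          · rcases h.eq_or_ssubset with rfl | h
            · exact Or.inl Finset.sdiff_subset
            · exact absurd h (h4 w (Finset.mem_filter.2 ⟨hw, hw0⟩) h')
      · rcases h1 with h1 | h1
        · rcases hF.2.1 w hw U (Finset.mem_filter.1 h1).1 with h' | h' | h'
          · exact Or.inr (Or.inr (Finset.disjoint_of_subset_right h' Finset.sdiff_disjoint))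
          · exact absurd (h' hU0) hw0
          · exact Or.inr (Or.inl (Finset.subset_sdiff.2 ⟨h, h'⟩))
        · refine Or.inr (Or.inl (Finset.subset_sdiff.2 ⟨h, ?_⟩))
          rw [h1]; simpa using hw0
    · exact Or.inl (Finset.sdiff_subset.trans h)
    · exact Or.inr (Or.inr (Finset.disjoint_of_subset_left Finset.sdiff_subset h.symm))
  refine ⟨?_, ?_, hF.2.2.imp_left (Finset.mem_insert_of_mem)⟩
  · intro w hw
    rcases Finset.mem_insert.1 hw with rfl | hw
    · exact h5
    · exact hF.1 w hw
  · intro w hw w' hw'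
    rcases Finset.mem_insert.1 hw with rfl | hw
    · rcases Finset.mem_insert.1 hw' with rfl | hw'
      · exact Or.inl subset_rfl
      · exact key w' hw'
    · rcases Finset.mem_insert.1 hw' with rfl | hw'
      · rcases key w hw with h | h | h
        · exact Or.inr (Or.inl h)
        · exact Or.inl h
        · exact Or.inr (Or.inr h.symm)
      · exact hF.2.1 w hw w' hw'

/-- Without gap, the smallest path vertex above `U` has just one entry more, so the path climbs from
`{0}` through all sizes. -/
theorem exists_rootPath_card {m : ℕ} {F : Finset (Finset (Fin (m + 1)))} (hF : IsFamily (m + 1) F)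
    (h : gap (rootPath F) = none) (k : ℕ) (hk : k ≤ m) :
    ∃ U, (U ∈ rootPath F ∨ U = {0}) ∧ U.card = k + 1 := by
  induction k with
  | zero => exact ⟨{0}, Or.inr rfl, rfl⟩
  | succ k ih =>
    obtain ⟨U, hU, hUk⟩ := ih (by omega)
    have hU0 : (0 : Fin (m + 1)) ∈ U := by
      rcases hU with h1 | h1
      · exact (Finset.mem_filter.1 h1).2
      · simp [h1]
    have huniv : Finset.univ ∈ F := hF.2.2.resolve_right (by omega)
    obtain ⟨V, hV, hmin⟩ := ((rootPath F).filter (U ⊂ ·)).exists_min_image Finset.card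
      ⟨Finset.univ, Finset.mem_filter.2 ⟨Finset.mem_filter.2 ⟨huniv, Finset.mem_univ _⟩,
        (Finset.subset_univ U).ssubset_of_ne fun h => by
          rw [h, Finset.card_univ, Fintype.card_fin] at hUk
          omega⟩⟩
    rw [Finset.mem_filter] at hV
    refine ⟨V, Or.inl hV.1, ?_⟩
    by_contra hne
    refine gap_eq_none h (U, V) ⟨hU, hV.1, hV.2, fun w hw hUw hwV => ?_, ?_⟩
    · exact absurd (hmin w (Finset.mem_filter.2 ⟨hw, hUw⟩)) (not_le.2 (Finset.card_lt_card hwV))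
    · have h1 := Finset.card_lt_card hV.2
      have h2 := Finset.card_sdiff_add_card_eq_card hV.2.1
      simp only
      omega

/-- All sizes from `2` to `m + 1` occur on the path; size `1` is left out because `{0}` is an entry,
not a vertex. -/
theorem le_card_rootPath {m : ℕ} {F : Finset (Finset (Fin (m + 1)))} (hF : IsFamily (m + 1) F)
    (h : gap (rootPath F) = none) : m ≤ (rootPath F).card := by
  have : Finset.Ioc 1 (m + 1) ⊆ (rootPath F).image Finset.card := by
    intro k hk
    rw [Finset.mem_Ioc] at hk
    obtain ⟨U, hU, hUk⟩ := exists_rootPath_card hF h (k - 1) (by omega)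
    rcases hU with hU | hU
    · exact Finset.mem_image.2 ⟨U, hU, by omega⟩
    · rw [hU, Finset.card_singleton] at hUk
      omega
  have := (Finset.card_le_card this).trans Finset.card_image_le
  simpa using this

/-- The matching on the laminar families of subsets of `{0, …, m}`. -/
noncomputable def matching (m : ℕ) :
    CellMatching (Finset (Fin (m + 1))) (Finset (Fin (m + 1))) where
  cell := IsFamily (m + 1)
  free v := v ≠ Finset.univ
  lt w v := toColex w < toColex v
  cell_erase hF _ hv := ⟨fun w hw => hF.1 w (Finset.mem_of_mem_erase hw),
    fun w hw w' hw' => hF.2.1 w (Finset.mem_of_mem_erase hw) w' (Finset.mem_of_mem_erase hw'),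
    hF.2.2.imp_left fun h => Finset.mem_erase.2 ⟨hv.symm, h⟩⟩
  total _ _ _ hne := ⟨fun h => h.asymm, fun h =>
    lt_of_le_of_ne (not_lt.1 h) fun e => hne (toColex_inj.1 e)⟩
  path := rootPath
  pivot := gap
  top := m
  path_mono _ _ h := Finset.filter_subset_filter _ h
  pivot_free _ h e := gap_zero_notMem h (e ▸ Finset.mem_univ _)
  cell_insert hF h := by convert hF.insert_gap h
  path_insert hF h := by
    unfold rootPath
    rw [Finset.filter_insert, if_neg (gap_zero_notMem h)]
  path_erase hF h := by
    unfold rootPath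
    rw [Finset.filter_erase, Finset.erase_eq_of_notMem]
    simp [gap_zero_notMem h]
  card_le hF := (ofFamily hF rfl).degree_le
  card_critical hF h := le_antisymm (ofFamily hF rfl).degree_le
    ((le_card_rootPath hF h).trans (Finset.card_filter_le _ _))

/-- A critical family is exhausted by its path. Conversely, a pivot would avoid `0`, hence be a new
vertex, and no family has more than `m` vertices. These families are the complete flags above `{0}`,
`m!` in number. -/
theorem critical_iff {m : ℕ} {F : Finset (Finset (Fin (m + 1)))} :
    (matching m).Critical F ↔ IsFamily (m + 1) F ∧ F.card = m ∧ ∀ v ∈ F, 0 ∈ v := by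
  constructor
  · rintro ⟨hF, h⟩
    have h1 := (matching m).card_critical hF h
    refine ⟨hF, h1, fun v hv => ?_⟩
    have h2 : rootPath F = F := Finset.eq_of_subset_of_card_le (Finset.filter_subset _ _)
      (h1.trans_le (le_card_rootPath hF h))
    rw [← h2] at hv
    exact (Finset.mem_filter.1 hv).2
  · rintro ⟨hF, hc, h0⟩
    refine ⟨hF, ?_⟩
    by_contra hne
    obtain ⟨v, hv⟩ := Option.ne_none_iff_exists'.1 hne
    have h1 := (matching m).card_le ((matching m).cell_insert hF hv)
    have h2 : v ∉ F := fun h => gap_zero_notMem hv (h0 v h)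
    rw [Finset.card_insert_of_notMem h2, hc] at h1
    exact absurd h1 (Nat.not_succ_le_self _)

end SymmOperad.RTree

/-! ## Chains of partitions -/

namespace Partitions

open Classical

/-- The partitions of `{0, …, m}`. -/
abbrev Part (m : ℕ) : Type := Finpartition (Finset.univ : Finset (Fin (m + 1)))

variable {m : ℕ}

/-- The block which contains `0`. -/
def base (π : Part m) : Finset (Fin (m + 1)) := π.part 0

theorem base_mem (π : Part m) : base π ∈ π.parts := π.part_mem.2 (Finset.mem_univ _)

theorem zero_mem_base (π : Part m) : 0 ∈ base π := π.mem_part_self.2 (Finset.mem_univ _)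

theorem eq_base {π : Part m} {c : Finset (Fin (m + 1))} (hc : c ∈ π.parts) (h : 0 ∈ c) :
    c = base π := (π.part_eq_of_mem hc h).symm

theorem base_mono {π σ : Part m} (h : π ≤ σ) : base π ⊆ base σ := by
  obtain ⟨c, hc, hle⟩ := h (base_mem π)
  rw [← eq_base hc (hle (zero_mem_base π))]
  exact hle

theorem base_bot : base (⊥ : Part m) = {0} := by
  refine (eq_base ?_ (Finset.mem_singleton_self 0)).symm
  exact Finpartition.mem_bot_iff.2 ⟨0, Finset.mem_univ _, rfl⟩

theorem parts_top : (⊤ : Part m).parts = {Finset.univ} := by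
  refine (Finset.subset_singleton_iff.1 (Finpartition.parts_top_subset _)).resolve_left ?_
  exact (Finpartition.parts_nonempty _ Finset.univ_nonempty.ne_empty).ne_empty

theorem eq_top_iff_parts {π : Part m} : π = ⊤ ↔ π.parts = {Finset.univ} :=
  ⟨fun h => h ▸ parts_top, fun h => Finpartition.ext (h.trans parts_top.symm)⟩

theorem base_top : base (⊤ : Part m) = Finset.univ :=
  (eq_base (by simp [parts_top]) (Finset.mem_univ _)).symm

theorem eq_top_of_base {π : Part m} (h : base π = Finset.univ) : π = ⊤ := by
  rw [eq_top_iff_parts]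
  have hu := base_mem π
  rw [h] at hu
  refine Finset.eq_singleton_iff_unique_mem.2 ⟨hu, fun c hc => ?_⟩
  obtain ⟨a, ha⟩ := π.nonempty_of_mem_parts hc
  exact π.eq_of_mem_parts hc hu ha (Finset.mem_univ a)

/-- Sending a block of `π` to the block of `σ` containing it is surjective. If the numbers of blocks
agreed it would be injective too, and each block of `σ` would coincide with the block of `π` inside
it. -/
theorem card_parts_lt {n : ℕ} {π σ : Finpartition (Finset.univ : Finset (Fin n))} (h : π < σ) :
    σ.parts.card < π.parts.card := by
  refine lt_of_le_of_ne (Finpartition.card_mono h.le) fun he => h.not_ge fun s hs => ?_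
  choose f hf hle using h.le
  have hsurj : ∀ t ∈ σ.parts, ∃ c, ∃ hc : c ∈ π.parts, f hc = t := by
    intro t ht
    obtain ⟨c, hc, hct⟩ := Finpartition.exists_le_of_le h.le ht
    obtain ⟨a, ha⟩ := π.nonempty_of_mem_parts hc
    exact ⟨c, hc, σ.eq_of_mem_parts (hf hc) ht (hle hc ha) (hct ha)⟩
  have hinj := Finset.inj_on_of_surj_on_of_card_le (fun c hc => f hc) (fun c hc => hf hc)
    (fun t ht => by obtain ⟨c, hc, e⟩ := hsurj t ht; exact ⟨c, hc, e⟩) he.ge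
  obtain ⟨c, hc, rfl⟩ := hsurj s hs
  refine ⟨c, hc, fun x hx => ?_⟩
  obtain ⟨c', hc', hxc'⟩ := π.exists_mem (Finset.mem_univ x)
  have := σ.eq_of_mem_parts (hf hc') (hf hc) (hle hc' hxc') hx
  rwa [← hinj hc' hc this]

/-! ### Splitting the block of `0`; steps and gaps of a chain. -/

/-- The partition obtained from `τ` by splitting the block of `0` into `U` and its complement. -/
noncomputable def split (τ : Part m) (U : Finset (Fin (m + 1))) : Part m :=
  if h : 0 ∈ U ∧ U ⊂ base τ then
    Finpartition.ofExistsUnique (insert U (insert (base τ \ U) (τ.parts.erase (base τ))))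
      (fun _ _ => Finset.subset_univ _)
      (fun a _ => by
        obtain ⟨c, hc, hac⟩ := τ.exists_mem (Finset.mem_univ a)
        have hne : ∀ {c'}, c' ∈ τ.parts.erase (base τ) → a ∈ c' → a ∉ base τ := fun h1 h2 h3 =>
          (Finset.mem_erase.1 h1).1
            (τ.eq_of_mem_parts (Finset.mem_of_mem_erase h1) (base_mem τ) h2 h3)
        by_cases hb : a ∈ base τ
        · by_cases hU : a ∈ U
          · refine ⟨U, ⟨by simp, hU⟩, ?_⟩
            rintro c' ⟨h1, h2⟩
            rcases Finset.mem_insert.1 h1 with h1 | h1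
            · exact h1
            rcases Finset.mem_insert.1 h1 with rfl | h1
            · simp [hU] at h2
            · exact absurd hb (hne h1 h2)
          · refine ⟨base τ \ U, ⟨by simp, by simp [hb, hU]⟩, ?_⟩
            rintro c' ⟨h1, h2⟩
            rcases Finset.mem_insert.1 h1 with rfl | h1
            · exact absurd h2 hU
            rcases Finset.mem_insert.1 h1 with h1 | h1
            · exact h1
            · exact absurd hb (hne h1 h2)
        · have hcb : c ∈ τ.parts.erase (base τ) := Finset.mem_erase.2 ⟨fun e => hb (e ▸ hac), hc⟩
          refine ⟨c, ⟨by simp [Finset.mem_erase.1 hcb], hac⟩, ?_⟩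
          rintro c' ⟨h1, h2⟩
          rcases Finset.mem_insert.1 h1 with rfl | h1
          · exact absurd (h.2.1 h2) hb
          rcases Finset.mem_insert.1 h1 with rfl | h1
          · exact absurd (Finset.sdiff_subset h2) hb
          · exact τ.eq_of_mem_parts (Finset.mem_of_mem_erase h1) hc h2 hac)
      (fun h0 => by
        rcases Finset.mem_insert.1 h0 with h1 | h1
        · exact absurd h.1 (by simp [← h1])
        rcases Finset.mem_insert.1 h1 with h1 | h1
        · exact h.2.2 (Finset.sdiff_eq_empty_iff_subset.1 h1.symm)
        · exact τ.empty_notMem_parts (Finset.mem_of_mem_erase h1))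
  else τ

section Split

variable {τ : Part m} {U : Finset (Fin (m + 1))}

theorem split_parts (h0 : 0 ∈ U) (h : U ⊂ base τ) :
    (split τ U).parts = insert U (insert (base τ \ U) (τ.parts.erase (base τ))) := by
  rw [split, dif_pos ⟨h0, h⟩]; rfl

theorem base_split (h0 : 0 ∈ U) (h : U ⊂ base τ) : base (split τ U) = U :=
  (eq_base (by simp [split_parts h0 h]) h0).symm

theorem split_le (h0 : 0 ∈ U) (h : U ⊂ base τ) : split τ U ≤ τ := by
  intro c hc
  rw [split_parts h0 h] at hc
  rcases Finset.mem_insert.1 hc with rfl | hc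
  · exact ⟨base τ, base_mem τ, h.1⟩
  rcases Finset.mem_insert.1 hc with rfl | hc
  · exact ⟨base τ, base_mem τ, Finset.sdiff_subset⟩
  · exact ⟨c, Finset.mem_of_mem_erase hc, le_rfl⟩

/-- Splitting yields the coarsest refinement of `τ` with a prescribed block of `0`: any other block
of `σ` inside `base τ` is disjoint from `base σ`. -/
theorem le_split {σ : Part m} (hs : σ ≤ τ) (h : base σ ⊂ base τ) : σ ≤ split τ (base σ) := by
  intro c hc
  rw [split_parts (zero_mem_base σ) h]
  obtain ⟨c', hc', hle⟩ := hs hc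
  by_cases hb : c' = base τ
  · by_cases hcb : c = base σ
    · exact ⟨base σ, by simp, hcb.le⟩
    · refine ⟨base τ \ base σ, by simp, Finset.subset_sdiff.2 ⟨hb ▸ hle, ?_⟩⟩
      exact σ.disjoint hc (base_mem σ) hcb
  · exact ⟨c', by simp [hb, hc'], hle⟩

end Split

/-- The elements of `Q` which are minimal among the partitions in `Q` with the same block of `0`. -/
def IsStep (Q : Finset (Part m)) (π : Part m) : Prop :=
  π ∈ Q ∧ ∀ σ ∈ Q, σ < π → base σ ≠ base π

/-- The partitions which are coarser than a partition in `G ∪ {⊥}` with the same block of `0`. -/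
noncomputable def upper (G : Finset (Part m)) : Finset (Part m) :=
  Finset.univ.filter fun π => ∃ σ ∈ insert ⊥ G, σ ≤ π ∧ base σ = base π

theorem mem_upper {G : Finset (Part m)} {π : Part m} :
    π ∈ upper G ↔ ∃ σ ∈ insert ⊥ G, σ ≤ π ∧ base σ = base π := by
  simp only [upper, Finset.mem_filter, Finset.mem_univ, true_and]

/-- Closing upwards among partitions with the same block of `0` does not change the minimal ones.
The closure serves as path instead of the set of steps because it is monotone in `G`, while steps
may disappear when `G` grows. -/
theorem isStep_upper {G : Finset (Part m)} {π : Part m} :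
    IsStep (upper G) π ↔ IsStep (insert ⊥ G) π := by
  constructor
  · rintro ⟨h1, h2⟩
    obtain ⟨σ, hσ, hle, hb⟩ := mem_upper.1 h1
    obtain rfl : σ = π := by
      by_contra hne
      exact h2 σ (mem_upper.2 ⟨σ, hσ, le_rfl, rfl⟩) (lt_of_le_of_ne hle hne) hb
    exact ⟨hσ, fun κ hκ => h2 κ (mem_upper.2 ⟨κ, hκ, le_rfl, rfl⟩)⟩
  · rintro ⟨h1, h2⟩
    refine ⟨mem_upper.2 ⟨π, h1, le_rfl, rfl⟩, fun σ hσ hlt hb => ?_⟩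
    obtain ⟨κ, hκ, hle, hb'⟩ := mem_upper.1 hσ
    exact h2 κ hκ (hle.trans_lt hlt) (hb'.trans hb)

/-- Two consecutive steps such that the finer one is not obtained from the coarser one by splitting
the block of `0`. -/
def IsGap (Q : Finset (Part m)) (p : Part m × Part m) : Prop :=
  IsStep Q p.1 ∧ IsStep Q p.2 ∧ p.1 < p.2 ∧ (∀ κ, IsStep Q κ → p.1 < κ → ¬ κ < p.2) ∧
    split p.2 (base p.1) ≠ p.1

/-- The partition obtained by splitting the coarser element of a gap. -/
noncomputable def gap (Q : Finset (Part m)) : Option (Part m) :=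
  if h : ∃ p, IsGap Q p then some (split h.choose.2 (base h.choose.1)) else none

theorem gap_eq_none {Q : Finset (Part m)} (h : gap Q = none) : ∀ p, ¬ IsGap Q p := by
  unfold gap at h
  split_ifs at h with h'
  exact not_exists.1 h'

/-- A chain of partitions which contains the coarsest partition but not the finest one. -/
def IsFamily (G : Finset (Part m)) : Prop :=
  (∀ π ∈ G, ∀ σ ∈ G, π ≤ σ ∨ σ ≤ π) ∧ ⊥ ∉ G ∧ (⊤ ∈ G ∨ m = 0)

/-- All that the matching needs about a pivot `ρ`. The essential point is comparability with `G`: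
members lying between the consecutive steps `σ` and `τ` have the block of `0` of `σ`, hence refine
the splitting of `τ`. -/
theorem gap_spec {G : Finset (Part m)} (hG : IsFamily G) {ρ : Part m}
    (h : gap (upper G) = some ρ) : ∃ σ τ, σ ∈ insert ⊥ G ∧ τ ∈ insert ⊥ G ∧ σ < ρ ∧ ρ < τ ∧
      base ρ = base σ ∧ ρ = split τ (base σ) ∧ base σ ⊂ base τ ∧ ∀ π ∈ G, π ≤ ρ ∨ ρ ≤ π := by
  unfold gap at h
  split_ifs at h with h'
  obtain ⟨h1, h2, h3, h4, h5⟩ := h'.choose_spec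
  obtain rfl := Option.some.inj h
  generalize h'.choose.1 = σ at *
  generalize h'.choose.2 = τ at *
  rw [isStep_upper] at h1 h2
  have hb : base σ ⊂ base τ := (base_mono h3.le).ssubset_of_ne (h2.2 σ h1.1 h3)
  have hbr := base_split (zero_mem_base σ) hb
  have hle := le_split h3.le hb
  have hchain : ∀ π ∈ insert ⊥ G, ∀ κ ∈ insert ⊥ G, π ≤ κ ∨ κ ≤ π := by
    intro π hπ κ hκ
    rcases Finset.mem_insert.1 hπ with rfl | hπ
    · exact Or.inl bot_le
    rcases Finset.mem_insert.1 hκ with rfl | hκ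
    · exact Or.inr bot_le
    exact hG.1 π hπ κ hκ
  refine ⟨σ, τ, h1.1, h2.1, lt_of_le_of_ne hle h5.symm,
    lt_of_le_of_ne (split_le (zero_mem_base σ) hb) fun e => ?_, hbr, rfl, hb, fun π hπ => ?_⟩
  · rw [e] at hbr
    exact hb.ne hbr.symm
  · have hπ' := Finset.mem_insert_of_mem (b := ⊥) hπ
    rcases hchain τ h2.1 π hπ' with h | h
    · exact Or.inr ((split_le (zero_mem_base σ) hb).trans h)
    rcases h.eq_or_lt with rfl | h
    · exact Or.inr (split_le (zero_mem_base σ) hb)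
    left
    rcases hchain π hπ' σ h1.1 with h6 | h6
    · exact h6.trans hle
    by_cases hbb : base π = base σ
    · rw [← hbb] at hb ⊢
      exact le_split h.le hb
    -- Otherwise the finest member with the same block of `0` as `π` would be a step strictly
    -- between `σ` and `τ`.
    exfalso
    obtain ⟨κ, hκ⟩ := ((insert ⊥ G).filter fun κ => κ ≤ π ∧ base κ = base π).exists_minimal
      ⟨π, by simp [hπ]⟩
    obtain ⟨hκ1, hκ2⟩ := hκ
    simp only [Finset.mem_filter] at hκ1 hκ2
    have hstep : IsStep (insert ⊥ G) κ := by
      refine ⟨hκ1.1, fun μ hμ hlt hbμ => ?_⟩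
      exact hlt.not_ge (hκ2 ⟨hμ, hlt.le.trans hκ1.2.1, hbμ.trans hκ1.2.2⟩ hlt.le)
    refine h4 κ (isStep_upper.2 hstep) ?_ (hκ1.2.1.trans_lt h)
    rcases hchain σ h1.1 κ hκ1.1 with h7 | h7
    · refine lt_of_le_of_ne h7 fun e => hbb ?_
      rw [e, hκ1.2.2]
    · exfalso
      have := base_mono h7
      rw [hκ1.2.2] at this
      exact hbb (this.antisymm (base_mono h6))

/-- The number of blocks is injective on a chain and takes values in `1, …, m`, the value `m + 1`
being excluded with the discrete partition. -/
theorem card_le_of_isFamily {G : Finset (Part m)} (hG : IsFamily G) : G.card ≤ m := by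
  have h1 : G.image (fun π => π.parts.card) ⊆ Finset.Icc 1 m := by
    intro k hk
    obtain ⟨π, hπ, rfl⟩ := Finset.mem_image.1 hk
    rw [Finset.mem_Icc]
    have hne : (⊥ : Part m) < π := bot_lt_iff_ne_bot.2 fun e => hG.2.1 (e ▸ hπ)
    have h2 := card_parts_lt hne
    rw [Finpartition.card_bot, Finset.card_univ, Fintype.card_fin] at h2
    exact ⟨Finset.card_pos.2 ⟨_, base_mem π⟩, by omega⟩
  have h2 : Set.InjOn (fun π : Part m => π.parts.card) G := by
    intro π hπ σ hσ h
    by_contra hne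
    rcases hG.1 π hπ σ hσ with hle | hle
    · exact (card_parts_lt (lt_of_le_of_ne hle hne)).ne h.symm
    · exact (card_parts_lt (lt_of_le_of_ne hle (Ne.symm hne))).ne h
  rw [← Finset.card_image_of_injOn h2]
  simpa using Finset.card_le_card h1

/-! ### Combs and the critical chains of partitions. -/

/-- All blocks are singletons, except possibly the block of `0`. -/
def IsComb (π : Part m) : Prop := ∀ c ∈ π.parts, 0 ∉ c → c.card = 1

theorem isComb_bot : IsComb (⊥ : Part m) := by
  intro c hc _
  obtain ⟨a, -, rfl⟩ := Finpartition.mem_bot_iff.1 hc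
  simp

/-- A comb is the finest partition with its block of `0`, hence is determined by that block. -/
theorem IsComb.le_of_base_eq {π σ : Part m} (h : IsComb π) (hb : base π = base σ) : π ≤ σ := by
  intro c hc
  by_cases h0 : 0 ∈ c
  · exact ⟨base σ, base_mem σ, (eq_base hc h0).le.trans hb.le⟩
  · obtain ⟨a, rfl⟩ := Finset.card_eq_one.1 (h c hc h0)
    obtain ⟨c', hc', ha⟩ := σ.exists_mem (Finset.mem_univ a)
    exact ⟨c', hc', Finset.singleton_subset_iff.2 ha⟩

theorem IsComb.ext {π σ : Part m} (h : IsComb π) (h' : IsComb σ) (hb : base π = base σ) : π = σ :=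
  (h.le_of_base_eq hb).antisymm (h'.le_of_base_eq hb.symm)

/-- Without gap, each step is the splitting of the next one. Starting from the discrete partition,
the next step over a comb merges a single entry into the block of `0`, so it is again a comb. -/
theorem exists_comb {G : Finset (Part m)} (hG : IsFamily G) (h : gap (upper G) = none) (k : ℕ)
    (hk : k ≤ m) : ∃ σ, IsStep (insert ⊥ G) σ ∧ IsComb σ ∧ (base σ).card = k + 1 := by
  have hchain : ∀ π ∈ insert ⊥ G, ∀ κ ∈ insert ⊥ G, π ≤ κ ∨ κ ≤ π := by
    intro π hπ κ hκ
    rcases Finset.mem_insert.1 hπ with rfl | hπ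
    · exact Or.inl bot_le
    rcases Finset.mem_insert.1 hκ with rfl | hκ
    · exact Or.inr bot_le
    exact hG.1 π hπ κ hκ
  induction k with
  | zero =>
    exact ⟨⊥, ⟨by simp, fun σ _ hlt => absurd hlt not_lt_bot⟩, isComb_bot, by simp [base_bot]⟩
  | succ k ih =>
    obtain ⟨σ, hσ, hcomb, hcard⟩ := ih (by omega)
    have htop : ⊤ ∈ G := hG.2.2.resolve_right (by omega)
    have hne : base σ ≠ Finset.univ := fun e => by
      rw [e, Finset.card_univ, Fintype.card_fin] at hcard
      omega
    -- The step `κ` only serves to show that some step lies above `σ`; `τ` below is the next one.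
    obtain ⟨κ, hκ1, hκ2⟩ := ((insert ⊥ G).filter fun κ => base κ = Finset.univ).exists_minimal
      ⟨⊤, by simp [htop, base_top]⟩
    simp only [Finset.mem_filter] at hκ1 hκ2
    have hκ : IsStep (insert ⊥ G) κ := ⟨hκ1.1, fun μ hμ hlt hb =>
      hlt.not_ge (hκ2 ⟨hμ, hb.trans hκ1.2⟩ hlt.le)⟩
    have hσκ : σ < κ := by
      rcases hchain σ hσ.1 κ hκ.1 with h1 | h1
      · exact lt_of_le_of_ne h1 fun e => hne (e ▸ hκ1.2)
      · have := base_mono h1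
        rw [hκ1.2] at this
        exact absurd (Finset.univ_subset_iff.1 this) hne
    obtain ⟨τ, hτ1, hτ2⟩ := (Finset.univ.filter fun τ =>
      IsStep (insert ⊥ G) τ ∧ σ < τ).exists_minimal ⟨κ, by simp [hκ, hσκ]⟩
    simp only [Finset.mem_filter, Finset.mem_univ, true_and] at hτ1 hτ2
    have hsplit : split τ (base σ) = σ := by
      by_contra hs
      refine gap_eq_none h (σ, τ) ⟨isStep_upper.2 hσ, isStep_upper.2 hτ1.1, hτ1.2, ?_, hs⟩
      intro μ hμ h1 h2
      exact h2.not_ge (hτ2 ⟨isStep_upper.1 hμ, h1⟩ h2.le)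
    have hb : base σ ⊂ base τ :=
      (base_mono hτ1.2.le).ssubset_of_ne (hτ1.1.2 σ hσ.1 hτ1.2)
    have hparts := split_parts (zero_mem_base σ) hb
    rw [hsplit] at hparts
    -- The difference is a block of the splitting, that is of the comb `σ`, and it avoids `0`.
    have hd : (base τ \ base σ).card = 1 :=
      hcomb _ (by rw [hparts]; simp) (by simp [zero_mem_base])
    refine ⟨τ, hτ1.1, fun c hc h0 => ?_, ?_⟩
    · refine hcomb c ?_ h0
      rw [hparts]
      have : c ≠ base τ := fun e => h0 (e ▸ zero_mem_base τ)
      simp [this, hc]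
    · have := Finset.card_sdiff_add_card_eq_card hb.1
      omega

/-- The combs supplied by `exists_comb` for the sizes `2, …, m + 1` already number `m`, so they fill
the chain. -/
theorem comb_of_gap_eq_none {G : Finset (Part m)} (hG : IsFamily G) (h : gap (upper G) = none) :
    G.card = m ∧ ∀ π ∈ G, IsComb π := by
  have h1 : Finset.Ioc 1 (m + 1) ⊆ (G.filter IsComb).image (fun π => (base π).card) := by
    intro k hk
    rw [Finset.mem_Ioc] at hk
    obtain ⟨σ, h1, h2, h3⟩ := exists_comb hG h (k - 1) (by omega)
    rcases Finset.mem_insert.1 h1.1 with rfl | h4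
    · rw [base_bot, Finset.card_singleton] at h3
      omega
    · exact Finset.mem_image.2 ⟨σ, Finset.mem_filter.2 ⟨h4, h2⟩, by omega⟩
  have h2 := (Finset.card_le_card h1).trans Finset.card_image_le
  simp only [Nat.card_Ioc, Nat.add_sub_cancel] at h2
  have h3 := card_le_of_isFamily hG
  have h4 := Finset.card_filter_le G IsComb
  refine ⟨by omega, fun π hπ => ?_⟩
  have h5 : G.filter IsComb = G :=
    Finset.eq_of_subset_of_card_le (Finset.filter_subset _ _) (by omega)
  rw [← h5] at hπ
  exact (Finset.mem_filter.1 hπ).2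

/-- The matching on the chains of partitions of `{0, …, m}`. -/
noncomputable def matching (m : ℕ) : CellMatching (Part m) (Part m) where
  cell := IsFamily
  free π := π ≠ ⊤
  -- Coarser partitions come first, so that the position of a partition in its chain is its level.
  lt w v := v < w
  cell_erase hF _ hv := ⟨fun w hw w' hw' =>
    hF.1 w (Finset.mem_of_mem_erase hw) w' (Finset.mem_of_mem_erase hw'),
    fun h => hF.2.1 (Finset.mem_of_mem_erase h),
    hF.2.2.imp_left fun h => Finset.mem_erase.2 ⟨hv.symm, h⟩⟩
  total {F v w} hF hv hw hne := ⟨fun h => h.asymm, fun h =>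
    lt_of_le_of_ne ((hF.1 w hw v hv).resolve_right fun h' => h (lt_of_le_of_ne h' hne)) hne.symm⟩
  path := upper
  pivot := gap
  top := m
  path_mono F G h := by
    intro π hπ
    obtain ⟨σ, hσ, h'⟩ := mem_upper.1 hπ
    exact mem_upper.2 ⟨σ, Finset.insert_subset_insert _ h hσ, h'⟩
  pivot_free hF h := by
    obtain ⟨σ, τ, -, -, -, h1, -⟩ := gap_spec hF h
    exact h1.ne_top
  cell_insert {inst F v} hF h := by
    obtain rfl : inst = fun a b => instDecidableEqFinpartition a b := Subsingleton.elim _ _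
    obtain ⟨σ, τ, -, -, h1, -, -, -, -, h2⟩ := gap_spec hF h
    refine ⟨?_, ?_, hF.2.2.imp_left (Finset.mem_insert_of_mem)⟩
    · intro w hw w' hw'
      rcases Finset.mem_insert.1 hw with h3 | h3
      · rcases Finset.mem_insert.1 hw' with h4 | h4
        · exact Or.inl (h3.trans h4.symm).le
        · exact h3 ▸ (h2 w' h4).symm
      · rcases Finset.mem_insert.1 hw' with h4 | h4
        · exact h4 ▸ h2 w h3
        · exact hF.1 w h3 w' h4
    · intro hb
      rcases Finset.mem_insert.1 hb with rfl | hb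
      · exact not_lt_bot h1
      · exact hF.2.1 hb
  -- The pivot lies above the step `σ` and has the same block of `0`, so everything it contributes
  -- to the closure is contributed by `σ`. The same remark handles its removal.
  path_insert {inst F v} hF h := by
    obtain rfl : inst = fun a b => instDecidableEqFinpartition a b := Subsingleton.elim _ _
    obtain ⟨σ, τ, hσ, -, h1, -, h2, -⟩ := gap_spec hF h
    ext π
    simp only [mem_upper]
    constructor
    · rintro ⟨κ, hκ, hle, hb⟩
      rcases Finset.mem_insert.1 hκ with rfl | hκ
      · exact ⟨⊥, by simp, hle, hb⟩
      rcases Finset.mem_insert.1 hκ with rfl | hκ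
      · exact ⟨σ, hσ, h1.le.trans hle, h2.symm.trans hb⟩
      · exact ⟨κ, Finset.mem_insert_of_mem hκ, hle, hb⟩
    · rintro ⟨κ, hκ, h'⟩
      exact ⟨κ, Finset.insert_subset_insert _ (Finset.subset_insert _ _) hκ, h'⟩
  path_erase {inst F v} hF h := by
    obtain rfl : inst = fun a b => instDecidableEqFinpartition a b := Subsingleton.elim _ _
    obtain ⟨σ, τ, hσ, -, h1, -, h2, -⟩ := gap_spec hF h
    have key : ∀ κ ∈ insert ⊥ F, κ ≠ v → κ ∈ insert ⊥ (F.erase v) := fun κ hκ hne => by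
      rcases Finset.mem_insert.1 hκ with rfl | hκ
      · simp
      · exact Finset.mem_insert_of_mem (Finset.mem_erase.2 ⟨hne, hκ⟩)
    ext π
    simp only [mem_upper]
    constructor
    · rintro ⟨κ, hκ, h'⟩
      exact ⟨κ, Finset.insert_subset_insert _ (Finset.erase_subset _ _) hκ, h'⟩
    · rintro ⟨κ, hκ, hle, hb⟩
      by_cases he : κ = v
      · subst he
        exact ⟨σ, key σ hσ h1.ne, h1.le.trans hle, h2.symm.trans hb⟩
      · exact ⟨κ, key κ hκ he, hle, hb⟩
  card_le := card_le_of_isFamily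
  card_critical hF h := (comb_of_gap_eq_none hF h).1

theorem matching_pivot : (matching m).pivot = gap := by simp only [matching]

theorem matching_path : (matching m).path = upper := by simp only [matching]

/-- For the converse, a pivot would already be in `G` by cardinality; it would then be a comb with
the same block of `0` as the strictly finer comb `σ`. -/
theorem critical_iff {G : Finset (Part m)} :
    (matching m).Critical G ↔ IsFamily G ∧ G.card = m ∧ ∀ π ∈ G, IsComb π := by
  constructor
  · rintro ⟨hG, h⟩
    have hG' : IsFamily G := hG
    rw [matching_pivot, matching_path] at h
    exact ⟨hG', comb_of_gap_eq_none hG' h⟩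
  · rintro ⟨hG, hc, hcomb⟩
    refine ⟨hG, ?_⟩
    by_contra hne
    obtain ⟨ρ, hρ⟩ := Option.ne_none_iff_exists'.1 hne
    have h1 : (insert ρ G).card ≤ m := card_le_of_isFamily ((matching m).cell_insert hG hρ)
    have h2 : ρ ∈ G := by
      by_contra h2
      rw [Finset.card_insert_of_notMem h2, hc] at h1
      exact absurd h1 (Nat.not_succ_le_self _)
    rw [matching_pivot, matching_path] at hρ
    obtain ⟨σ, τ, hσ, -, hlt, -, hb, -⟩ := gap_spec hG hρ
    have hσ' : IsComb σ := by
      rcases Finset.mem_insert.1 hσ with rfl | hσ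
      · exact isComb_bot
      · exact hcomb σ hσ
    exact hlt.ne (hσ'.ext (hcomb ρ h2) hb.symm)

end Partitions

/-! ## Values of the operations of the commutative operad -/

namespace SymmOperad

variable {K : Type u} [CommRing K]

/-- The scalar which corresponds to an operation of the commutative operad. -/
noncomputable def comVal (I : Type) [Finite I] : (commutative K).obj I →ₗ[K] K :=
  (comObj K I).subtype

theorem comVal_injective (I : Type) [Finite I] : Function.Injective (comVal (K := K) I) :=
  Subtype.val_injective

/-- The generating operation of the commutative operad. -/
noncomputable def comOne (K : Type u) [CommRing K] (I : Type) [Finite I] [h : Nonempty I] :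
    (commutative K).obj I :=
  (⟨1, fun h' => (h'.false h.some).elim⟩ : comObj K I)

@[simp]
theorem comVal_comOne (I : Type) [Finite I] [Nonempty I] : comVal I (comOne K I) = 1 := rfl

theorem comVal_transport {X : Type} {I J : Finset X} (h : I = J) (p : (commutative K).obj I) :
    comVal J ((commutative K).transport h p) = comVal I p := rfl

theorem comVal_subst {n : ℕ} {I' I : Finset (Finset (Fin n))} (h : Refines I' I)
    (p : (commutative K).obj I)
    (q : ∀ c : I, (commutative K).obj ↥(I'.filter (· ⊆ c.1))) :
    comVal _ ((commutative K).subst h p q) = comVal _ p * ∏ c, comVal _ (q c) :=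
  comComp_coe (K := K) _ _ _

/-- Since bijections act trivially, the bijection chosen in `unitAt` does not matter. -/
theorem comVal_unitAt {I : Type} [Finite I] (h : Nat.card I = 1) :
    comVal I ((commutative K).unitAt I) = 1 := by
  have : Nonempty (Unit ≃ I) := by
    obtain ⟨e⟩ := Finite.card_eq.1 (show Nat.card Unit = Nat.card I by rw [h]; simp)
    exact ⟨e⟩
  rw [unitAt, dif_pos this]
  rfl

theorem comVal_aug {I : Type} [Finite I] (h : Nat.card I = 1) (p : (commutative K).obj I) :
    (commutative K).aug I p = comVal I p := by
  have key : ∀ c : K, comVal I (c • (commutative K).unitAt I) = c := fun c => by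
    rw [map_smul, comVal_unitAt h, smul_eq_mul, mul_one]
  have hb : Function.Bijective
      (LinearMap.toSpanSingleton K ((commutative K).obj I) ((commutative K).unitAt I)) := by
    refine ⟨fun a b hab => ?_, fun p => ⟨comVal I p, comVal_injective I (key _)⟩⟩
    rw [← key a, ← key b]
    exact congrArg _ hab
  rw [aug, dif_pos ⟨h, hb⟩]
  change (LinearEquiv.ofBijective _ hb).symm p = _
  rw [LinearEquiv.symm_apply_eq]
  exact comVal_injective I (key _).symm

theorem natCard_filter_subset {n : ℕ} {I : Finset (Finset (Fin n))} {c : Finset (Fin n)}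
    (h : ∀ j ∈ I, j ⊆ c ↔ j = c) (hc : c ∈ I) : Nat.card ↥(I.filter (· ⊆ c)) = 1 := by
  rw [Finset.filter_congr h, Finset.filter_eq', if_pos hc]
  simp

section Tensor

variable {ι : Type} [Fintype ι] (I : ι → Type) [∀ v, Finite (I v)]

/-- The product of the values of the labels. -/
noncomputable def tensorVal : (⨂[K] v, (commutative K).obj (I v)) →ₗ[K] K :=
  PiTensorProduct.lift ((MultilinearMap.mkPiAlgebra K ι K).compLinearMap fun v => comVal (I v))

@[simp]
theorem tensorVal_tprod (x : ∀ v, (commutative K).obj (I v)) :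
    tensorVal I (PiTensorProduct.tprod K x) = ∏ v, comVal (I v) (x v) := by
  simp [tensorVal]

/-- The tensor product of the generating operations. -/
noncomputable def tensorOne (K : Type u) [CommRing K] [∀ v, Nonempty (I v)] :
    ⨂[K] v, (commutative K).obj (I v) :=
  PiTensorProduct.tprod K fun v => comOne K (I v)

variable [∀ v, Nonempty (I v)]

theorem tensorVal_one : tensorVal I (tensorOne I K) = 1 := by
  simp [tensorOne]

/-- Treewise tensors are free of rank one: each label is its value times the monomial, and the
values gather in front of the tensor product. -/
theorem tensorVal_smul_one (t : ⨂[K] v, (commutative K).obj (I v)) :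
    tensorVal I t • tensorOne I K = t := by
  classical
  induction t using PiTensorProduct.induction_on with
  | smul_tprod r x =>
    rw [map_smul, tensorVal_tprod, smul_assoc, tensorOne, ← MultilinearMap.map_smul_univ]
    congr 2
    funext v
    apply comVal_injective
    rw [map_smul, comVal_comOne, smul_eq_mul, mul_one]
  | add x y hx hy => rw [map_add, add_smul, hx, hy]

theorem tensorVal_injective :
    Function.Injective (tensorVal (K := K) I) := fun s t h => by
  rw [← tensorVal_smul_one I s, ← tensorVal_smul_one I t, h]

end Tensor

/-! ## The bar construction of the commutative operad -/

namespace RTree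

open Classical

variable {n d : ℕ}

instance (T : RTree n d) (v : T.verts) : Nonempty ↥(T.inputs v) := by
  have := T.two_le_card_inputs (T.two_le v v.2)
  exact (Finset.card_pos.1 (by omega)).to_subtype

/-- Composites of monomials are monomials, so an edge contraction sends basis trees to basis trees
with coefficient `1`. -/
theorem contractMap_one (T : RTree n (d + 1)) (v : Finset (Fin n)) (hv : v ∈ T.verts)
    (hr : v ≠ Finset.univ) :
    T.contractMap (commutative K) v hv hr (tensorOne (fun v : T.verts => ↥(T.inputs v)) K) =
      tensorOne (fun w : (T.contract v hv hr).verts => ↥((T.contract v hv hr).inputs w)) K := by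
  apply tensorVal_injective
  rw [tensorVal_one]
  unfold contractMap tensorOne
  rw [PiTensorProduct.lift.tprod]
  change tensorVal _ (PiTensorProduct.tprod K _) = 1
  rw [tensorVal_tprod]
  refine Finset.prod_eq_one fun w _ => ?_
  unfold contractLabel
  rw [comVal_subst, comVal_comOne, one_mul]
  refine Finset.prod_eq_one fun c _ => ?_
  split_ifs with h
  · rw [comVal_transport, comVal_comOne]
  -- An ingoing edge other than `v` survives the contraction unchanged, so it is the only new edge
  -- below itself and its unit label has value `1`.
  · refine comVal_unitAt (natCard_filter_subset ?_ ?_)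
    · intro j hj
      refine ⟨fun hjc => ?_, fun e => e.le⟩
      by_contra hne
      obtain ⟨h1, h2, h3⟩ := mem_inputs.1 hj
      obtain ⟨c1, c2, c3⟩ := mem_inputs.1 c.2
      have hjc := hjc.ssubset_of_ne hne
      rcases c2 with c2 | c2
      · exact h3 c (Finset.mem_erase.2 ⟨h, c2⟩) hjc c1
      · have := Finset.card_lt_card hjc
        have := Finset.card_pos.2 (nonempty_of h2)
        omega
    · obtain ⟨c1, c2, c3⟩ := mem_inputs.1 c.2
      exact mem_inputs.2 ⟨c1, c2.imp_left fun h' => Finset.mem_erase.2 ⟨h, h'⟩,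
        fun w hw => c3 w (Finset.mem_of_mem_erase hw)⟩

end RTree

section Bar

open Classical

variable (K) in
/-- The comparison of the bar construction with the free module on the families of subsets. -/
noncomputable def barChain (n d : ℕ) :
    Bar (commutative K) n d →ₗ[K] (Finset (Finset (Fin n)) →₀ K) :=
  DirectSum.toModule K _ _ fun T =>
    Finsupp.lsingle T.verts ∘ₗ tensorVal (fun v : T.verts => ↥(T.inputs v))

variable (K) in
/-- The basis element of the bar construction given by a tree. -/
noncomputable def barBasis {n d : ℕ} (T : RTree n d) : Bar (commutative K) n d :=
  DirectSum.lof K (RTree n d) (fun T => T.Tensor (commutative K)) T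
    (tensorOne (fun v : T.verts => ↥(T.inputs v)) K)

theorem barChain_lof {n d : ℕ} (T : RTree n d) (t : T.Tensor (commutative K)) :
    barChain K n d (DirectSum.lof K (RTree n d) (fun T => T.Tensor (commutative K)) T t) =
      Finsupp.single T.verts (tensorVal (fun v : T.verts => ↥(T.inputs v)) t) := by
  simp [barChain, DirectSum.toModule_lof]

@[simp]
theorem barChain_basis {n d : ℕ} (T : RTree n d) :
    barChain K n d (barBasis K T) = Finsupp.single T.verts 1 := by
  rw [barBasis, barChain_lof, tensorVal_one]

theorem lof_eq_smul_basis {n d : ℕ} (T : RTree n d) (t : T.Tensor (commutative K)) :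
    DirectSum.lof K (RTree n d) (fun T => T.Tensor (commutative K)) T t =
      tensorVal (fun v : T.verts => ↥(T.inputs v)) t • barBasis K T := by
  rw [barBasis, ← map_smul, tensorVal_smul_one]

/-- A linear property of the elements of the bar construction can be checked on the trees. -/
theorem bar_induction {n d : ℕ} {motive : Bar (commutative K) n d → Prop}
    (x : Bar (commutative K) n d) (zero : motive 0)
    (smul : ∀ (c : K) (T : RTree n d), motive (c • barBasis K T))
    (add : ∀ x y, motive x → motive y → motive (x + y)) : motive x := by
  induction x using DirectSum.induction_on with
  | zero => exact zero
  | of T t =>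
    have := lof_eq_smul_basis T t
    rw [DirectSum.lof_eq_of] at this
    rw [this]
    exact smul _ _
  | add x y hx hy => exact add x y hx hy

theorem bar_hom_ext {n d : ℕ} {M : Type u} [AddCommGroup M] [Module K M]
    {f g : Bar (commutative K) n d →ₗ[K] M} (h : ∀ T, f (barBasis K T) = g (barBasis K T)) :
    f = g := by
  refine LinearMap.ext fun x => ?_
  induction x using bar_induction with
  | zero => simp
  | smul c T => rw [map_smul, map_smul, h]
  | add x y hx hy => rw [map_add, map_add, hx, hy]

theorem barD_basis {n d : ℕ} (T : RTree n (d + 1)) :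
    barD (commutative K) n d (barBasis K T) = ∑ v : T.verts,
      if hr : v.1 ≠ Finset.univ then
        (-1 : K) ^ T.position v.1 • barBasis K (T.contract v.1 v.2 hr) else 0 := by
  unfold barD barBasis
  rw [DirectSum.toModule_lof, LinearMap.sum_apply]
  refine Finset.sum_congr rfl fun v _ => ?_
  split_ifs with hr
  · rw [LinearMap.smul_apply, LinearMap.comp_apply, RTree.contractMap_one]
  · rfl

theorem verts_injective {n d : ℕ} : Function.Injective (RTree.verts : RTree n d → _) :=
  fun _ _ h => RTree.ext h

/-- Distinct trees have distinct vertex families, so coefficients recover the components; this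
yields injectivity. -/
theorem barChain_apply {n d : ℕ} (x : Bar (commutative K) n d) (T : RTree n d) :
    barChain K n d x T.verts = tensorVal (fun v : T.verts => ↥(T.inputs v)) (x T) := by
  induction x using bar_induction with
  | zero => simp
  | smul c S =>
    rw [map_smul, barChain_basis, barBasis, ← map_smul]
    by_cases h : S = T
    · subst h
      rw [DirectSum.lof_apply, map_smul, tensorVal_one]
      simp
    · rw [DirectSum.lof_eq_of, DirectSum.of_eq_of_ne _ _ _ (Ne.symm h), map_zero]
      have : S.verts ≠ T.verts := fun e => h (RTree.ext e)
      simp [this]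
  | add x y hx hy => rw [map_add, Finsupp.add_apply, hx, hy, DirectSum.add_apply, map_add]

theorem barChain_injective (n d : ℕ) : Function.Injective (barChain K n d) := by
  intro x y h
  refine DFinsupp.ext fun T => ?_
  apply tensorVal_injective
  rw [← barChain_apply, ← barChain_apply, h]

theorem barChain_mem {m d : ℕ} (x : Bar (commutative K) (m + 1) d) :
    barChain K (m + 1) d x ∈ (RTree.matching m).chains K d := by
  induction x using bar_induction with
  | zero => simp
  | smul c T =>
    rw [map_smul, barChain_basis]
    exact Submodule.smul_mem _ _ (Finsupp.single_mem_supported K _ ⟨T.isFamily, T.card_verts⟩)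
  | add x y hx hy => rw [map_add]; exact add_mem hx hy

theorem exists_barChain_eq {m d : ℕ} {y : Finset (Finset (Fin (m + 1))) →₀ K}
    (hy : y ∈ (RTree.matching m).chains K d) : ∃ x, barChain K (m + 1) d x = y := by
  rw [← LinearMap.mem_range]
  unfold CellFamily.chains at hy
  rw [Finsupp.supported_eq_span_single] at hy
  refine Submodule.span_le.2 ?_ hy
  rintro _ ⟨F, ⟨hF, hd⟩, rfl⟩
  exact ⟨barBasis K (RTree.ofFamily hF hd), barChain_basis _⟩

/-- Contracting the edge issued from `v` erases `v` from the family, the root is the vertex which is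
not free, and both signs count the vertices preceding `v` in the colexicographic order. -/
theorem bdry_barChain {m d : ℕ} (x : Bar (commutative K) (m + 1) (d + 1)) :
    (RTree.matching m).bdry K (barChain K (m + 1) (d + 1) x) =
      barChain K (m + 1) d (barD (commutative K) (m + 1) d x) := by
  refine LinearMap.congr_fun (f := (RTree.matching m).bdry K ∘ₗ barChain K (m + 1) (d + 1))
    (g := barChain K (m + 1) d ∘ₗ barD (commutative K) (m + 1) d) (bar_hom_ext fun T => ?_) x
  rw [LinearMap.comp_apply, LinearMap.comp_apply, barChain_basis, CellFamily.bdry_single, one_smul,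
    barD_basis, map_sum, CellFamily.faceSum, Finset.sum_filter,
    ← Finset.sum_coe_sort T.verts]
  refine Finset.sum_congr rfl fun v _ => ?_
  by_cases hr : v.1 ≠ Finset.univ
  · rw [if_pos (show (RTree.matching m).free v.1 from hr), dif_pos hr, map_smul,
      barChain_basis, Finsupp.smul_single, smul_eq_mul, mul_one]
    have h2 : (RTree.matching m).pos T.verts v.1 = T.position v.1 := by
      unfold CellFamily.pos RTree.position
      exact congrArg Finset.card (Finset.filter_congr fun _ _ => Iff.rfl)
    rw [h2]
    congr 1
    ext
    simp [RTree.contract]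
  · rw [if_neg (show ¬ (RTree.matching m).free v.1 from hr), dif_neg hr, map_zero]

end Bar

end SymmOperad

/-! ## The normalized bar construction of the commutative operad -/

namespace Partitions

open Classical

variable {m : ℕ} (K : Type u) [CommRing K]

/-- The increasing map `ℕ → ℕ` which avoids `k`. -/
def avoid (k l : ℕ) : ℕ := if l < k then l else l + 1

/-- The conditions under which a sequence of partitions gives a non-degenerate tree with `d`
levels. -/
def IsStrict (p : ℕ → Part m) (d : ℕ) : Prop :=
  p 0 = ⊤ ∧ p d = ⊥ ∧ ∀ i < d, p (i + 1) < p i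

/-- The chain of partitions associated to a tree with levels, or `0` if the tree is degenerate. -/
noncomputable def levelChain (p : ℕ → Part m) (d : ℕ) : Finset (Part m) →₀ K :=
  if IsStrict p d then Finsupp.single ((Finset.range d).image p) 1 else 0

variable {K}

theorem levelChain_congr {p q : ℕ → Part m} {d : ℕ} (h : ∀ l ≤ d, p l = q l) :
    levelChain K p d = levelChain K q d := by
  have h1 : IsStrict p d ↔ IsStrict q d := by
    unfold IsStrict
    rw [h 0 (Nat.zero_le d), h d le_rfl]
    refine and_congr_right fun _ => and_congr_right fun _ => forall₂_congr fun i hi => ?_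
    rw [h i hi.le, h (i + 1) hi]
  have h2 : (Finset.range d).image p = (Finset.range d).image q :=
    Finset.image_congr fun l hl => h l (Finset.mem_range.1 hl).le
  unfold levelChain
  rw [h2]
  exact if_congr h1 rfl rfl

theorem IsStrict.lt {p : ℕ → Part m} {d : ℕ} (h : IsStrict p d) {i j : ℕ} (hij : i < j)
    (hj : j ≤ d) : p j < p i := by
  induction j, hij using Nat.le_induction with
  | base => exact h.2.2 i hj
  | succ j hij ih => exact (h.2.2 j hj).trans (ih (by omega))

theorem IsStrict.injOn {p : ℕ → Part m} {d : ℕ} (h : IsStrict p d) :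
    Set.InjOn p (Finset.range (d + 1)) := by
  intro i hi j hj hij
  simp only [Finset.coe_range, Set.mem_Iio] at hi hj
  rcases lt_trichotomy i j with h1 | h1 | h1
  · exact absurd hij (h.lt h1 (by omega)).ne'
  · exact h1
  · exact absurd hij (h.lt h1 (by omega)).ne

theorem IsStrict.isFamily {p : ℕ → Part m} {d : ℕ} (h : IsStrict p d) :
    IsFamily ((Finset.range d).image p) := by
  refine ⟨fun π hπ σ hσ => ?_, fun hb => ?_, ?_⟩
  · obtain ⟨i, hi, rfl⟩ := Finset.mem_image.1 hπ
    obtain ⟨j, hj, rfl⟩ := Finset.mem_image.1 hσ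
    rw [Finset.mem_range] at hi hj
    rcases lt_trichotomy i j with h1 | rfl | h1
    · exact Or.inr (h.lt h1 hj.le).le
    · exact Or.inl le_rfl
    · exact Or.inl (h.lt h1 hi.le).le
  · obtain ⟨i, hi, hi'⟩ := Finset.mem_image.1 hb
    rw [Finset.mem_range] at hi
    have := h.lt hi le_rfl
    rw [hi'] at this
    exact not_lt_bot this
  · rcases Nat.eq_zero_or_pos d with rfl | hd
    · right
      have h1 : (⊥ : Part m) = ⊤ := h.2.1.symm.trans h.1
      have h2 := congrArg (fun π => (base π).card) h1
      simp only [base_bot, base_top, Finset.card_singleton, Finset.card_univ, Fintype.card_fin]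
        at h2
      omega
    · exact Or.inl (Finset.mem_image.2 ⟨0, Finset.mem_range.2 hd, h.1⟩)

theorem IsStrict.card_image {p : ℕ → Part m} {d : ℕ} (h : IsStrict p d) :
    ((Finset.range d).image p).card = d := by
  rw [Finset.card_image_of_injOn, Finset.card_range]
  exact h.injOn.mono (by simp)

theorem IsStrict.pos_eq {p : ℕ → Part m} {d : ℕ} (h : IsStrict p d) {k : ℕ} (hk : k < d) :
    (matching m).pos ((Finset.range d).image p) (p k) = k := by
  have : ((Finset.range d).image p).filter (fun w => (matching m).lt w (p k)) =
      (Finset.range k).image p := by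
    ext π
    simp only [Finset.mem_filter, Finset.mem_image, Finset.mem_range]
    constructor
    · rintro ⟨⟨i, hi, rfl⟩, h1⟩
      have h1 : p k < p i := h1
      refine ⟨i, ?_, rfl⟩
      by_contra hle
      rcases (not_lt.1 hle).eq_or_lt with rfl | h2
      · exact h1.false
      · exact (h.lt h2 hi.le).asymm h1
    · rintro ⟨i, hi, rfl⟩
      exact ⟨⟨i, by omega, rfl⟩, (h.lt hi (by omega) : p k < p i)⟩
  unfold CellFamily.pos
  rw [this, Finset.card_image_of_injOn (h.injOn.mono ?_), Finset.card_range]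
  intro i hi
  simp only [Finset.coe_range, Set.mem_Iio] at hi ⊢
  omega

/-- The level of a partition is recovered as its position in the chain. -/
theorem IsStrict.eq_of_image_eq {p q : ℕ → Part m} {d : ℕ} (hp : IsStrict p d)
    (hq : IsStrict q d) (h : (Finset.range d).image p = (Finset.range d).image q) {i : ℕ}
    (hi : i < d) : p i = q i := by
  obtain ⟨j, hj, hji⟩ := Finset.mem_image.1 (h ▸ Finset.mem_image_of_mem p (Finset.mem_range.2 hi))
  have h1 := hp.pos_eq hi
  rw [h, ← hji, hq.pos_eq (Finset.mem_range.1 hj)] at h1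
  rw [← hji, h1]

/-- A chain of partitions is the chain of a sequence of partitions. -/
theorem IsFamily.exists_isStrict {G : Finset (Part m)} (hG : IsFamily G) {d : ℕ}
    (hd : G.card = d) : ∃ p : ℕ → Part m, Antitone p ∧ (∀ i, d ≤ i → p i = ⊥) ∧ IsStrict p d ∧
      (Finset.range d).image p = G := by
  -- The level of a member is the number of strictly coarser members.
  let r : Part m → ℕ := fun π => (G.filter (π < ·)).card
  have hr : ∀ π ∈ G, ∀ σ ∈ G, π < σ → r σ < r π := fun π _ σ hσ h =>
    Finset.card_lt_card ((Finset.monotone_filter_right G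
      fun κ _ hκ => h.trans hκ).ssubset_of_ne fun e => by
      have : σ ∈ G.filter (σ < ·) := e ▸ Finset.mem_filter.2 ⟨hσ, h⟩
      exact (Finset.mem_filter.1 this).2.false)
  have hlt : ∀ π ∈ G, ∀ σ ∈ G, r π < r σ → σ < π := by
    intro π hπ σ hσ h
    rcases hG.1 σ hσ π hπ with h1 | h1
    · exact lt_of_le_of_ne h1 fun e => h.ne (e ▸ rfl)
    · rcases h1.eq_or_lt with rfl | h1
      · exact absurd h (lt_irrefl _)
      · exact absurd h (hr π hπ σ hσ h1).asymm
  have hinj : Set.InjOn r G := by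
    intro π hπ σ hσ h
    by_contra hne
    rcases hG.1 π hπ σ hσ with h1 | h1
    · exact (hr π hπ σ hσ (lt_of_le_of_ne h1 hne)).ne h.symm
    · exact (hr σ hσ π hπ (lt_of_le_of_ne h1 (Ne.symm hne))).ne h
  have hrd : ∀ π ∈ G, r π < d := fun π hπ => by
    rw [← hd]
    refine Finset.card_lt_card ((Finset.filter_subset _ _).ssubset_of_ne fun e => ?_)
    rw [← e] at hπ
    exact (Finset.mem_filter.1 hπ).2.false
  have himg : G.image r = Finset.range d := by
    refine Finset.eq_of_subset_of_card_le (fun i hi => ?_) ?_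
    · obtain ⟨π, hπ, rfl⟩ := Finset.mem_image.1 hi
      exact Finset.mem_range.2 (hrd π hπ)
    · rw [Finset.card_range, Finset.card_image_of_injOn hinj, hd]
  have hex : ∀ i < d, ∃ π ∈ G, r π = i := fun i hi =>
    Finset.mem_image.1 (himg ▸ Finset.mem_range.2 hi)
  choose f hfG hfr using hex
  let p : ℕ → Part m := fun i => if h : i < d then f i h else ⊥
  have hp : ∀ i (h : i < d), p i = f i h := fun i h => dif_pos h
  have hp' : ∀ i, d ≤ i → p i = ⊥ := fun i h => dif_neg (not_lt.2 h)
  have hstrict : ∀ i j, i < j → i < d → p j < p i := by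
    intro i j hij hi
    rw [hp i hi]
    by_cases hj : j < d
    · rw [hp j hj]
      exact hlt _ (hfG i hi) _ (hfG j hj) (by rwa [hfr, hfr])
    · rw [hp' j (not_lt.1 hj), bot_lt_iff_ne_bot]
      exact fun e => hG.2.1 (e ▸ hfG i hi)
  have hself : ∀ π ∈ G, p (r π) = π := fun π hπ => by
    rw [hp _ (hrd π hπ)]
    exact hinj (hfG _ _) hπ (hfr _ _)
  refine ⟨p, fun i j hij => ?_, hp', ⟨?_, hp' d le_rfl, fun i hi => hstrict i _ i.lt_succ_self hi⟩,
    ?_⟩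
  · rcases hij.eq_or_lt with rfl | hij
    · exact le_rfl
    by_cases hi : i < d
    · exact (hstrict i j hij hi).le
    · rw [hp' j (by omega)]
      exact bot_le
  · rcases hG.2.2 with h | h
    · have := hself ⊤ h
      have h0 : r ⊤ = 0 := by
        refine Finset.card_eq_zero.2 (Finset.filter_eq_empty_iff.2 fun π _ => not_top_lt)
      rwa [h0] at this
    · subst h
      exact eq_top_of_base (Finset.eq_univ_of_forall fun a => Subsingleton.elim (α := Fin 1) 0 a ▸
        zero_mem_base (p 0))
  · ext π
    rw [Finset.mem_image]
    constructor
    · rintro ⟨i, hi, rfl⟩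
      rw [hp i (Finset.mem_range.1 hi)]
      exact hfG _ _
    · intro hπ
      exact ⟨r π, Finset.mem_range.2 (hrd π hπ), hself π hπ⟩

theorem levelChain_mem (p : ℕ → Part m) (d : ℕ) :
    levelChain K p d ∈ (matching m).chains K d := by
  unfold levelChain
  split_ifs with h
  · exact Finsupp.single_mem_supported K _ ⟨h.isFamily, h.card_image⟩
  · exact Submodule.zero_mem _

/-- The two outer faces vanish, since they no longer start at the coarsest or end at the finest
partition. The inner faces remove one free partition, whose position is its level. -/
theorem bdry_levelChain_of_strict {p : ℕ → Part m} {d : ℕ} (h : IsStrict p (d + 1)) :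
    (matching m).bdry K (levelChain K p (d + 1)) =
      ∑ k ∈ Finset.range (d + 2), (-1 : K) ^ k • levelChain K (fun l => p (avoid k l)) d := by
  have hinj : Set.InjOn p (Finset.range (d + 1)) := h.injOn.mono (by simp)
  have hlast : levelChain K (fun l => p (avoid (d + 1) l)) d = 0 := by
    refine if_neg fun h' => ?_
    have h1 : p (avoid (d + 1) d) = ⊥ := h'.2.1
    rw [avoid, if_pos (Nat.lt_succ_self d)] at h1
    have := h.2.2 d (Nat.lt_succ_self d)
    rw [h1] at this
    exact not_lt_bot this
  rw [levelChain, if_pos h, CellFamily.bdry_single, one_smul, CellFamily.faceSum,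
    Finset.sum_filter, Finset.sum_image hinj, Finset.sum_range_succ _ (d + 1), hlast,
    smul_zero, add_zero]
  refine Finset.sum_congr rfl fun k hk => ?_
  rw [Finset.mem_range] at hk
  rcases Nat.eq_zero_or_pos k with rfl | hk0
  · rw [if_neg (show ¬ (matching m).free (p 0) from fun h' => h' h.1)]
    have : levelChain K (fun l => p (avoid 0 l)) d = 0 := by
      refine if_neg fun h' => ?_
      have h1 : p (avoid 0 0) = ⊤ := h'.1
      rw [avoid, if_neg (lt_irrefl 0)] at h1
      have := h.2.2 0 (by omega)
      rw [h1] at this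
      exact not_top_lt this
    rw [this, smul_zero]
  · have hfree : p k ≠ ⊤ := (lt_of_lt_of_le (h.lt hk0 (by omega)) le_top).ne
    have hpos := h.pos_eq hk
    have hs : IsStrict (fun l => p (avoid k l)) d := by
      refine ⟨?_, ?_, fun i hi => ?_⟩
      · simp only [avoid, if_pos hk0]; exact h.1
      · simp only [avoid, if_neg (show ¬ d < k by omega)]; exact h.2.1
      · refine h.lt ?_ ?_ <;> simp only [avoid] <;> split_ifs <;> omega
    have himg : ((Finset.range (d + 1)).image p).erase (p k) =
        (Finset.range d).image fun l => p (avoid k l) := by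
      ext π
      simp only [Finset.mem_erase, Finset.mem_image, Finset.mem_range]
      constructor
      · rintro ⟨hne, i, hi, rfl⟩
        have hik : i ≠ k := fun e => hne (e ▸ rfl)
        by_cases hlt : i < k
        · exact ⟨i, by omega, by rw [avoid, if_pos hlt]⟩
        · refine ⟨i - 1, by omega, ?_⟩
          rw [avoid, if_neg (by omega)]
          congr 1; omega
      · rintro ⟨i, hi, rfl⟩
        have h1 : avoid k i < d + 1 := by unfold avoid; split_ifs <;> omega
        refine ⟨fun e => ?_, avoid k i, h1, rfl⟩
        have := hinj (by simpa using h1) (by simpa using hk) e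
        unfold avoid at this
        split_ifs at this <;> omega
    rw [if_pos (show (matching m).free (p k) from hfree), hpos, levelChain, if_pos hs,
      Finsupp.smul_single, smul_eq_mul, mul_one, ← himg]
    congr 1
    ext
    simp

/-- If levels `i` and `i + 1` carry the same partition, the faces `i` and `i + 1` coincide and have
opposite signs, and all other faces keep the repetition. -/
theorem bdry_levelChain_of_not_strict {p : ℕ → Part m} (hp : Antitone p) {d : ℕ} (h0 : p 0 = ⊤)
    (hd : p (d + 1) = ⊥) (h : ¬ IsStrict p (d + 1)) :
    (matching m).bdry K (levelChain K p (d + 1)) =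
      ∑ k ∈ Finset.range (d + 2), (-1 : K) ^ k • levelChain K (fun l => p (avoid k l)) d := by
  obtain ⟨i, hi, he⟩ : ∃ i < d + 1, p (i + 1) = p i := by
    by_contra! hne
    exact h ⟨h0, hd, fun i hi => lt_of_le_of_ne (hp (Nat.le_succ i)) (hne i hi)⟩
  rw [levelChain, if_neg h, map_zero, Finset.sum_eq_add_of_mem i (i + 1)
    (by simp; omega) (by simp; omega) (by omega)]
  · have : levelChain K (fun l => p (avoid i l)) d =
        levelChain K (fun l => p (avoid (i + 1) l)) d := by
      congr 1
      funext l
      rcases lt_trichotomy l i with h1 | rfl | h1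
      · rw [avoid, avoid, if_pos h1, if_pos (by omega)]
      · rw [avoid, avoid, if_neg (by omega), if_pos (by omega), he]
      · rw [avoid, avoid, if_neg (by omega), if_neg (by omega)]
    rw [this, pow_succ, mul_neg_one, neg_smul, add_neg_cancel]
  · intro k hk hne
    rw [Finset.mem_range] at hk
    rw [levelChain, if_neg, smul_zero]
    intro hs
    by_cases hlt : i < k
    · have := hs.2.2 i (by omega)
      simp only [avoid, if_pos hlt, if_pos (show i + 1 < k by omega), he] at this
      exact this.false
    · have := hs.2.2 (i - 1) (by omega)
      simp only [avoid, if_neg (show ¬ i - 1 < k by omega),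
        show i - 1 + 1 = i by omega, if_neg hlt, he] at this
      exact this.false

theorem bdry_levelChain {p : ℕ → Part m} (hp : Antitone p) {d : ℕ} (h0 : p 0 = ⊤)
    (hd : p (d + 1) = ⊥) :
    (matching m).bdry K (levelChain K p (d + 1)) =
      ∑ k ∈ Finset.range (d + 2), (-1 : K) ^ k • levelChain K (fun l => p (avoid k l)) d := by
  by_cases h : IsStrict p (d + 1)
  · exact bdry_levelChain_of_strict h
  · exact bdry_levelChain_of_not_strict hp h0 hd h

end Partitions

/-! ### Trees with levels as a basis, their faces, and the degenerate part. -/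

namespace SymmOperad

open Classical Partitions

variable {K : Type u} [CommRing K]

namespace LevelTree

variable {n d : ℕ}

instance (τ : LevelTree n d) (v : τ.Vertex) : Nonempty ↥(τ.inputs v.1 v.2) := by
  obtain ⟨c, hc, hle⟩ := Finpartition.exists_le_of_le (τ.anti (Nat.le_succ v.1)) v.2.2
  exact ⟨⟨c, Finset.mem_filter.2 ⟨hc, hle⟩⟩⟩

theorem natCard_filter_parts {n : ℕ} {π : Finpartition (Finset.univ : Finset (Fin n))}
    {b : Finset (Fin n)} (hb : b ∈ π.parts) : Nat.card ↥(π.parts.filter (· ⊆ b)) = 1 := by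
  refine natCard_filter_subset (fun j hj => ⟨fun h => ?_, fun h => h.le⟩) hb
  obtain ⟨a, ha⟩ := π.nonempty_of_mem_parts hj
  exact π.eq_of_mem_parts hj hb ha (h ha)

theorem natCard_inputs (τ : LevelTree n d) {i : ℕ} (h : τ.part i = τ.part (i + 1))
    {b : Finset (Fin n)} (hb : b ∈ (τ.part i).parts) : Nat.card ↥(τ.inputs i b) = 1 :=
  natCard_filter_parts (h ▸ hb)

variable (K) in
/-- The tensor product of the generating operations. -/
noncomputable def one (τ : LevelTree n d) : τ.Tensor (commutative K) :=
  tensorOne (fun v : τ.Vertex => ↥(τ.inputs v.1 v.2)) K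

theorem levelAug_one (τ : LevelTree n d) (i : Fin d) (h : τ.part i = τ.part (i + 1)) :
    τ.levelAug (commutative K) i (fun v => comOne K ↥(τ.inputs v.1 v.2)) = 1 :=
  Finset.prod_eq_one fun b _ => by
    rw [comVal_aug (τ.natCard_inputs h b.2)]
    rfl

theorem mergeMap_one (τ : LevelTree n (d + 1)) (j : Fin d) :
    τ.mergeMap (commutative K) j (τ.one K) = (τ.merge j).one K := by
  apply tensorVal_injective
  unfold one
  rw [tensorVal_one]
  unfold mergeMap tensorOne
  rw [PiTensorProduct.lift.tprod]
  change tensorVal _ (PiTensorProduct.tprod K _) = 1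
  rw [tensorVal_tprod]
  refine Finset.prod_eq_one fun w _ => ?_
  unfold mergeLabel
  rw [comVal_subst]
  refine Eq.trans (congrArg (_ * ·) (Finset.prod_eq_one fun c _ => ?_)) (mul_one (1 : K))
  split_ifs with h
  · rw [comVal_transport]
    rfl
  · refine comVal_unitAt (natCard_filter_subset (fun e he => ⟨fun hec => ?_, fun h => h.le⟩) ?_)
    all_goals
      have h1 : (τ.merge j).part (w.1 + 1) = τ.part (skip j w.1 + 1) := by
        have : (w.1 : ℕ) ≠ j := fun e => h (Fin.ext e)
        simp only [merge, skip]
        congr 1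
        split_ifs <;> omega
      have h2 := Finset.mem_filter.1 c.2
    · have h3 := (Finset.mem_filter.1 he).1
      rw [h1] at h3
      obtain ⟨a, ha⟩ := (τ.part _).nonempty_of_mem_parts h3
      exact (τ.part _).eq_of_mem_parts h3 h2.1 ha (hec ha)
    · refine Finset.mem_filter.2 ⟨?_, h2.2⟩
      rw [h1]
      exact h2.1

theorem dropFirstMap_one (τ : LevelTree n (d + 1)) (h : (τ.part 1).parts = {Finset.univ}) :
    τ.dropFirstMap (commutative K) h (τ.one K) = (τ.dropFirst h).one K := by
  unfold one dropFirstMap tensorOne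
  rw [PiTensorProduct.lift.tprod]
  refine (congrArg (· • _) (τ.levelAug_one (K := K) 0 ?_)).trans (one_smul _ _)
  exact Finpartition.ext (τ.first.trans h.symm)

theorem dropLastMap_one (τ : LevelTree n (d + 1)) (h : τ.part d = ⊥) :
    τ.dropLastMap (commutative K) h (τ.one K) = (τ.dropLast h).one K := by
  unfold one dropLastMap tensorOne
  rw [PiTensorProduct.lift.tprod]
  refine (congrArg (· • _) (τ.levelAug_one (K := K) (Fin.last d) ?_)).trans (one_smul _ _)
  exact h.trans (τ.last _ le_rfl).symm

end LevelTree

variable (K) in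
/-- The basis element of the simplicial bar construction given by a tree with levels. -/
noncomputable def sbarBasis {n d : ℕ} (τ : LevelTree n d) : SBar (commutative K) n d :=
  DirectSum.lof K (LevelTree n d) (fun τ => τ.Tensor (commutative K)) τ (τ.one K)

theorem lof_eq_smul_sbarBasis {n d : ℕ} (τ : LevelTree n d) (t : τ.Tensor (commutative K)) :
    DirectSum.lof K (LevelTree n d) (fun τ => τ.Tensor (commutative K)) τ t =
      tensorVal (fun v : τ.Vertex => ↥(τ.inputs v.1 v.2)) t • sbarBasis K τ := by
  rw [sbarBasis, ← map_smul, LevelTree.one, tensorVal_smul_one]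

theorem sbar_induction {n d : ℕ} {motive : SBar (commutative K) n d → Prop}
    (x : SBar (commutative K) n d) (zero : motive 0)
    (smul : ∀ (c : K) (τ : LevelTree n d), motive (c • sbarBasis K τ))
    (add : ∀ x y, motive x → motive y → motive (x + y)) : motive x := by
  induction x using DirectSum.induction_on with
  | zero => exact zero
  | of T t =>
    have := lof_eq_smul_sbarBasis T t
    rw [DirectSum.lof_eq_of] at this
    rw [this]
    exact smul _ _
  | add x y hx hy => exact add x y hx hy

theorem sbar_hom_ext {n d : ℕ} {M : Type u} [AddCommGroup M] [Module K M]
    {f g : SBar (commutative K) n d →ₗ[K] M} (h : ∀ τ, f (sbarBasis K τ) = g (sbarBasis K τ)) :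
    f = g := by
  refine LinearMap.ext fun x => ?_
  induction x using sbar_induction with
  | zero => simp
  | smul c T => rw [map_smul, map_smul, h]
  | add x y hx hy => rw [map_add, map_add, hx, hy]

variable (K) in
/-- The comparison of the simplicial bar construction with the free module on the chains of
partitions. -/
noncomputable def sbarChain (m d : ℕ) :
    SBar (commutative K) (m + 1) d →ₗ[K] (Finset (Part m) →₀ K) :=
  DirectSum.toModule K _ _ fun τ =>
    LinearMap.toSpanSingleton K _ (levelChain K τ.part d) ∘ₗ
      tensorVal (fun v : τ.Vertex => ↥(τ.inputs v.1 v.2))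

@[simp]
theorem sbarChain_basis {m d : ℕ} (τ : LevelTree (m + 1) d) :
    sbarChain K m d (sbarBasis K τ) = levelChain K τ.part d := by
  rw [sbarChain, sbarBasis, DirectSum.toModule_lof, LinearMap.comp_apply, LevelTree.one,
    tensorVal_one, LinearMap.toSpanSingleton_apply, one_smul]

theorem sbarFirst_basis {n d : ℕ} (τ : LevelTree n (d + 1)) :
    sbarFirst (commutative K) n d (sbarBasis K τ) =
      if h : (τ.part 1).parts = {Finset.univ} then sbarBasis K (τ.dropFirst h) else 0 := by
  unfold sbarFirst sbarBasis
  rw [DirectSum.toModule_lof]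
  split_ifs with h
  · rw [LinearMap.comp_apply, LevelTree.dropFirstMap_one]
  · rfl

theorem sbarLast_basis {n d : ℕ} (τ : LevelTree n (d + 1)) :
    sbarLast (commutative K) n d (sbarBasis K τ) =
      if h : τ.part d = ⊥ then sbarBasis K (τ.dropLast h) else 0 := by
  unfold sbarLast sbarBasis
  rw [DirectSum.toModule_lof]
  split_ifs with h
  · rw [LinearMap.comp_apply, LevelTree.dropLastMap_one]
  · rfl

theorem sbarMerge_basis {n d : ℕ} (j : Fin d) (τ : LevelTree n (d + 1)) :
    sbarMerge (commutative K) n d j (sbarBasis K τ) = sbarBasis K (τ.merge j) := by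
  unfold sbarMerge sbarBasis
  rw [DirectSum.toModule_lof, LinearMap.comp_apply, LevelTree.mergeMap_one]

/-- Merging the levels `j` and `j + 1` forgets the partition `j + 1`, and the augmentations forget
the first or the last one. Where an augmentation vanishes, the remaining sequence has a wrong end
point and `levelChain` is zero as well. -/
theorem bdry_sbarChain {m d : ℕ} (x : SBar (commutative K) (m + 1) (d + 1)) :
    (Partitions.matching m).bdry K (sbarChain K m (d + 1) x) =
      sbarChain K m d (sbarD (commutative K) (m + 1) d x) := by
  refine LinearMap.congr_fun (f := (Partitions.matching m).bdry K ∘ₗ sbarChain K m (d + 1))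
    (g := sbarChain K m d ∘ₗ sbarD (commutative K) (m + 1) d) (sbar_hom_ext fun τ => ?_) x
  have h0 : τ.part 0 = ⊤ := eq_top_iff_parts.2 τ.first
  rw [LinearMap.comp_apply, LinearMap.comp_apply, sbarChain_basis,
    bdry_levelChain τ.anti h0 (τ.last _ le_rfl), Finset.sum_range_succ, Finset.sum_range_succ',
    sbarD]
  simp only [LinearMap.add_apply, LinearMap.sum_apply, LinearMap.smul_apply, map_add, map_sum,
    map_smul, sbarMerge_basis, sbarChain_basis, sbarFirst_basis, sbarLast_basis]
  have hfirst : sbarChain K m d (if h : (τ.part 1).parts = {Finset.univ} then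
      sbarBasis K (τ.dropFirst h) else 0) = levelChain K (fun l => τ.part (avoid 0 l)) d := by
    split_ifs with h
    · rw [sbarChain_basis]; rfl
    · rw [map_zero, levelChain, if_neg]
      exact fun h' => h (eq_top_iff_parts.1 h'.1)
  have hlast : sbarChain K m d (if h : τ.part d = ⊥ then
      sbarBasis K (τ.dropLast h) else 0) = levelChain K (fun l => τ.part (avoid (d + 1) l)) d := by
    have : levelChain K (fun l => τ.part (avoid (d + 1) l)) d = levelChain K τ.part d :=
      levelChain_congr fun l hl => by rw [avoid, if_pos (by omega)]
    rw [this]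
    split_ifs with h
    · rw [sbarChain_basis]; rfl
    · rw [map_zero, levelChain, if_neg]
      exact fun h' => h h'.2.1
  have hmid : ∀ j : ℕ, (fun l => τ.part (LevelTree.skip j l)) =
      fun l => τ.part (avoid (j + 1) l) := fun j => by
    funext l
    unfold LevelTree.skip avoid
    congr 1
    split_ifs <;> omega
  rw [hfirst, hlast, pow_zero, one_smul, add_comm (∑ k ∈ Finset.range d, _), Finset.sum_range]
  congr 2
  refine Finset.sum_congr rfl fun j _ => ?_
  rw [← hmid]
  rfl

theorem sbarChain_mem {m d : ℕ} (x : SBar (commutative K) (m + 1) d) :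
    sbarChain K m d x ∈ (Partitions.matching m).chains K d := by
  induction x using sbar_induction with
  | zero => simp
  | smul c T =>
    rw [map_smul, sbarChain_basis]
    exact Submodule.smul_mem _ _ (levelChain_mem _ _)
  | add x y hx hy => rw [map_add]; exact add_mem hx hy

theorem sbarChain_apply {m d : ℕ} (x : SBar (commutative K) (m + 1) d) (τ : LevelTree (m + 1) d)
    (hτ : IsStrict τ.part d) : sbarChain K m d x ((Finset.range d).image τ.part) =
      tensorVal (fun v : τ.Vertex => ↥(τ.inputs v.1 v.2)) (x τ) := by
  induction x using sbar_induction with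
  | zero => simp
  | smul c S =>
    rw [map_smul, sbarChain_basis, sbarBasis, ← map_smul]
    by_cases h : S = τ
    · subst h
      rw [DirectSum.lof_apply, map_smul, LevelTree.one, tensorVal_one, levelChain, if_pos hτ]
      simp
    · rw [DirectSum.lof_eq_of, DirectSum.of_eq_of_ne _ _ _ (Ne.symm h), map_zero, levelChain]
      split_ifs with hS
      · have : (Finset.range d).image S.part ≠ (Finset.range d).image τ.part := fun e => by
          refine h (LevelTree.ext (funext fun i => ?_))
          rcases lt_or_ge i d with hi | hi
          · exact hS.eq_of_image_eq hτ e hi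
          · rw [S.last i hi, τ.last i hi]
        simp [this]
      · simp
  | add x y hx hy => rw [map_add, Finsupp.add_apply, hx, hy, DirectSum.add_apply, map_add]

/-- The ends of the sequence are correct by definition, so the failure is a repeated partition. On
that level all vertices have one ingoing edge, where the monomial is the operad unit. -/
theorem lof_mem_degenerate {m d : ℕ} (τ : LevelTree (m + 1) d) (hτ : ¬ IsStrict τ.part d)
    (t : τ.Tensor (commutative K)) :
    DirectSum.lof K (LevelTree (m + 1) d) (fun τ => τ.Tensor (commutative K)) τ t ∈
      (commutative K).degenerate (m + 1) d := by
  rw [lof_eq_smul_sbarBasis]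
  refine Submodule.smul_mem _ _ (Submodule.subset_span ?_)
  obtain ⟨i, hi, he⟩ : ∃ i < d, τ.part (i + 1) = τ.part i := by
    by_contra! hne
    exact hτ ⟨eq_top_iff_parts.2 τ.first, τ.last d le_rfl,
      fun i hi => lt_of_le_of_ne (τ.anti (Nat.le_succ i)) (hne i hi)⟩
  refine ⟨τ, fun v => comOne K ↥(τ.inputs v.1 v.2), ⟨i, hi⟩, he.symm, fun b => ?_, rfl⟩
  apply comVal_injective
  rw [comVal_unitAt (τ.natCard_inputs he.symm b.2)]
  rfl

/-- Strict trees give independent chains, so an element of the kernel has components only on trees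
with a repeated level. Compatibility of the differential with degenerate elements then comes for
free, without simplicial identities. -/
theorem degenerate_eq_ker (m d : ℕ) :
    (commutative K).degenerate (m + 1) d = LinearMap.ker (sbarChain K m d) := by
  apply le_antisymm
  · refine Submodule.span_le.2 ?_
    rintro _ ⟨τ, x, i, hi, -, rfl⟩
    rw [SetLike.mem_coe, LinearMap.mem_ker, lof_eq_smul_sbarBasis, map_smul, sbarChain_basis,
      levelChain, if_neg, smul_zero]
    intro h
    have := h.2.2 i i.2
    rw [hi] at this
    exact this.false
  · intro x hx
    rw [LinearMap.mem_ker] at hx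
    rw [← DirectSum.sum_support_of x]
    refine Submodule.sum_mem _ fun τ _ => ?_
    by_cases hτ : IsStrict τ.part d
    · have h1 := sbarChain_apply x τ hτ
      rw [hx, Finsupp.zero_apply, ← map_zero (tensorVal fun v : τ.Vertex => ↥(τ.inputs v.1 v.2))]
        at h1
      rw [← tensorVal_injective _ h1, map_zero]
      exact Submodule.zero_mem _
    · exact lof_mem_degenerate τ hτ _

theorem degenerate_le_comap (m d : ℕ) : (commutative K).degenerate (m + 1) (d + 1) ≤
    ((commutative K).degenerate (m + 1) d).comap ((commutative K).sbarD (m + 1) d) := by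
  rw [degenerate_eq_ker, degenerate_eq_ker]
  intro x hx
  rw [LinearMap.mem_ker] at hx
  rw [Submodule.mem_comap, LinearMap.mem_ker, ← bdry_sbarChain, hx, map_zero]

theorem exists_sbarChain_eq {m d : ℕ} {y : Finset (Part m) →₀ K}
    (hy : y ∈ (Partitions.matching m).chains K d) : ∃ x, sbarChain K m d x = y := by
  rw [← LinearMap.mem_range]
  unfold CellFamily.chains at hy
  rw [Finsupp.supported_eq_span_single] at hy
  refine Submodule.span_le.2 ?_ hy
  rintro _ ⟨G, ⟨hG, hd⟩, rfl⟩
  obtain ⟨p, hp, hlast, hs, hG'⟩ := IsFamily.exists_isStrict hG hd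
  let τ : LevelTree (m + 1) d := ⟨p, hp, eq_top_iff_parts.1 hs.1, hlast⟩
  refine ⟨sbarBasis K τ, ?_⟩
  rw [sbarChain_basis, levelChain, if_pos (show IsStrict τ.part d from hs)]
  exact congrArg (fun F => Finsupp.single F (1 : K)) hG'

variable (K) in
/-- The comparison of the normalized bar construction with the free module on the chains of
partitions. -/
noncomputable def normChain (m d : ℕ) :
    NBar (commutative K) (m + 1) d →ₗ[K] (Finset (Part m) →₀ K) :=
  Submodule.liftQ _ (sbarChain K m d) (degenerate_eq_ker m d).le

theorem normChain_injective (m d : ℕ) : Function.Injective (normChain K m d) := by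
  rw [← LinearMap.ker_eq_bot, normChain, Submodule.ker_liftQ, ← degenerate_eq_ker,
    Submodule.mkQ_map_self]

theorem normChain_mem {m d : ℕ} (x : NBar (commutative K) (m + 1) d) :
    normChain K m d x ∈ (Partitions.matching m).chains K d := by
  obtain ⟨x, rfl⟩ := Submodule.mkQ_surjective _ x
  exact sbarChain_mem x

theorem exists_normChain_eq {m d : ℕ} {y : Finset (Part m) →₀ K}
    (hy : y ∈ (Partitions.matching m).chains K d) : ∃ x, normChain K m d x = y := by
  obtain ⟨x, rfl⟩ := exists_sbarChain_eq hy
  exact ⟨Submodule.mkQ _ x, rfl⟩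

theorem bdry_normChain {m d : ℕ} (h) (x : NBar (commutative K) (m + 1) (d + 1)) :
    (Partitions.matching m).bdry K (normChain K m (d + 1) x) =
      normChain K m d (normD (commutative K) (m + 1) d h x) := by
  obtain ⟨x, rfl⟩ := Submodule.mkQ_surjective _ x
  exact bdry_sbarChain x

end SymmOperad

/-! ## Quasi-isomorphisms of complexes of modules, in terms of elements -/

namespace SymmOperad

variable {K : Type u} [CommRing K]

/-- The two hypotheses are injectivity and surjectivity on homology classes, expressed with
representing cycles. -/
theorem shortComplex_quasiIso_of_elements {S T : ShortComplex (ModuleCat.{u} K)} (φ : S ⟶ T)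
    (inj : ∀ x : S.X₂, S.g x = 0 → (∃ y, T.f y = φ.τ₂ x) → ∃ z, S.f z = x)
    (surj : ∀ y : T.X₂, T.g y = 0 → ∃ x : S.X₂, S.g x = 0 ∧ ∃ z, T.f z = y - φ.τ₂ x) :
    ShortComplex.QuasiIso φ := by
  have hex : ∀ (R : ShortComplex (ModuleCat.{u} K)) (z : R.cycles), R.homologyπ z = 0 →
      ∃ y, R.toCycles y = z := fun R z hz => by
    have := (ShortComplex.mk R.toCycles R.homologyπ (by simp)).exact_of_g_is_cokernel
      R.homologyIsCokernel
    rw [ShortComplex.moduleCat_exact_iff] at this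
    exact this z hz
  have hsurj : ∀ (R : ShortComplex (ModuleCat.{u} K)) (h : R.homology), ∃ z, R.homologyπ z = h :=
    fun R => (ModuleCat.epi_iff_surjective _).1 inferInstance
  have hi : ∀ (R : ShortComplex (ModuleCat.{u} K)), Function.Injective R.iCycles :=
    fun R => (ModuleCat.mono_iff_injective _).1 inferInstance
  have hcyc : ∀ (R : ShortComplex (ModuleCat.{u} K)) (x : R.X₂), R.g x = 0 →
      ∃ z, R.iCycles z = x := fun R x hx => by
    have := LinearMap.congr_fun
      (congrArg ModuleCat.Hom.hom R.moduleCatCyclesIso_inv_iCycles) ⟨x, hx⟩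
    exact ⟨_, this⟩
  have hg : ∀ (R : ShortComplex (ModuleCat.{u} K)) (z : R.cycles), R.g (R.iCycles z) = 0 :=
    fun R z => by rw [← ModuleCat.comp_apply, ShortComplex.iCycles_g]; rfl
  have ht : ∀ (R : ShortComplex (ModuleCat.{u} K)) (y : R.X₁), R.iCycles (R.toCycles y) = R.f y :=
    fun R y => by rw [← ModuleCat.comp_apply, ShortComplex.toCycles_i]
  have hπt : ∀ (R : ShortComplex (ModuleCat.{u} K)) (y : R.X₁), R.homologyπ (R.toCycles y) = 0 :=
    fun R y => by rw [← ModuleCat.comp_apply, ShortComplex.toCycles_comp_homologyπ]; rfl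
  have hm : ∀ z, ShortComplex.homologyMap φ (S.homologyπ z) =
      T.homologyπ (ShortComplex.cyclesMap φ z) := fun z => by
    rw [← ModuleCat.comp_apply, ShortComplex.homologyπ_naturality, ModuleCat.comp_apply]
  have hmi : ∀ z, T.iCycles (ShortComplex.cyclesMap φ z) = φ.τ₂ (S.iCycles z) := fun z => by
    rw [← ModuleCat.comp_apply, ShortComplex.cyclesMap_i, ModuleCat.comp_apply]
  rw [ShortComplex.quasiIso_iff]
  have hmono : Mono (ShortComplex.homologyMap φ) := by
    rw [ModuleCat.mono_iff_injective, injective_iff_map_eq_zero]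
    intro h hh
    obtain ⟨z, rfl⟩ := hsurj S h
    rw [hm] at hh
    obtain ⟨y, hy⟩ := hex T _ hh
    obtain ⟨w, hw⟩ := inj (S.iCycles z) (hg S z) ⟨y, by rw [← ht, hy, hmi]⟩
    have : S.toCycles w = z := hi S (by rw [ht, hw])
    rw [← this, hπt]
  have hepi : Epi (ShortComplex.homologyMap φ) := by
    rw [ModuleCat.epi_iff_surjective]
    intro h
    obtain ⟨z, rfl⟩ := hsurj T h
    obtain ⟨x, hx, w, hw⟩ := surj (T.iCycles z) (hg T z)
    obtain ⟨z', rfl⟩ := hcyc S x hx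
    refine ⟨S.homologyπ z', ?_⟩
    rw [hm, ← sub_eq_zero, ← map_sub]
    have : T.toCycles (-w) = ShortComplex.cyclesMap φ z' - z := hi T (by
      rw [ht, map_sub, hmi, map_neg, hw, neg_sub])
    rw [← this, hπt]
  exact isIso_of_mono_of_epi _

/-- The cycles of a sequence of modules and of linear maps. -/
def cyclesOf {X : ℕ → Type u} [∀ i, AddCommGroup (X i)] [∀ i, Module K (X i)]
    (dX : ∀ i, X (i + 1) →ₗ[K] X i) : ∀ i, Submodule K (X i)
  | 0 => ⊤
  | i + 1 => LinearMap.ker (dX i)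

theorem isQuasiIso_of_elements {X Y : ℕ → Type u} [∀ i, AddCommGroup (X i)] [∀ i, Module K (X i)]
    [∀ i, AddCommGroup (Y i)] [∀ i, Module K (Y i)] {dX : ∀ i, X (i + 1) →ₗ[K] X i}
    {dY : ∀ i, Y (i + 1) →ₗ[K] Y i} {f : ∀ i, X i →ₗ[K] Y i}
    (sqX : ∀ i, dX i ∘ₗ dX (i + 1) = 0) (sqY : ∀ i, dY i ∘ₗ dY (i + 1) = 0)
    (comm : ∀ i, dY i ∘ₗ f (i + 1) = f i ∘ₗ dX i)
    (inj : ∀ i, ∀ x ∈ cyclesOf dX i, (∃ y, dY i y = f i x) → ∃ z, dX i z = x)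
    (surj : ∀ i, ∀ y ∈ cyclesOf dY i, ∃ x ∈ cyclesOf dX i, ∃ z, dY i z = y - f i x) :
    IsQuasiIso dX dY f := by
  refine ⟨sqX, sqY, comm, ?_⟩
  have hdX : ∀ i x, (ChainComplex.of.d (fun i => ModuleCat.of K (X i))
      (fun i => ModuleCat.ofHom (dX i)) (i + 1) i) x = dX i x := fun i x => by
    rw [ChainComplex.of_d]; rfl
  have hdY : ∀ i y, (ChainComplex.of.d (fun i => ModuleCat.of K (Y i))
      (fun i => ModuleCat.ofHom (dY i)) (i + 1) i) y = dY i y := fun i y => by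
    rw [ChainComplex.of_d]; rfl
  rw [quasiIso_iff]
  intro i
  -- In degree zero the outgoing differential is zero and every element is a cycle.
  rcases i with _ | i
  · rw [quasiIsoAt_iff' _ 1 0 0 (by simp) (by simp)]
    refine shortComplex_quasiIso_of_elements _ (fun x _ => ?_) (fun y _ => ?_)
    · rintro ⟨y, hy⟩
      obtain ⟨z, hz⟩ := inj 0 x trivial ⟨y, (hdY 0 y).symm.trans hy⟩
      exact ⟨z, (hdX 0 z).trans hz⟩
    · obtain ⟨x, -, z, hz⟩ := surj 0 y trivial
      refine ⟨x, ?_, z, (hdY 0 z).trans hz⟩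
      have : ChainComplex.of.d (fun i => ModuleCat.of K (X i))
        (fun i => ModuleCat.ofHom (dX i)) 0 0 = 0 := ChainComplex.of_d_ne _ _ (by simp)
      exact LinearMap.congr_fun (congrArg ModuleCat.Hom.hom this) x
  · rw [quasiIsoAt_iff' _ (i + 2) (i + 1) i (by simp) (by simp)]
    refine shortComplex_quasiIso_of_elements _ (fun x hx => ?_) (fun y hy => ?_)
    · rintro ⟨y, hy⟩
      obtain ⟨z, hz⟩ := inj (i + 1) x ((hdX i x).symm.trans hx) ⟨y, (hdY (i + 1) y).symm.trans hy⟩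
      exact ⟨z, (hdX (i + 1) z).trans hz⟩
    · obtain ⟨x, hx, z, hz⟩ := surj (i + 1) y ((hdY i y).symm.trans hy)
      exact ⟨x, (hdX i x).trans hx, z, (hdY (i + 1) z).trans hz⟩

end SymmOperad

/-! ## Homology of the bar constructions -/

namespace SymmOperad

open Classical

variable {K : Type u} [CommRing K]

theorem mem_cyclesOf_zero {X : ℕ → Type u} [∀ i, AddCommGroup (X i)] [∀ i, Module K (X i)]
    {i : ℕ} (x : X i) : x ∈ cyclesOf (K := K) (X := X) (fun _ => 0) i := by
  cases i with
  | zero => trivial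
  | succ i => exact LinearMap.zero_apply x

/-- An identification of a complex with the complex of chains of a family of cells. -/
structure CellModel {V W : Type} (M : CellMatching V W) {X : ℕ → Type u}
    [∀ i, AddCommGroup (X i)] [∀ i, Module K (X i)] (dX : ∀ i, X (i + 1) →ₗ[K] X i) where
  chain : ∀ d, X d →ₗ[K] (Finset V →₀ K)
  injective : ∀ d, Function.Injective (chain d)
  mem : ∀ d x, chain d x ∈ M.chains K d
  exists_eq : ∀ d, ∀ y ∈ M.chains K d, ∃ x, chain d x = y
  bdry_chain : ∀ d x, M.bdry K (chain (d + 1) x) = chain d (dX d x)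

namespace CellModel

variable {V W : Type} {M : CellMatching V W} {X : ℕ → Type u} [∀ i, AddCommGroup (X i)]
  [∀ i, Module K (X i)] {dX : ∀ i, X (i + 1) →ₗ[K] X i} (C : CellModel M dX)

include C

theorem d_comp_d (i : ℕ) : dX i ∘ₗ dX (i + 1) = 0 := by
  refine LinearMap.ext fun x => C.injective i ?_
  rw [LinearMap.comp_apply, ← C.bdry_chain, ← C.bdry_chain, CellFamily.bdry_bdry (C.mem _ x),
    LinearMap.zero_apply, map_zero]

theorem eq_zero_of_lt {d : ℕ} (hd : M.top < d) (x : X d) : x = 0 :=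
  C.injective d (by rw [CellMatching.chains_eq_zero hd (C.mem d x), map_zero])

theorem bdry_eq_zero {d : ℕ} {x : X d} (hx : x ∈ cyclesOf dX d) : M.bdry K (C.chain d x) = 0 := by
  rcases d with _ | d
  -- In degree zero the only possible cell is the empty family, which has no faces.
  · have h := C.mem 0 x
    unfold CellFamily.chains at h
    rw [Finsupp.supported_eq_span_single] at h
    rw [← LinearMap.mem_ker]
    refine Submodule.span_le.2 ?_ h
    rintro _ ⟨F, ⟨-, hF⟩, rfl⟩
    rw [Finset.card_eq_zero] at hF
    subst hF
    rw [SetLike.mem_coe, LinearMap.mem_ker, CellFamily.bdry_single, CellFamily.faceSum]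
    simp
  · rw [C.bdry_chain, LinearMap.mem_ker.1 hx, map_zero]

/-- Below the top degree this is the matching argument; above it the modules are zero. -/
theorem exists_primitive {d : ℕ} (hd : d ≠ M.top) {x : X d} (hx : x ∈ cyclesOf dX d) :
    ∃ z, dX d z = x := by
  rcases lt_or_gt_of_ne hd with hd | hd
  · obtain ⟨z, hz, -, hz'⟩ := CellMatching.exists_primitive hd (C.mem d x) (C.bdry_eq_zero hx)
    obtain ⟨z, rfl⟩ := C.exists_eq _ z hz
    exact ⟨z, C.injective d (by rw [← C.bdry_chain, hz'])⟩
  · exact ⟨0, by rw [C.eq_zero_of_lt hd x, map_zero]⟩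

theorem eq_zero_of_crit {x : X M.top} (hx : x ∈ cyclesOf dX M.top)
    (h : M.crit K (C.chain _ x) = 0) : x = 0 :=
  C.injective _ (by
    rw [map_zero]
    exact CellMatching.eq_zero_of_crit_eq_zero (C.mem _ x) (C.bdry_eq_zero hx) h)

theorem exists_cycle {y : Finset V →₀ K} (hy : y ∈ M.chains K M.top) (h : M.crit K y = y) :
    ∃ x ∈ cyclesOf dX M.top, M.crit K (C.chain _ x) = y := by
  obtain ⟨x, hx, h1, h2⟩ := CellMatching.exists_cycle hy h
  obtain ⟨x, rfl⟩ := C.exists_eq _ x hx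
  refine ⟨x, ?_, h2⟩
  generalize M.top = d at *
  rcases d with _ | d
  · trivial
  · refine LinearMap.mem_ker.2 (C.injective d ?_)
    rw [← C.bdry_chain, h1 d rfl, map_zero]

/-- The cycles of top degree are determined by their critical components. -/
noncomputable def cyclesEquiv :
    cyclesOf dX M.top ≃ₗ[K] Finsupp.supported K K {F | M.Critical F} :=
  LinearEquiv.ofBijective
    ((M.crit K ∘ₗ C.chain M.top ∘ₗ (cyclesOf dX M.top).subtype).codRestrict
      (Finsupp.supported K K {F | M.Critical F}) fun x F hF => by
      rw [Finset.mem_coe, Finsupp.mem_support_iff, LinearMap.comp_apply,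
        CellMatching.crit_apply] at hF
      exact (ite_ne_right_iff.1 hF).1) (by
    constructor
    · rw [injective_iff_map_eq_zero]
      exact fun x hx => Subtype.ext (C.eq_zero_of_crit x.2 (congrArg Subtype.val hx))
    · rintro ⟨y, hy⟩
      have h1 : y ∈ M.chains K M.top := fun F hF => ⟨(hy hF).1, M.card_critical (hy hF).1 (hy hF).2⟩
      have h2 : M.crit K y = y := by
        ext F
        rw [CellMatching.crit_apply]
        split_ifs with hF
        · rfl
        · by_contra hne
          exact hF (hy (Finsupp.mem_support_iff.2 (Ne.symm hne)))
      obtain ⟨x, hx, h⟩ := C.exists_cycle h1 h2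
      exact ⟨⟨x, hx⟩, Subtype.ext h⟩)

/-- Over an arbitrary ring a kernel need not be projective; here it is free on the critical cells.
-/
theorem projective_cycles : Module.Projective K (cyclesOf dX M.top) :=
  Module.Projective.of_equiv
    ((Finsupp.supportedEquivFinsupp {F | M.Critical F}).symm.trans C.cyclesEquiv.symm)

end CellModel

variable (K) in
/-- The bar construction of the commutative operad as a complex of cells. -/
noncomputable def barModel (m : ℕ) :
    CellModel (K := K) (X := fun d => Bar (commutative K) (m + 1) d) (RTree.matching m)
      (barD (commutative K) (m + 1)) where
  chain d := barChain K (m + 1) d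
  injective d := barChain_injective (m + 1) d
  mem _ x := barChain_mem x
  exists_eq _ _ hy := exists_barChain_eq hy
  bdry_chain _ x := bdry_barChain x

variable (K) in
/-- The normalized bar construction of the commutative operad as a complex of cells. -/
noncomputable def normModel (m : ℕ) :
    CellModel (K := K) (X := fun d => NBar (commutative K) (m + 1) d) (Partitions.matching m)
      (fun d => normD (commutative K) (m + 1) d (degenerate_le_comap m d)) where
  chain d := normChain K m d
  injective d := normChain_injective m d
  mem _ x := normChain_mem x
  exists_eq _ _ hy := exists_normChain_eq hy
  bdry_chain _ x := bdry_normChain _ x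

theorem barCycles_eq (n d : ℕ) : (commutative K).barCycles n d =
    cyclesOf (X := fun d => Bar (commutative K) n d) (barD (commutative K) n) d := by
  cases d <;> rfl

theorem isEmpty_rtree_zero (d : ℕ) : IsEmpty (RTree 0 d) := ⟨fun T => by
  have := T.two_le _ (T.univ_mem (by omega))
  simp at this⟩

theorem isEmpty_levelTree_zero (d : ℕ) : IsEmpty (LevelTree 0 d) := ⟨fun τ => by
  have h : (Finset.univ : Finset (Fin 0)) ∈ (τ.part 0).parts := by simp [τ.first]
  exact (τ.part 0).ne_empty h rfl⟩

instance (d : ℕ) : Subsingleton (Bar (commutative K) 0 d) :=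
  ⟨fun _ _ => DFinsupp.ext fun T => ((isEmpty_rtree_zero d).false T).elim⟩

instance (d : ℕ) : Subsingleton (SBar (commutative K) 0 d) :=
  ⟨fun _ _ => DFinsupp.ext fun T => ((isEmpty_levelTree_zero d).false T).elim⟩

instance (d : ℕ) : Subsingleton (NBar (commutative K) 0 d) :=
  (Submodule.mkQ_surjective _).subsingleton

/-! ## The Koszul construction of the commutative operad -/

theorem mem_commutativeWeight (s : ℕ) (I : Type) [Finite I] (p : (commutative K).obj I) :
    p ∈ (commutativeWeight K).wt s I ↔ (Nat.card I = s + 1 ∨ p = 0) := by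
  change p ∈ (if Nat.card I = s + 1 then ⊤ else ⊥ : Submodule K ((commutative K).obj I)) ↔ _
  split_ifs with h <;> simp [h]

/-- If no label is zero, the weights are forced to be `|I_v| - 1`, and they sum to `n - 1` by
`sum_card_inputs`. -/
theorem weight_bar_eq_bot (n d s : ℕ) (hs : s ≠ n - 1) : (commutativeWeight K).bar n d s = ⊥ := by
  rw [WeightGrading.bar, Submodule.span_eq_bot]
  rintro _ ⟨T, x, t, hx, ht, rfl⟩
  simp only [mem_commutativeWeight] at hx
  obtain ⟨v, hv⟩ : ∃ v, x v = 0 := by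
    by_contra! hne
    refine hs (ht.symm.trans (Eq.trans ?_ T.sum_card_inputs))
    refine Finset.sum_congr rfl fun v _ => ?_
    have := (hx v).resolve_right (hne v)
    rw [Nat.card_eq_fintype_card, Fintype.card_coe] at this
    omega
  rw [(PiTensorProduct.tprod K).map_coord_zero v hv, map_zero]

theorem weight_bar_eq_top (n d : ℕ) : (commutativeWeight K).bar n d (n - 1) = ⊤ := by
  rw [eq_top_iff]
  intro x _
  induction x using bar_induction with
  | zero => exact Submodule.zero_mem _
  | smul c T =>
    refine Submodule.smul_mem _ _ (Submodule.subset_span ?_)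
    refine ⟨T, fun v => comOne K _, fun v => (T.inputs v).card - 1, fun v => ?_,
      T.sum_card_inputs, rfl⟩
    rw [mem_commutativeWeight]
    left
    have := T.two_le_card_inputs (T.two_le v v.2)
    rw [Nat.card_eq_fintype_card, Fintype.card_coe]
    exact (Nat.sub_add_cancel (by omega)).symm
  | add x y hx hy => exact add_mem (hx trivial) (hy trivial)

theorem koszul_eq_bot {n s : ℕ} (hs : s ≠ n - 1) : (commutativeWeight K).koszul n s = ⊥ := by
  rw [WeightGrading.koszul, weight_bar_eq_bot _ _ _ hs, bot_inf_eq]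

theorem koszul_eq_cycles (n : ℕ) : (commutativeWeight K).koszul n (n - 1) =
    cyclesOf (X := fun d => Bar (commutative K) n d) (barD (commutative K) n) (n - 1) := by
  rw [WeightGrading.koszul, weight_bar_eq_top, top_inf_eq, barCycles_eq]

/-- The Koszul construction is concentrated in degree `n - 1`, where it consists of all cycles.
Nothing lies above that degree, so there are no boundaries in it, and the bar complex is exact in
the other degrees. -/
theorem koszulToBar (n : ℕ) : (commutativeWeight K).KoszulToBarQuasiIso n := by
  have hker : ∀ i, (commutativeWeight K).koszul n (i + 1) ≤ LinearMap.ker (barD _ n i) :=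
    fun i => inf_le_right
  refine isQuasiIso_of_elements (fun _ => LinearMap.comp_zero _) (fun i => ?_) (fun i => ?_)
    (fun i x _ => ?_) (fun i y hy => ?_)
  · rcases n with _ | m
    · exact LinearMap.ext fun _ => Subsingleton.elim _ _
    · exact (barModel K m).d_comp_d i
  · refine LinearMap.ext fun x => ?_
    rw [LinearMap.comp_zero]
    exact LinearMap.mem_ker.1 (hker i x.2)
  · rintro ⟨y, hy⟩
    refine ⟨0, ?_⟩
    rw [LinearMap.zero_apply, eq_comm]
    by_cases hi : i = n - 1
    -- For `n = 0` the truncated difference `n - 1` is `0`, but all modules vanish.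
    · rcases n with _ | m
      · exact Subtype.ext (Subsingleton.elim _ _)
      · have : y = 0 := (barModel K m).eq_zero_of_lt (by rw [hi]; exact Nat.lt_succ_self _) y
        rw [this, map_zero] at hy
        exact Subtype.ext hy.symm
    · exact Subtype.ext ((Submodule.mem_bot K).1 ((koszul_eq_bot hi).le x.2))
  · by_cases hi : i = n - 1
    · subst hi
      exact ⟨⟨y, by rw [koszul_eq_cycles]; exact hy⟩, mem_cyclesOf_zero _, 0, by simp⟩
    · refine ⟨0, Submodule.zero_mem _, ?_⟩
      rcases n with _ | m
      · exact ⟨0, Subsingleton.elim _ _⟩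
      · obtain ⟨z, hz⟩ := (barModel K m).exists_primitive hi hy
        exact ⟨z, by rw [hz, map_zero, sub_zero]⟩

theorem commutative_projective (I : Type) [Finite I] :
    Module.Projective K ((commutative K).obj I) := by
  rcases isEmpty_or_nonempty I with h | h
  · have := commutative_subsingleton (K := K) I h
    infer_instance
  · exact Module.Projective.of_equiv (LinearEquiv.ofBijective (comVal (K := K) I)
      ⟨comVal_injective I, fun c => ⟨c • comOne K I, by simp⟩⟩).symm

theorem projective_koszul (n s : ℕ) : Module.Projective K ((commutativeWeight K).koszul n s) := by
  by_cases hs : s = n - 1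
  · subst hs
    rw [koszul_eq_cycles]
    rcases n with _ | m
    · infer_instance
    · exact (barModel K m).projective_cycles
  · rw [koszul_eq_bot hs]
    infer_instance

theorem commutative_isKoszul : (commutativeWeight K).IsKoszul where
  connected := by
    refine ⟨⟨fun I _ h => commutative_subsingleton I h, ?_⟩, fun I _ h => ?_⟩
    · have key : ∀ c : K, comVal Unit (c • (commutative K).one) = c := fun c => by
        rw [map_smul]
        exact mul_one c
      exact ⟨fun a b hab => by rw [← key a, ← key b]; exact congrArg _ hab,
        fun p => ⟨comVal Unit p, comVal_injective _ (key _)⟩⟩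
    · rw [eq_bot_iff]
      intro p hp
      exact ((mem_commutativeWeight 0 I p).1 hp).resolve_left h
  projective I _ := commutative_projective I
  projective_koszul := projective_koszul
  quasiIso := koszulToBar

end SymmOperad

/-! ## Levelings of trees -/

namespace SymmOperad.RTree.Leveling

open Classical Partitions

variable {n d : ℕ}

theorem ext_val {T : RTree n d} {l l' : T.Leveling} (h : ∀ v, (l.1 v : ℕ) = l'.1 v) : l = l' :=
  Subtype.ext (Equiv.ext fun v => Fin.ext (h v))

/-- A leveling is given by an injective decreasing function on the vertices. -/
noncomputable def ofInjective (T : RTree n d) (f : T.verts → ℕ) (hf : ∀ v, f v < d)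
    (hinj : Function.Injective f) (hlt : ∀ v w : T.verts, v.1 ⊂ w.1 → f w < f v) : T.Leveling :=
  ⟨Equiv.ofBijective (fun v => (⟨f v, hf v⟩ : Fin d))
    ((Fintype.bijective_iff_injective_and_card _).2
      ⟨fun _ _ h => hinj (congrArg Fin.val h), by simp [T.card_verts]⟩), hlt⟩

section Tensor

variable {K : Type u} [CommRing K] {T : RTree n d} (l : T.Leveling)

theorem mem_part_iff {i : ℕ} {c : Finset (Fin n)} : c ∈ (l.tree.part i).parts ↔
    l.Above i c ∧ ∀ w : T.verts, i ≤ l.1 w → ¬ c ⊂ w.1 := mem_blocks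

/-- Only the block of the vertex placed on level `i` is subdivided there; every other block merely
crosses the level, so its label is a unit. -/
theorem mem_part_succ {i : Fin d} {b : Finset (Fin n)} (hb : b ∈ (l.tree.part i).parts)
    (h : b ≠ (l.1.symm i).1) : b ∈ (l.tree.part (i + 1)).parts := by
  rw [mem_part_iff] at hb ⊢
  refine ⟨hb.1.imp_left ?_, fun w hw => hb.2 w (by omega)⟩
  rintro ⟨w, rfl, hw⟩
  refine ⟨w, rfl, lt_of_le_of_ne hw fun e => h ?_⟩
  rw [show i = l.1 w from Fin.ext e, Equiv.symm_apply_apply]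

theorem tensorMap_one : l.tensorMap (commutative K)
    (tensorOne (fun v : T.verts => ↥(T.inputs v)) K) = l.tree.one K := by
  apply tensorVal_injective
  unfold LevelTree.one
  rw [tensorVal_one]
  unfold tensorMap tensorOne
  rw [PiTensorProduct.lift.tprod]
  change tensorVal _ (PiTensorProduct.tprod K _) = 1
  rw [tensorVal_tprod]
  refine Finset.prod_eq_one fun w _ => ?_
  unfold label
  split_ifs with h
  · rw [comVal_transport]
    rfl
  · exact comVal_unitAt (LevelTree.natCard_filter_parts (l.mem_part_succ w.2.2 h))

end Tensor

/-- The vertex placed on level `i` is a block just below that level and no longer one just above it.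
-/
theorem isStrict {m d : ℕ} {T : RTree (m + 1) d} (l : T.Leveling) :
    IsStrict l.tree.part d := by
  refine ⟨eq_top_iff_parts.2 l.tree.first, l.tree.last d le_rfl, fun i hi => ?_⟩
  refine lt_of_le_of_ne (l.tree.anti (Nat.le_succ i)) fun e => ?_
  obtain ⟨v, hv⟩ := l.1.surjective ⟨i, hi⟩
  have h := l.mem_part v
  rw [hv] at h
  change v.1 ∈ (l.tree.part i).parts at h
  rw [← e, mem_part_iff] at h
  rcases h.1 with ⟨w, hw, hle⟩ | h1
  · rw [Subtype.ext hw, hv] at hle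
    exact absurd hle (Nat.not_succ_le_self i)
  · have := T.two_le _ v.2
    omega

/-! ### Removal and insertion of a vertex -/

/-- The vertex on the level just before the level of `v`. -/
noncomputable def below {T : RTree n d} (l : T.Leveling) (v : T.verts) : T.verts :=
  -- With truncated subtraction, the vertex on level `0` is its own predecessor.
  l.1.symm ⟨l.1 v - 1, by omega⟩

theorem val_below {T : RTree n d} (l : T.Leveling) (v : T.verts) :
    (l.1 (l.below v) : ℕ) = l.1 v - 1 := by simp [below]

theorem eq_below {T : RTree n d} (l : T.Leveling) {v w : T.verts}
    (h : (l.1 w : ℕ) = l.1 v - 1) : l.below v = w :=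
  l.1.injective (Fin.ext (by rw [val_below, h]))

theorem val_root {T : RTree n d} (l : T.Leveling) {v : T.verts} (hv : v.1 = Finset.univ) :
    (l.1 v : ℕ) = 0 := by
  by_contra h
  have h1 := l.val_below v
  have hne : l.below v ≠ v := fun e => by rw [e] at h1; omega
  have : (l.below v).1 ⊂ v.1 := by
    rw [hv]
    exact (Finset.subset_univ _).ssubset_of_ne fun e => hne (Subtype.ext (e.trans hv.symm))
  have h2 : (l.1 v : ℕ) < l.1 (l.below v) := l.2 _ _ this
  omega

theorem val_pos {T : RTree n d} (l : T.Leveling) {v : T.verts} (hv : v.1 ≠ Finset.univ) :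
    0 < (l.1 v : ℕ) := by
  obtain ⟨w, hw, h⟩ := T.exists_parent v.2 hv
  have : (l.1 ⟨w, hw⟩ : ℕ) < l.1 v := l.2 v ⟨w, hw⟩ (mem_inputs.1 h).1
  omega

/-- Exchange of the levels of a vertex and of the preceding vertex. -/
noncomputable def swapBelow {T : RTree n d} (l : T.Leveling) (v : T.verts)
    (h : ¬ v.1 ⊂ (l.below v).1) : T.Leveling :=
  ⟨l.1.trans (Equiv.swap (l.1 v) (l.1 (l.below v))), fun x y hxy => by
    have h1 : (l.1 y : ℕ) < l.1 x := l.2 x y hxy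
    have h2 := l.val_below v
    rw [Fin.lt_def]
    simp only [Equiv.trans_apply, Equiv.swap_apply_def]
    have h3 : ¬ ((l.1 x = l.1 v) ∧ l.1 y = l.1 (l.below v)) := fun ⟨e1, e2⟩ => by
      rw [l.1.injective e1, l.1.injective e2] at hxy
      exact h hxy
    simp only [Fin.ext_iff] at h3 ⊢
    split_ifs <;> omega⟩

section Swap

variable {T : RTree n d} (l : T.Leveling) (v : T.verts) (h : ¬ v.1 ⊂ (l.below v).1)

theorem swapBelow_self : (l.swapBelow v h).1 v = l.1 (l.below v) := by
  simp [swapBelow]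

theorem swapBelow_below : (l.swapBelow v h).1 (l.below v) = l.1 v := by
  simp [swapBelow]

theorem swapBelow_of_ne {w : T.verts} (h1 : w ≠ v) (h2 : w ≠ l.below v) :
    (l.swapBelow v h).1 w = l.1 w := by
  simp only [swapBelow, Equiv.trans_apply]
  exact Equiv.swap_apply_of_ne_of_ne (fun e => h1 (l.1.injective e)) fun e => h2 (l.1.injective e)

theorem below_swapBelow : (l.swapBelow v h).below (l.below v) = v :=
  eq_below _ (by rw [swapBelow_self, swapBelow_below, val_below])

theorem not_below_ssubset : ¬ (l.below v).1 ⊂ v.1 := fun h' => by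
  have : (l.1 v : ℕ) < l.1 (l.below v) := l.2 _ _ h'
  have := l.val_below v
  omega

theorem le_swapBelow_iff {i : ℕ} (hi : i ≠ l.1 v) (w : T.verts) :
    i ≤ (l.swapBelow v h).1 w ↔ i ≤ l.1 w := by
  have h2 := l.val_below v
  by_cases h1 : w = v
  · subst h1
    rw [swapBelow_self]; omega
  by_cases h3 : w = l.below v
  · rw [h3, swapBelow_below]; omega
  · rw [swapBelow_of_ne l v h h1 h3]

/-- Exchanging two adjacent levels only affects the cut between them. -/
theorem part_swapBelow {i : ℕ} (hi : i ≠ l.1 v) :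
    (l.swapBelow v h).tree.part i = l.tree.part i := by
  apply Finpartition.ext
  ext c
  simp only [mem_part_iff, Above, le_swapBelow_iff l v h hi]

end Swap

section Remove

variable {T : RTree n (d + 1)} (l : T.Leveling) (v : T.verts) (hr : v.1 ≠ Finset.univ)

theorem mem_verts_of_contract {T : RTree n (d + 1)} {v : Finset (Fin n)} {hv : v ∈ T.verts}
    {hr : v ≠ Finset.univ} (w : (T.contract v hv hr).verts) : w.1 ∈ T.verts :=
  Finset.mem_of_mem_erase w.2

theorem ne_of_contract {T : RTree n (d + 1)} {v : Finset (Fin n)} {hv : v ∈ T.verts}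
    {hr : v ≠ Finset.univ} (w : (T.contract v hv hr).verts) : w.1 ≠ v :=
  (Finset.mem_erase.1 w.2).1

theorem val_ne_of_contract (w : (T.contract v.1 v.2 hr).verts) :
    (l.1 ⟨w.1, mem_verts_of_contract w⟩ : ℕ) ≠ l.1 v := fun e =>
  ne_of_contract w (congrArg Subtype.val (l.1.injective (Fin.ext e)))

/-- The leveling of the tree obtained by contracting the edge issued from `v`, where the level of
`v` is removed. -/
noncomputable def remove : (T.contract v.1 v.2 hr).Leveling :=
  ofInjective _ (fun w => if (l.1 ⟨w.1, mem_verts_of_contract w⟩ : ℕ) < l.1 v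
      then l.1 ⟨w.1, mem_verts_of_contract w⟩ else l.1 ⟨w.1, mem_verts_of_contract w⟩ - 1)
    (fun w => by
      have := l.val_ne_of_contract v hr w
      split_ifs <;> omega)
    (fun w w' h => by
      have h1 := l.val_ne_of_contract v hr w
      have h2 := l.val_ne_of_contract v hr w'
      have : (l.1 ⟨w.1, mem_verts_of_contract w⟩ : ℕ) = l.1 ⟨w'.1, mem_verts_of_contract w'⟩ := by
        simp only at h
        split_ifs at h <;> omega
      exact Subtype.ext (congrArg (fun z : T.verts => z.1) (l.1.injective (Fin.ext this))))
    (fun w w' h => by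
      have h1 := l.val_ne_of_contract v hr w
      have h2 := l.val_ne_of_contract v hr w'
      have h3 : (l.1 ⟨w'.1, mem_verts_of_contract w'⟩ : ℕ) < l.1 ⟨w.1, mem_verts_of_contract w⟩ :=
        l.2 ⟨w.1, mem_verts_of_contract w⟩ ⟨w'.1, mem_verts_of_contract w'⟩ h
      split_ifs <;> omega)

theorem avoid_remove (w : (T.contract v.1 v.2 hr).verts) :
    avoid (l.1 v) ((l.remove v hr).1 w) = l.1 ⟨w.1, mem_verts_of_contract w⟩ := by
  have h1 := l.val_ne_of_contract v hr w
  have h2 : ((l.remove v hr).1 w : ℕ) = if (l.1 ⟨w.1, mem_verts_of_contract w⟩ : ℕ) < l.1 v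
    then (l.1 ⟨w.1, mem_verts_of_contract w⟩ : ℕ)
    else l.1 ⟨w.1, mem_verts_of_contract w⟩ - 1 := rfl
  rw [h2, avoid]
  split_ifs <;> omega

/-- Each predicate in the hypothesis holds exactly at the level that `w` has after the level of `v`
is deleted; equality of the predicates means that the renumbered levels agree. -/
theorem remove_congr {l l' : T.Leveling} (h : ∀ w : T.verts, w ≠ v →
    (avoid (l.1 v) · = (l.1 w : ℕ)) = (avoid (l'.1 v) · = (l'.1 w : ℕ))) :
    l.remove v hr = l'.remove v hr := by
  refine ext_val fun w => ?_
  have h1 := congrFun (h ⟨w.1, mem_verts_of_contract w⟩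
    fun e => ne_of_contract w (congrArg Subtype.val e)) ((l.remove v hr).1 w : ℕ)
  have h2 := l'.avoid_remove v hr w
  have h3 := h1.mp (l.avoid_remove v hr w)
  rw [← h2] at h3
  unfold avoid at h3
  split_ifs at h3 <;> omega

theorem remove_swapBelow (h : ¬ v.1 ⊂ (l.below v).1) :
    (l.swapBelow v h).remove v hr = l.remove v hr := by
  refine remove_congr v hr fun w hw => funext fun i => ?_
  have h1 := l.val_below v
  have h0 := l.val_pos hr
  have hwv : (l.1 w : ℕ) ≠ l.1 v := fun e => hw (l.1.injective (Fin.ext e))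
  rw [swapBelow_self, h1]
  by_cases hb : w = l.below v
  · rw [hb, swapBelow_below, h1]
    unfold avoid
    apply propext
    split_ifs <;> omega
  · have : (l.1 w : ℕ) ≠ l.1 v - 1 := fun e => hb (l.eq_below e).symm
    rw [swapBelow_of_ne l v h hw hb]
    unfold avoid
    apply propext
    split_ifs <;> omega

/-- The trees with levels associated to the two levelings are the same, when `v` is placed just
after the vertex below it. -/
theorem part_remove (h : v.1 ⊂ (l.below v).1) (i : ℕ) :
    (l.remove v hr).tree.part i = l.tree.part (avoid (l.1 v) i) := by
  have h1 := l.val_below v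
  have h0 := l.val_pos hr
  have hne : (l.below v).1 ≠ v.1 := h.ne'
  let u : (T.contract v.1 v.2 hr).verts := ⟨(l.below v).1, Finset.mem_erase.2 ⟨hne, (l.below v).2⟩⟩
  have key : ∀ w : (T.contract v.1 v.2 hr).verts, i ≤ (l.remove v hr).1 w ↔
      avoid (l.1 v) i ≤ l.1 ⟨w.1, mem_verts_of_contract w⟩ := fun w => by
    rw [← l.avoid_remove v hr w]
    unfold avoid
    split_ifs <;> omega
  -- The cut is never at the level of `v`, so when `v` lies above it, so does the preceding vertex,
  -- which contains `v`. Hence `v` is never a maximal block there.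
  have hu : avoid (l.1 v) i ≤ l.1 v → avoid (l.1 v) i ≤ l.1 (l.below v) := by
    rw [h1]
    unfold avoid
    split_ifs <;> omega
  apply Finpartition.ext
  ext c
  rw [mem_part_iff, mem_part_iff]
  constructor
  · rintro ⟨h2, h3⟩
    refine ⟨h2.imp_left ?_, fun w hw hcw => ?_⟩
    · rintro ⟨w, rfl, hw⟩
      exact ⟨⟨w.1, mem_verts_of_contract w⟩, rfl, (key w).1 hw⟩
    · by_cases hwv : w = v
      · subst hwv
        exact h3 u ((key u).2 (hu hw)) (hcw.trans h)
      · exact h3 ⟨w.1, Finset.mem_erase.2 ⟨fun e => hwv (Subtype.ext e), w.2⟩⟩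
          ((key _).2 hw) hcw
  · rintro ⟨h2, h3⟩
    refine ⟨h2.imp_left ?_, fun w hw hcw => h3 ⟨w.1, mem_verts_of_contract w⟩ ((key w).1 hw) hcw⟩
    rintro ⟨w, rfl, hw⟩
    have hwv : w ≠ v := fun e => by
      subst e
      exact h3 (l.below w) (hu hw) h
    exact ⟨⟨w.1, Finset.mem_erase.2 ⟨fun e => hwv (Subtype.ext e), w.2⟩⟩, rfl, (key _).2 hw⟩

theorem eq_of_remove_eq {l l' : T.Leveling} (h : l.remove v hr = l'.remove v hr)
    (hv : l.1 v = l'.1 v) : l = l' := by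
  refine ext_val fun w => ?_
  by_cases hw : w = v
  · rw [hw, hv]
  · have h1 := l.avoid_remove v hr ⟨w.1, Finset.mem_erase.2 ⟨fun e => hw (Subtype.ext e), w.2⟩⟩
    have h2 := l'.avoid_remove v hr ⟨w.1, Finset.mem_erase.2 ⟨fun e => hw (Subtype.ext e), w.2⟩⟩
    rw [h, hv] at h1
    exact h1.symm.trans h2

/-- A vertex strictly between the two would need a level strictly between two consecutive ones. -/
theorem below_mem_inputs (h : v.1 ⊂ (l.below v).1) : v.1 ∈ T.inputs (l.below v).1 := by
  refine mem_inputs.2 ⟨h, Or.inl v.2, fun w hw h1 h2 => ?_⟩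
  have h3 : (l.1 ⟨w, hw⟩ : ℕ) < l.1 v := l.2 v ⟨w, hw⟩ h1
  have h4 : (l.1 (l.below v) : ℕ) < l.1 ⟨w, hw⟩ := l.2 ⟨w, hw⟩ _ h2
  have h5 := l.val_below v
  omega

/-- The preceding vertex is the parent of `v`, the same in both levelings; its level after the
removal determines the level of `v`. -/
theorem remove_injOn {l l' : T.Leveling} (h : v.1 ⊂ (l.below v).1) (h' : v.1 ⊂ (l'.below v).1)
    (he : l.remove v hr = l'.remove v hr) : l = l' := by
  have hb : l.below v = l'.below v := Subtype.ext (T.parent_unique (l.below v).2 (l'.below v).2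
    (l.below_mem_inputs v h) (l'.below_mem_inputs v h'))
  have h1 := l.avoid_remove v hr ⟨_, Finset.mem_erase.2 ⟨h.ne', (l.below v).2⟩⟩
  have h2 := l'.avoid_remove v hr ⟨_, Finset.mem_erase.2 ⟨h.ne', (l.below v).2⟩⟩
  rw [he] at h1
  refine eq_of_remove_eq v hr he (Fin.ext ?_)
  have h3 := l.val_below v
  have h4 := l'.val_below v
  have h5 := l.val_pos hr
  have h6 := l'.val_pos hr
  rw [← hb] at h4
  change _ = (l.1 (l.below v) : ℕ) at h1
  change _ = (l'.1 (l.below v) : ℕ) at h2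
  rw [h3] at h1
  rw [h4] at h2
  unfold avoid at h1 h2
  split_ifs at h1 h2 <;> omega

/-- Every leveling of the contracted tree is obtained by removing `v` from a leveling where `v` is
placed just after the vertex below it. -/
theorem exists_remove_eq (l' : (T.contract v.1 v.2 hr).Leveling) :
    ∃ l : T.Leveling, v.1 ⊂ (l.below v).1 ∧ l.remove v hr = l' := by
  obtain ⟨u, hu, hvu⟩ := T.exists_parent v.2 hr
  obtain ⟨h1, -, h3⟩ := mem_inputs.1 hvu
  have huv : u ≠ v.1 := h1.ne'
  let u' : (T.contract v.1 v.2 hr).verts := ⟨u, Finset.mem_erase.2 ⟨huv, hu⟩⟩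
  let emb : ∀ w : T.verts, w ≠ v → (T.contract v.1 v.2 hr).verts := fun w hw =>
    ⟨w.1, Finset.mem_erase.2 ⟨fun e => hw (Subtype.ext e), w.2⟩⟩
  -- Insert `v` immediately after its parent `u`. The other vertices containing `v` contain `u`,
  -- hence have lower levels, and those inside `v` are inside `u`, hence have levels at least `k`.
  let k : ℕ := l'.1 u' + 1
  have habove : ∀ (w : T.verts) (hw : w ≠ v), v.1 ⊂ w.1 → (l'.1 (emb w hw) : ℕ) < k := by
    intro w hw hvw
    obtain ⟨a, ha⟩ := nonempty_of (T := T) (Or.inl v.2)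
    rcases trichotomy (Or.inl w.2) (Or.inl hu) (hvw.1 ha) (h1.1 ha) with e | h | h
    · have : emb w hw = u' := Subtype.ext e
      rw [this]; exact Nat.lt_succ_self _
    · exact absurd h (h3 w.1 w.2 hvw)
    · have : (l'.1 (emb w hw) : ℕ) < l'.1 u' := l'.2 u' (emb w hw) h
      omega
  have hbelow : ∀ (w : T.verts) (hw : w ≠ v), w.1 ⊂ v.1 → k ≤ l'.1 (emb w hw) := by
    intro w hw hwv
    have : (l'.1 u' : ℕ) < l'.1 (emb w hw) := l'.2 (emb w hw) u' (hwv.trans h1)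
    omega
  let f : T.verts → ℕ := fun w => if hw : w = v then k else avoid k (l'.1 (emb w hw))
  have hfv : f v = k := dif_pos rfl
  have hfw : ∀ w (hw : w ≠ v), f w = avoid k (l'.1 (emb w hw)) := fun w hw => dif_neg hw
  have hfinj : Function.Injective f := by
    intro w w' h
    by_cases hw : w = v
    · by_cases hw' : w' = v
      · rw [hw, hw']
      · rw [hw, hfv, hfw w' hw'] at h
        unfold avoid at h
        split_ifs at h <;> omega
    · by_cases hw' : w' = v
      · rw [hw', hfv, hfw w hw] at h
        unfold avoid at h
        split_ifs at h <;> omega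
      · rw [hfw w hw, hfw w' hw'] at h
        have : (l'.1 (emb w hw) : ℕ) = l'.1 (emb w' hw') := by
          unfold avoid at h
          split_ifs at h <;> omega
        have := l'.1.injective (Fin.ext this)
        exact Subtype.ext (congrArg (fun z => z.1) this)
  let l : T.Leveling := ofInjective T f (fun w => by
      by_cases hw : w = v
      · rw [hw, hfv]
        have := (l'.1 u').2
        omega
      · rw [hfw w hw]
        have := (l'.1 (emb w hw)).2
        unfold avoid
        split_ifs <;> omega) hfinj (fun w w' h => by
      by_cases hw : w = v
      · have hw' : w' ≠ v := fun e => h.ne (by rw [hw, e])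
        rw [hw, hfv, hfw w' hw', avoid, if_pos (habove w' hw' (hw ▸ h))]
        exact habove w' hw' (hw ▸ h)
      · by_cases hw' : w' = v
        · have := hbelow w hw (hw' ▸ h)
          rw [hw', hfv, hfw w hw, avoid, if_neg (by omega)]
          omega
        · have : (l'.1 (emb w' hw') : ℕ) < l'.1 (emb w hw) := l'.2 (emb w hw) (emb w' hw') h
          rw [hfw w hw, hfw w' hw']
          unfold avoid
          split_ifs <;> omega)
  have hlv : (l.1 v : ℕ) = k := hfv
  have hbel : l.below v = ⟨u, hu⟩ := by
    refine eq_below _ ?_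
    have huv' : (⟨u, hu⟩ : T.verts) ≠ v := fun e => huv (congrArg Subtype.val e)
    rw [hlv]
    change f ⟨u, hu⟩ = _
    rw [hfw _ huv']
    change avoid k (l'.1 u') = _
    rw [avoid, if_pos (Nat.lt_succ_self _)]
    rfl
  refine ⟨l, by rw [hbel]; exact h1, ext_val fun w => ?_⟩
  have h5 := l.avoid_remove v hr w
  have hwv : (⟨w.1, mem_verts_of_contract w⟩ : T.verts) ≠ v := fun e =>
    ne_of_contract w (congrArg Subtype.val e)
  have h6 : (l.1 ⟨w.1, mem_verts_of_contract w⟩ : ℕ) = avoid k (l'.1 w) := hfw _ hwv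
  rw [h6, hlv] at h5
  unfold avoid at h5
  split_ifs at h5 <;> omega

end Remove

end SymmOperad.RTree.Leveling

open Classical in
/-- The inversions between two total orderings, and those which do not involve `v`. -/
theorem card_inversions {V α β : Type*} [Fintype V] [LinearOrder α] [LinearOrder β] {f : V → α}
    {g : V → β} (hf : Function.Injective f) (hg : Function.Injective g) (v : V) :
    (Finset.univ.filter fun p : V × V => f p.1 < f p.2 ∧ g p.2 < g p.1).card +
        2 * (Finset.univ.filter fun w => f w < f v ∧ g w < g v).card =
      (Finset.univ.filter fun p : V × V =>
          (p.1 ≠ v ∧ p.2 ≠ v) ∧ f p.1 < f p.2 ∧ g p.2 < g p.1).card +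
        ((Finset.univ.filter fun w => f w < f v).card +
          (Finset.univ.filter fun w => g w < g v).card) := by
  -- An inversion involving `v` is given by a `w` that comes after `v` for `f` and before it for
  -- `g`, or the other way round. The elements preceding `v` for both orders are then counted twice
  -- on each side.
  have h1 : (Finset.univ.filter fun p : V × V => f p.1 < f p.2 ∧ g p.2 < g p.1).card =
      (Finset.univ.filter fun p : V × V =>
          (p.1 ≠ v ∧ p.2 ≠ v) ∧ f p.1 < f p.2 ∧ g p.2 < g p.1).card +
        ((Finset.univ.filter fun w => f v < f w ∧ g w < g v).card +
          (Finset.univ.filter fun w => f w < f v ∧ g v < g w).card) := by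
    have h2 : (Finset.univ.filter fun w => f v < f w ∧ g w < g v).card =
        ∑ p : V × V, if p.1 = v ∧ f p.1 < f p.2 ∧ g p.2 < g p.1 then 1 else 0 := by
      rw [Fintype.sum_prod_type, Finset.sum_eq_single v (fun a _ ha => by simp [ha]) (by simp)]
      simp
    have h3 : (Finset.univ.filter fun w => f w < f v ∧ g v < g w).card =
        ∑ p : V × V, if p.2 = v ∧ f p.1 < f p.2 ∧ g p.2 < g p.1 then 1 else 0 := by
      rw [Fintype.sum_prod_type_right, Finset.sum_eq_single v (fun a _ ha => by simp [ha])
        (by simp)]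
      simp
    rw [h2, h3, Finset.card_filter, Finset.card_filter, ← Finset.sum_add_distrib,
      ← Finset.sum_add_distrib]
    refine Finset.sum_congr rfl fun p _ => ?_
    obtain ⟨a, b⟩ := p
    by_cases hi : f a < f b ∧ g b < g a
    · by_cases ha : a = v <;> by_cases hb : b = v <;> simp_all
    · simp [hi]
  rw [h1, Nat.add_assoc]
  congr 1
  simp only [Finset.card_filter]
  rw [Finset.mul_sum, ← Finset.sum_add_distrib, ← Finset.sum_add_distrib,
    ← Finset.sum_add_distrib]
  refine Finset.sum_congr rfl fun w _ => ?_
  by_cases hw : w = v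
  · simp [hw]
  · have h2 : f w ≠ f v := fun e => hw (hf e)
    have h3 : g w ≠ g v := fun e => hw (hg e)
    rcases lt_or_gt_of_ne h2 with h | h <;> rcases lt_or_gt_of_ne h3 with h' | h' <;>
      simp [h, h', h.not_gt, h'.not_gt]

/-! ### Signs of levelings. -/

namespace SymmOperad.RTree.Leveling

open Classical Partitions

variable {n d : ℕ} {K : Type u} [CommRing K] {T : RTree n (d + 1)} (l : T.Leveling) (v : T.verts)
  (hr : v.1 ≠ Finset.univ)

theorem card_lt {T : RTree n d} (l : T.Leveling) (v : T.verts) :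
    (Finset.univ.filter fun w => l.1 w < l.1 v).card = l.1 v := by
  rw [← Fin.card_Iio (l.1 v)]
  refine Finset.card_equiv l.1 fun w => ?_
  simp

theorem card_colex_lt (T : RTree n d) (v : T.verts) :
    (Finset.univ.filter fun w : T.verts => toColex w.1 < toColex v.1).card = T.position v.1 := by
  rw [position]
  refine Finset.card_bij (fun w _ => w.1) (fun w hw => ?_) (fun _ _ _ _ h => Subtype.ext h)
    fun w hw => ?_
  · simp only [Finset.mem_filter, Finset.mem_univ, true_and] at hw
    exact Finset.mem_filter.2 ⟨w.2, hw⟩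
  · obtain ⟨h1, h2⟩ := Finset.mem_filter.1 hw
    exact ⟨⟨w, h1⟩, by simpa using h2, rfl⟩

theorem remove_lt_iff (w w' : (T.contract v.1 v.2 hr).verts) :
    (l.remove v hr).1 w < (l.remove v hr).1 w' ↔
      l.1 ⟨w.1, mem_verts_of_contract w⟩ < l.1 ⟨w'.1, mem_verts_of_contract w'⟩ := by
  rw [Fin.lt_def, Fin.lt_def, ← l.avoid_remove v hr w, ← l.avoid_remove v hr w']
  unfold avoid
  split_ifs <;> omega

/-- This is `card_inversions` modulo `2`: the position of `v` counts its predecessors in the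
colexicographic order, and its level counts its predecessors in the leveling. -/
theorem sign_eq : (l.sign : K) = (-1) ^ (T.position v.1 + l.1 v) * (l.remove v hr).sign := by
  have h := card_inversions (f := fun w : T.verts => toColex w.1) (g := fun w => l.1 w)
    (fun _ _ e => Subtype.ext (toColex.injective e)) l.1.injective v
  have h' : (Finset.univ.filter fun p : T.verts × T.verts => (p.1 ≠ v ∧ p.2 ≠ v) ∧
      toColex p.1.1 < toColex p.2.1 ∧ l.1 p.2 < l.1 p.1).card =
      (Finset.univ.filter fun p : (T.contract v.1 v.2 hr).verts × (T.contract v.1 v.2 hr).verts =>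
        toColex p.1.1 < toColex p.2.1 ∧ (l.remove v hr).1 p.2 < (l.remove v hr).1 p.1).card := by
    symm
    refine Finset.card_bij (fun p _ => (⟨p.1.1, mem_verts_of_contract p.1⟩,
      ⟨p.2.1, mem_verts_of_contract p.2⟩)) (fun p hp => ?_) (fun p _ q _ e => ?_) fun p hp => ?_
    · simp only [Finset.mem_filter, Finset.mem_univ, true_and, remove_lt_iff] at hp ⊢
      exact ⟨⟨fun e => ne_of_contract p.1 (congrArg (fun z : T.verts => z.1) e),
        fun e => ne_of_contract p.2 (congrArg (fun z : T.verts => z.1) e)⟩, hp⟩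
    · have e1 := congrArg (fun z : T.verts × T.verts => z.1.1) e
      have e2 := congrArg (fun z : T.verts × T.verts => z.2.1) e
      exact Prod.ext (Subtype.ext e1) (Subtype.ext e2)
    · simp only [Finset.mem_filter, Finset.mem_univ, true_and] at hp
      refine ⟨(⟨p.1.1, Finset.mem_erase.2 ⟨fun e => hp.1.1 (Subtype.ext e), p.1.2⟩⟩,
        ⟨p.2.1, Finset.mem_erase.2 ⟨fun e => hp.1.2 (Subtype.ext e), p.2.2⟩⟩), ?_, rfl⟩
      simp only [Finset.mem_filter, Finset.mem_univ, true_and, remove_lt_iff]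
      exact hp.2
  obtain ⟨x, hx⟩ : ∃ x, (Finset.univ.filter fun p : T.verts × T.verts =>
      toColex p.1.1 < toColex p.2.1 ∧ l.1 p.2 < l.1 p.1).card + 2 * x =
      (Finset.univ.filter fun p : (T.contract v.1 v.2 hr).verts × (T.contract v.1 v.2 hr).verts =>
        toColex p.1.1 < toColex p.2.1 ∧ (l.remove v hr).1 p.2 < (l.remove v hr).1 p.1).card +
      (T.position v.1 + l.1 v) := ⟨_, by rw [← h', ← card_colex_lt, ← card_lt]; convert h⟩
  unfold sign
  rw [← pow_add, Nat.add_comm (T.position v.1 + _), ← hx, pow_add, pow_mul]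
  simp

end SymmOperad.RTree.Leveling

/-! ### Cancellation among the faces of a levelized tree. -/

namespace SymmOperad.RTree.Leveling

open Classical Partitions

variable {K : Type u} [CommRing K]

section Swap

variable {n d : ℕ} {T : RTree n (d + 1)} (l : T.Leveling) (v : T.verts)
  (h : ¬ v.1 ⊂ (l.below v).1)

theorem swapBelow_swapBelow (h') : (l.swapBelow v h).swapBelow (l.below v) h' = l := by
  refine Subtype.ext (Equiv.ext fun w => ?_)
  have h1 := l.below_swapBelow v h
  change Equiv.swap ((l.swapBelow v h).1 (l.below v))
    ((l.swapBelow v h).1 ((l.swapBelow v h).below (l.below v)))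
      (Equiv.swap (l.1 v) (l.1 (l.below v)) (l.1 w)) = _
  rw [h1, swapBelow_self, swapBelow_below, Equiv.swap_apply_self]

/-- Both levelings become equal once `v` is removed, and the level of `v` changes by one, as it is
positive for a non-root vertex. -/
theorem sign_swapBelow (hr : v.1 ≠ Finset.univ) :
    ((l.swapBelow v h).sign : K) = - l.sign := by
  have h0 := l.val_pos hr
  rw [sign_eq _ v hr, sign_eq l v hr, remove_swapBelow, swapBelow_self, val_below]
  obtain ⟨k, hk⟩ := Nat.exists_eq_succ_of_ne_zero h0.ne'
  rw [hk, Nat.succ_sub_one, Nat.succ_eq_add_one]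
  ring

end Swap

variable {m d : ℕ} {T : RTree (m + 1) (d + 1)}

variable (K) in
/-- The component of the differential of a tree with levels where the level of the vertex `v` is
removed. -/
noncomputable def face (l : T.Leveling) (v : T.verts) : Finset (Part m) →₀ K :=
  ((l.sign : K) * (-1) ^ (l.1 v : ℕ)) •
    levelChain K (fun i => l.tree.part (avoid (l.1 v) i)) d

/-- Without its bottom level, the sequence no longer starts with the one-block partition. -/
theorem face_root (l : T.Leveling) {v : T.verts} (hv : l.1 v = 0) :
    face K l v = 0 := by
  rw [face, levelChain, if_neg, smul_zero]
  intro h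
  have h1 := h.1
  rw [hv] at h1
  have h2 := l.isStrict.2.2 0 (Nat.succ_pos d)
  exact h2.ne_top h1

/-- The exchange modifies only the partition which both faces delete, and it reverses the sign. -/
theorem face_swapBelow (l : T.Leveling) (v : T.verts) (h : ¬ v.1 ⊂ (l.below v).1) :
    face K l v + face K (l.swapBelow v h) (l.below v) = 0 := by
  by_cases hr : v.1 = Finset.univ
  · have hv : l.1 v = 0 := Fin.ext (l.val_root hr)
    rw [face_root l hv, face_root _ (by rw [swapBelow_below, hv]), add_zero]
  · have h1 : (fun i => (l.swapBelow v h).tree.part (avoid (l.1 v) i)) =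
        fun i => l.tree.part (avoid (l.1 v) i) := funext fun i =>
      l.part_swapBelow v h (by unfold avoid; split_ifs <;> omega)
    rw [face, face, swapBelow_below, sign_swapBelow l v h hr, h1, neg_mul, neg_smul, add_neg_cancel]

theorem face_of_ssubset (l : T.Leveling) (v : T.verts) (hr : v.1 ≠ Finset.univ)
    (h : v.1 ⊂ (l.below v).1) : face K l v = (-1 : K) ^ T.position v.1 •
      ((l.remove v hr).sign : K) • levelChain K (l.remove v hr).tree.part d := by
  rw [face, sign_eq l v hr, smul_smul]
  congr 1
  · have : ((-1 : K) ^ (l.1 v : ℕ)) * (-1) ^ (l.1 v : ℕ) = 1 := by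
      rw [← mul_pow]; simp
    rw [pow_add]
    linear_combination (-1 : K) ^ T.position v.1 * (l.remove v hr).sign * this
  · congr 1
    exact funext fun i => (l.part_remove v hr h i).symm

theorem bdry_levelChain_tree (l : T.Leveling) :
    (Partitions.matching m).bdry K ((l.sign : K) • levelChain K l.tree.part (d + 1)) =
      ∑ v, face K l v := by
  rw [map_smul, bdry_levelChain_of_strict l.isStrict, Finset.sum_range_succ, Finset.sum_range,
    smul_add, Finset.smul_sum, ← Equiv.sum_comp l.1]
  have : levelChain K (fun i => l.tree.part (avoid (d + 1) i)) d = 0 := by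
    rw [levelChain, if_neg]
    intro h
    have h1 := h.2.1
    dsimp only at h1
    rw [show avoid (d + 1) d = d from if_pos (Nat.lt_succ_self d)] at h1
    exact (l.isStrict.2.2 d (Nat.lt_succ_self d)).ne_bot h1
  rw [this, smul_zero, smul_zero, add_zero]
  exact Finset.sum_congr rfl fun v _ => smul_smul _ _ _

/-- The faces where the preceding vertex is not the parent of `v` cancel in pairs. The remaining
ones correspond bijectively, through `remove`, to the levelings of the contracted trees. -/
theorem sum_face : ∑ l : T.Leveling, ∑ v, face K l v = ∑ v : T.verts,
    if hr : v.1 ≠ Finset.univ then (-1 : K) ^ T.position v.1 •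
      ∑ l : (T.contract v.1 v.2 hr).Leveling, (l.sign : K) • levelChain K l.tree.part d
    else 0 := by
  rw [← Fintype.sum_prod_type', ← Finset.sum_filter_add_sum_filter_not _
    fun p : T.Leveling × T.verts => p.2.1 ⊂ (p.1.below p.2).1]
  have hbad : ∑ p ∈ Finset.univ.filter fun p : T.Leveling × T.verts =>
      ¬ p.2.1 ⊂ (p.1.below p.2).1, face K p.1 p.2 = 0 := by
    refine Finset.sum_involution (fun p hp =>
      (p.1.swapBelow p.2 (Finset.mem_filter.1 hp).2, p.1.below p.2)) (fun p hp => ?_)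
      (fun p hp hne he => ?_) (fun p hp => ?_) (fun p hp => ?_)
    · exact face_swapBelow _ _ (Finset.mem_filter.1 hp).2
    -- A fixed point of the exchange has `v` as its own predecessor, which only happens on level
    -- `0`, where the face is zero.
    · refine hne (face_root p.1 (Fin.ext ?_))
      have h1 := p.1.val_below p.2
      have h2 : p.1.below p.2 = p.2 := congrArg Prod.snd he
      rw [h2] at h1
      rw [Fin.val_zero]
      omega
    · refine Finset.mem_filter.2 ⟨Finset.mem_univ _, ?_⟩
      rw [below_swapBelow]
      exact not_below_ssubset _ _
    · exact Prod.ext (swapBelow_swapBelow _ _ (Finset.mem_filter.1 hp).2 (by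
        rw [below_swapBelow]
        exact not_below_ssubset _ _))
        (below_swapBelow _ _ (Finset.mem_filter.1 hp).2)
  rw [hbad, add_zero, Finset.sum_filter, Fintype.sum_prod_type_right]
  refine Finset.sum_congr rfl fun v _ => ?_
  split_ifs with hr
  · rw [← Finset.sum_filter, Finset.smul_sum]
    refine Finset.sum_bij (fun l _ => l.remove v hr) (fun _ _ => Finset.mem_univ _)
      (fun l hl l' hl' he => ?_) (fun l' _ => ?_) (fun l hl => ?_)
    · exact remove_injOn v hr (Finset.mem_filter.1 hl).2 (Finset.mem_filter.1 hl').2 he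
    · obtain ⟨l, h1, h2⟩ := exists_remove_eq v hr l'
      exact ⟨l, Finset.mem_filter.2 ⟨Finset.mem_univ _, h1⟩, h2⟩
    · exact face_of_ssubset l v hr (Finset.mem_filter.1 hl).2
  · refine Finset.sum_eq_zero fun l _ => if_neg fun h => hr fun e => ?_
    exact h.2 (e ▸ Finset.subset_univ _)

end SymmOperad.RTree.Leveling

/-! ### The levelization is a morphism of complexes. -/

namespace SymmOperad

open Classical Partitions

variable {K : Type u} [CommRing K]

theorem levelize_basis {n d : ℕ} (T : RTree n d) :
    levelize (commutative K) n d (barBasis K T) =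
      ∑ l : T.Leveling, (l.sign : K) • sbarBasis K l.tree := by
  unfold levelize barBasis
  rw [DirectSum.toModule_lof, LinearMap.sum_apply]
  refine Finset.sum_congr rfl fun l _ => ?_
  rw [LinearMap.smul_apply, LinearMap.comp_apply, RTree.Leveling.tensorMap_one]
  rfl

theorem normChain_levelization_basis {m d : ℕ} (T : RTree (m + 1) d) :
    normChain K m d (levelization (commutative K) (m + 1) d (barBasis K T)) =
      ∑ l : T.Leveling, (l.sign : K) • levelChain K l.tree.part d := by
  change sbarChain K m d (levelize (commutative K) (m + 1) d (barBasis K T)) = _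
  simp only [levelize_basis, map_sum, map_smul, sbarChain_basis]

/-- It suffices to compare chains of partitions on basis trees, `normChain` being injective; there
the identity is `sum_face`. -/
theorem normD_levelization (m d : ℕ) :
    normD (commutative K) (m + 1) d (degenerate_le_comap m d) ∘ₗ
        levelization (commutative K) (m + 1) (d + 1) =
      levelization (commutative K) (m + 1) d ∘ₗ barD (commutative K) (m + 1) d := by
  refine bar_hom_ext fun T => normChain_injective m d ?_
  rw [LinearMap.comp_apply, ← bdry_normChain, normChain_levelization_basis, map_sum,
    Finset.sum_congr rfl fun l _ => RTree.Leveling.bdry_levelChain_tree l,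
    RTree.Leveling.sum_face, LinearMap.comp_apply, barD_basis, map_sum, map_sum]
  refine Finset.sum_congr rfl fun v _ => ?_
  split_ifs with hr
  · rw [map_smul, map_smul, normChain_levelization_basis]
  · rw [map_zero, map_zero]

end SymmOperad

/-! ## Critical cells -/

namespace SymmOperad.RTree.Leveling

open Classical Partitions

section Chains

variable {n d : ℕ} {T : RTree n d} {a : Fin n}

theorem lt_iff_ssubset (hT : ∀ v ∈ T.verts, a ∈ v) (l : T.Leveling) (v w : T.verts) :
    l.1 w < l.1 v ↔ v.1 ⊂ w.1 := by
  refine ⟨fun h => ?_, l.2 v w⟩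
  rcases trichotomy (Or.inl v.2) (Or.inl w.2) (hT v v.2) (hT w w.2) with e | h' | h'
  · rw [Subtype.ext e] at h
    exact absurd h (lt_irrefl _)
  · exact h'
  · exact absurd h (l.2 w v h').not_gt

/-- Vertices with a common entry are nested, so the tree order is total and leaves no freedom for
the levels. -/
theorem val_eq_card (hT : ∀ v ∈ T.verts, a ∈ v) (l : T.Leveling) (v : T.verts) :
    (l.1 v : ℕ) = (Finset.univ.filter fun w : T.verts => v.1 ⊂ w.1).card := by
  rw [← card_lt]
  simp only [lt_iff_ssubset hT]

theorem subsingleton_of_forall_mem (hT : ∀ v ∈ T.verts, a ∈ v) : Subsingleton T.Leveling :=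
  ⟨fun l l' => ext_val fun v => by rw [val_eq_card hT, val_eq_card hT]⟩

theorem nonempty_of_forall_mem (hT : ∀ v ∈ T.verts, a ∈ v) : Nonempty T.Leveling := by
  have hlt : ∀ v w : T.verts, v.1 ⊂ w.1 → (Finset.univ.filter fun u : T.verts => w.1 ⊂ u.1).card <
      (Finset.univ.filter fun u : T.verts => v.1 ⊂ u.1).card := fun v w h => by
    refine Finset.card_lt_card ((Finset.ssubset_iff_of_subset fun u hu => ?_).2 ⟨w, ?_, ?_⟩)
    · exact Finset.mem_filter.2 ⟨Finset.mem_univ _, h.trans (Finset.mem_filter.1 hu).2⟩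
    · exact Finset.mem_filter.2 ⟨Finset.mem_univ _, h⟩
    · exact fun h' => (Finset.mem_filter.1 h').2.ne rfl
  refine ⟨ofInjective T (fun v => (Finset.univ.filter fun w : T.verts => v.1 ⊂ w.1).card)
    (fun v => ?_) (fun v w e => ?_) hlt⟩
  · have h := Finset.card_lt_univ_of_notMem
      (s := Finset.univ.filter fun w : T.verts => v.1 ⊂ w.1) (x := v) (by simp)
    rwa [Fintype.card_coe, T.card_verts] at h
  · rcases trichotomy (Or.inl v.2) (Or.inl w.2) (hT v v.2) (hT w w.2) with h | h | h
    · exact Subtype.ext h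
    · exact absurd e (hlt v w h).ne'
    · exact absurd e (hlt w v h).ne

end Chains

variable {m d : ℕ} {T : RTree (m + 1) d}

theorem base_part (hT : ∀ v ∈ T.verts, 0 ∈ v) (l : T.Leveling) (v : T.verts) :
    base (l.tree.part (l.1 v)) = v.1 :=
  (eq_base (l.mem_part v) (hT v v.2)).symm

theorem isComb_part (hT : ∀ v ∈ T.verts, 0 ∈ v) (l : T.Leveling) (i : ℕ) :
    IsComb (l.tree.part i) := fun _ hc h0 =>
  ((l.mem_part_iff.1 hc).1.or).resolve_left fun h => h0 (hT _ h)

/-- A vertex avoiding `0` would be a block with at least two entries in the partition of its own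
level. -/
theorem forall_mem_of_isComb {l : T.Leveling} (h : ∀ i < d, IsComb (l.tree.part i)) :
    ∀ v ∈ T.verts, 0 ∈ v := fun v hv => by
  by_contra h0
  have h1 := h (l.1 ⟨v, hv⟩) (Fin.is_lt _) v (l.mem_part ⟨v, hv⟩) h0
  have := T.two_le v hv
  omega

theorem image_base (hT : ∀ v ∈ T.verts, 0 ∈ v) (l : T.Leveling) :
    ((Finset.range d).image l.tree.part).image base = T.verts := by
  ext c
  simp only [Finset.mem_image, Finset.mem_range, exists_exists_and_eq_and]
  constructor
  · rintro ⟨i, hi, rfl⟩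
    obtain ⟨v, hv⟩ := l.1.surjective ⟨i, hi⟩
    have h := base_part hT l v
    rw [hv] at h
    rw [h]
    exact v.2
  · exact fun hc => ⟨l.1 ⟨c, hc⟩, Fin.is_lt _, base_part hT l ⟨c, hc⟩⟩

theorem critical_image_iff {T : RTree (m + 1) m} (l : T.Leveling) :
    (Partitions.matching m).Critical ((Finset.range m).image l.tree.part) ↔
      ∀ v ∈ T.verts, 0 ∈ v := by
  rw [Partitions.critical_iff]
  refine ⟨fun h => forall_mem_of_isComb fun i hi => h.2.2 _ (Finset.mem_image_of_mem _
    (Finset.mem_range.2 hi)), fun h => ⟨l.isStrict.isFamily, l.isStrict.card_image, ?_⟩⟩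
  intro π hπ
  obtain ⟨i, -, rfl⟩ := Finset.mem_image.1 hπ
  exact isComb_part h l i

/-- Being critical is a property of the chain, so the vertices of `T'` contain `0` too; both trees
are then recovered from the chain as the set of its blocks of `0`. -/
theorem eq_of_image_eq {T T' : RTree (m + 1) m} (l : T.Leveling) (l' : T'.Leveling)
    (hT : ∀ v ∈ T.verts, 0 ∈ v)
    (h : (Finset.range m).image l'.tree.part = (Finset.range m).image l.tree.part) : T' = T := by
  have h1 := (critical_image_iff l).2 hT
  rw [← h] at h1
  apply verts_injective
  rw [← image_base hT l, ← image_base ((critical_image_iff l').1 h1) l', h]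

/-- The critical chains of partitions are associated to the levelings of the trees formed by a
chain of vertices. -/
theorem exists_of_critical {G : Finset (Part m)} (hG : (Partitions.matching m).Critical G) :
    ∃ (T : RTree (m + 1) m) (l : T.Leveling), (∀ v ∈ T.verts, 0 ∈ v) ∧
      (Finset.range m).image l.tree.part = G := by
  obtain ⟨⟨h1, h2, h3⟩, hc, hcomb⟩ := Partitions.critical_iff.1 hG
  have hinj : Set.InjOn base (G : Set (Part m)) := fun π hπ σ hσ h =>
    (hcomb π hπ).ext (hcomb σ hσ) h
  -- The vertices are the blocks of `0` of the members of `G`; there are `m` of them because combs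
  -- are determined by these blocks.
  let T : RTree (m + 1) m :=
    { verts := G.image base
      card_verts := by rw [Finset.card_image_of_injOn hinj, hc]
      two_le := fun v hv => by
        obtain ⟨π, hπ, rfl⟩ := Finset.mem_image.1 hv
        by_contra hlt
        have hpos := Finset.card_pos.2 ⟨0, zero_mem_base π⟩
        obtain ⟨a, ha⟩ := Finset.card_eq_one.1 (show (base π).card = 1 by omega)
        have h0 := zero_mem_base π
        rw [ha, Finset.mem_singleton] at h0
        have : π = ⊥ := (hcomb π hπ).ext isComb_bot (by rw [base_bot, ha, h0])
        exact h2 (this ▸ hπ)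
      laminar := fun v hv w hw => by
        obtain ⟨π, hπ, rfl⟩ := Finset.mem_image.1 hv
        obtain ⟨σ, hσ, rfl⟩ := Finset.mem_image.1 hw
        exact (h1 π hπ σ hσ).imp base_mono fun h => Or.inl (base_mono h)
      root := h3.imp (fun h => Finset.mem_image.2 ⟨⊤, h, base_top⟩) fun h => by omega }
  have hT : ∀ v ∈ T.verts, 0 ∈ v := fun v hv => by
    obtain ⟨π, -, rfl⟩ := Finset.mem_image.1 hv
    exact zero_mem_base π
  obtain ⟨l⟩ := nonempty_of_forall_mem hT
  refine ⟨T, l, hT, ?_⟩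
  refine Finset.eq_of_subset_of_card_le (fun π hπ => ?_) (by rw [l.isStrict.card_image, hc])
  have h4 : base π ∈ G.image base := by
    change _ ∈ T.verts
    rw [← image_base hT l]
    exact Finset.mem_image_of_mem _ hπ
  obtain ⟨i, -, rfl⟩ := Finset.mem_image.1 hπ
  obtain ⟨σ, hσ, h5⟩ := Finset.mem_image.1 h4
  rw [← (hcomb σ hσ).ext (isComb_part hT l i) h5]
  exact hσ

variable {K : Type u} [CommRing K]

theorem sign_mul_sign {n d : ℕ} {T : RTree n d} (l : T.Leveling) : (l.sign : K) * l.sign = 1 := by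
  unfold sign
  rw [← mul_pow]
  simp

/-- The levelization morphism identifies the critical components up to a sign. -/
theorem normChain_levelization_apply {T : RTree (m + 1) m} (l : T.Leveling)
    (hT : ∀ v ∈ T.verts, 0 ∈ v) (x : Bar (commutative K) (m + 1) m) :
    normChain K m m (levelization (commutative K) (m + 1) m x)
        ((Finset.range m).image l.tree.part) = l.sign * barChain K (m + 1) m x T.verts := by
  induction x using bar_induction with
  | zero => simp
  | smul c S =>
    rw [map_smul, map_smul, map_smul, normChain_levelization_basis, barChain_basis,
      Finsupp.smul_apply, Finsupp.smul_apply, Finsupp.finsetSum_apply]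
    have hterm : ∀ l' : S.Leveling, ((l'.sign : K) • levelChain K l'.tree.part m)
        ((Finset.range m).image l.tree.part) = if (Finset.range m).image l'.tree.part =
          (Finset.range m).image l.tree.part then l'.sign else 0 := fun l' => by
      rw [levelChain, if_pos l'.isStrict, Finsupp.smul_single, smul_eq_mul, mul_one,
        Finsupp.single_apply]
    -- The tree `T` has a single leveling, hence contributes one sign; no other tree has a leveling
    -- with the same critical chain.
    by_cases hS : S = T
    · subst hS
      have := subsingleton_of_forall_mem hT
      rw [Fintype.sum_subsingleton _ l, hterm, if_pos rfl, Finsupp.single_eq_same, smul_eq_mul,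
        smul_eq_mul]
      ring
    · rw [Finset.sum_eq_zero fun l' _ => ?_, Finsupp.single_eq_of_ne, smul_zero, mul_zero]
      · exact fun e => hS (verts_injective e.symm)
      · rw [hterm, if_neg fun e => hS (eq_of_image_eq l l' hT e)]
  | add x y hx hy =>
    rw [map_add, map_add, map_add, Finsupp.add_apply, hx, hy, Finsupp.add_apply, mul_add]

end SymmOperad.RTree.Leveling

/-! ## The levelization morphism is a quasi-isomorphism -/

namespace SymmOperad

open Classical Partitions RTree

variable {K : Type u} [CommRing K]

theorem map_mem_cyclesOf {X Y : ℕ → Type u} [∀ i, AddCommGroup (X i)] [∀ i, Module K (X i)]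
    [∀ i, AddCommGroup (Y i)] [∀ i, Module K (Y i)] {dX : ∀ i, X (i + 1) →ₗ[K] X i}
    {dY : ∀ i, Y (i + 1) →ₗ[K] Y i} {f : ∀ i, X i →ₗ[K] Y i}
    (comm : ∀ i, dY i ∘ₗ f (i + 1) = f i ∘ₗ dX i) {i : ℕ} {x : X i} (hx : x ∈ cyclesOf dX i) :
    f i x ∈ cyclesOf dY i := by
  cases i with
  | zero => trivial
  | succ i =>
    refine LinearMap.mem_ker.2 ?_
    have := LinearMap.congr_fun (comm i) x
    rw [LinearMap.comp_apply, LinearMap.comp_apply, LinearMap.mem_ker.1 hx, map_zero] at this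
    exact this

/-- A cycle of top degree is determined by its critical coefficients, and up to sign these are
coefficients of its levelization. -/
theorem eq_zero_of_levelization_eq_zero {m : ℕ} {x : Bar (commutative K) (m + 1) m}
    (hx : x ∈ cyclesOf (K := K) (X := fun d => Bar (commutative K) (m + 1) d)
      (barD (commutative K) (m + 1)) m)
    (h : levelization (commutative K) (m + 1) m x = 0) : x = 0 := by
  refine (barModel K m).eq_zero_of_crit hx (Finsupp.ext fun F => ?_)
  rw [CellMatching.crit_apply, Finsupp.zero_apply]
  split_ifs with hF
  · obtain ⟨h1, h2, h3⟩ := RTree.critical_iff.1 hF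
    obtain ⟨l⟩ := Leveling.nonempty_of_forall_mem (T := ofFamily h1 h2) h3
    have h4 := Leveling.normChain_levelization_apply l h3 x
    rw [h, map_zero, Finsupp.zero_apply] at h4
    have h5 := congrArg ((l.sign : K) * ·) h4
    simp only [mul_zero, ← mul_assoc, Leveling.sign_mul_sign, one_mul] at h5
    exact h5.symm
  · rfl

theorem exists_levelization_eq {m : ℕ} {y : NBar (commutative K) (m + 1) m}
    (hy : y ∈ cyclesOf (K := K) (X := fun d => NBar (commutative K) (m + 1) d)
      (fun d => normD (commutative K) (m + 1) d (degenerate_le_comap m d)) m) :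
    ∃ x ∈ cyclesOf (K := K) (X := fun d => Bar (commutative K) (m + 1) d)
      (barD (commutative K) (m + 1)) m, levelization (commutative K) (m + 1) m x = y := by
  -- The coefficient to prescribe on a critical tree is that of `y` on its chain of partitions,
  -- corrected by the sign; it is well defined since the leveling is unique. On other families the
  -- default value `0` is harmless.
  have hc : ∀ F : Finset (Finset (Fin (m + 1))), ∃ c : K, ∀ (T : RTree (m + 1) m)
      (l : T.Leveling), T.verts = F → (∀ v ∈ T.verts, 0 ∈ v) →
        c = l.sign * normChain K m m y ((Finset.range m).image l.tree.part) := by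
    intro F
    by_cases h : ∃ T : RTree (m + 1) m, T.verts = F ∧ (∀ v ∈ T.verts, 0 ∈ v) ∧ Nonempty T.Leveling
    · obtain ⟨T, rfl, hT, ⟨l⟩⟩ := h
      refine ⟨l.sign * normChain K m m y ((Finset.range m).image l.tree.part),
        fun T' l' hT' _ => ?_⟩
      obtain rfl := verts_injective hT'
      rw [(Leveling.subsingleton_of_forall_mem hT).elim l l']
    · exact ⟨0, fun T l h1 h2 => absurd ⟨T, h1, h2, ⟨l⟩⟩ h⟩
  choose c hc using hc
  let g : Finset (Finset (Fin (m + 1))) →₀ K :=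
    Finsupp.equivFunOnFinite.symm fun F => if (RTree.matching m).Critical F then c F else 0
  have hg : ∀ F, g F = if (RTree.matching m).Critical F then c F else 0 := fun F => rfl
  have h1 : g ∈ (RTree.matching m).chains K m := fun F hF => by
    have hF' : (RTree.matching m).Critical F := by
      by_contra hne
      exact Finsupp.mem_support_iff.1 hF (by rw [hg, if_neg hne])
    obtain ⟨h1, h2, -⟩ := RTree.critical_iff.1 hF'
    exact ⟨h1, h2⟩
  have h2 : (RTree.matching m).crit K g = g := by
    ext F
    rw [CellMatching.crit_apply]
    split_ifs with hF
    · rfl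
    · rw [hg, if_neg hF]
  obtain ⟨x, hx, hxg⟩ := (barModel K m).exists_cycle h1 h2
  refine ⟨x, hx, ?_⟩
  have hfx := map_mem_cyclesOf (X := fun d => Bar (commutative K) (m + 1) d)
    (Y := fun d => NBar (commutative K) (m + 1) d)
    (dY := fun d => normD (commutative K) (m + 1) d (degenerate_le_comap m d))
    (f := levelization (commutative K) (m + 1)) (fun i => normD_levelization m i) hx
  -- The difference is a cycle of top degree, so it is enough to see that its critical coefficients
  -- vanish; each critical chain comes from a critical tree.
  refine sub_eq_zero.1 ((normModel K m).eq_zero_of_crit (sub_mem hfx hy) (Finsupp.ext fun G => ?_))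
  rw [CellMatching.crit_apply, Finsupp.zero_apply]
  split_ifs with hG
  · obtain ⟨T, l, hT, rfl⟩ := Leveling.exists_of_critical hG
    have hcrit : (RTree.matching m).Critical T.verts :=
      RTree.critical_iff.2 ⟨T.isFamily, T.card_verts, hT⟩
    have h3 : barChain K (m + 1) m x T.verts = c T.verts := by
      have := DFunLike.congr_fun hxg T.verts
      rw [CellMatching.crit_apply, if_pos hcrit, hg, if_pos hcrit] at this
      exact this
    have h4 := Leveling.normChain_levelization_apply l hT x
    rw [h3, hc _ T l rfl hT, ← mul_assoc, Leveling.sign_mul_sign, one_mul] at h4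
    change normChain K m m (levelization (commutative K) (m + 1) m x - y) _ = 0
    rw [map_sub, Finsupp.sub_apply, h4, sub_self]
  · rfl

/-- Both complexes are exact outside degree `m` and zero above it, so only the bijectivity on cycles
of degree `m` matters. -/
theorem barToNorm (n : ℕ) : (commutative K).BarToNormQuasiIso n := by
  rcases n with _ | m
  · refine ⟨fun d x _ => ?_, isQuasiIso_of_elements (fun i => ?_) (fun i => ?_) (fun i => ?_)
      (fun i x _ _ => ?_) (fun i y _ => ?_)⟩
    · rw [Subsingleton.elim x 0]
      exact Submodule.zero_mem _
    · exact LinearMap.ext fun _ => Subsingleton.elim _ _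
    · exact LinearMap.ext fun _ => Subsingleton.elim _ _
    · exact LinearMap.ext fun _ => Subsingleton.elim _ _
    · exact ⟨0, Subsingleton.elim _ _⟩
    · exact ⟨0, Submodule.zero_mem _, 0, Subsingleton.elim _ _⟩
  · refine ⟨degenerate_le_comap m, isQuasiIso_of_elements (fun i => (barModel K m).d_comp_d i)
      (fun i => (normModel K m).d_comp_d i) (normD_levelization m) (fun i x hx => ?_)
      (fun i y hy => ?_)⟩
    · rintro ⟨y, hy⟩
      by_cases hi : i = m
      · subst hi
        refine ⟨0, ?_⟩
        rw [(normModel K i).eq_zero_of_lt (Nat.lt_succ_self i) y, map_zero] at hy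
        rw [map_zero, eq_zero_of_levelization_eq_zero hx hy.symm]
      · exact (barModel K m).exists_primitive hi hx
    · by_cases hi : i = m
      · subst hi
        obtain ⟨x, hx, rfl⟩ := exists_levelization_eq hy
        exact ⟨x, hx, 0, by rw [map_zero, sub_self]⟩
      · obtain ⟨z, hz⟩ := (normModel K m).exists_primitive hi hy
        exact ⟨0, Submodule.zero_mem _, z, by rw [hz, map_zero, sub_zero]⟩

end SymmOperad

theorem mainTheorem2 (K : Type u) [CommRing K] :
    (SymmOperad.commutativeWeight K).IsKoszul ∧
      ∀ n : ℕ, (SymmOperad.commutativeWeight K).KoszulToBarQuasiIso n ∧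
        (SymmOperad.commutative K).BarToNormQuasiIso n :=
  ⟨SymmOperad.commutative_isKoszul, fun n => ⟨SymmOperad.koszulToBar n, SymmOperad.barToNorm n⟩⟩
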